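/- **Setting.** A *box space* is $X=\bigsqcup_{i\in\mathbb N}X_i$, where the $X_i$ are finite (simple, not necessarily connected) graphs of uniformly bounded degree with $|X_i|\to\infty$; $d$ denotes the graph metric on connected components and $d=\infty$ between different components. $\mathbb C[X]$ is the $*$-algebra of $X\times X$-matrices with bounded entries and finite propagation, and $C^*_{u,\max}(X)$ is its completion in the supremum of the norms of all its unital $*$-representations on Hilbert spaces. The coarse groupoid is $G(X)=\bigcup_{R}\overline{\{(x,y): d(x,y)\le R\}}\subseteq\beta X\times\beta X$, with the weak topology of this union and the pair groupoid operations; restriction of the continuous extension to $G(X)|_Z$ maps $\mathbb C[X]\cong C_c(G(X))$ to $C_c(G(X)|_Z)$ for every closed invariant $Z\subseteq\beta X$, and $C^*_{\max}(G(X)|_Z)$ is the completion of the latter in the supremum of the norms of all its unital $*$-representations. For $Y_i\subseteq X_i$ and $Y=\bigcup_iY_i$ let $\mathrm{core}(Y)=\partial\beta X\setminus \mathrm{sat}(\partial\beta (X\setminus Y))$, where $\partial\beta X=\beta X\setminus X$, $\partial\beta A=\overline A\cap\partial\beta X$ for $A\subseteq X$, and $\mathrm{sat}(A)=\{x\in\beta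 X:(a,x)\in G(X)\text{ for some }a\in A\}$ for $A\subseteq\beta X$. Let $\Delta\in\mathbb C[X]$ be the graph Laplacian, $(\Delta f)(x)=\sum_{y\sim x}(f(x)-f(y))$. An element $a$ has *spectral gap at least* $c>0$ in a $C^*$-algebra if its spectrum there is contained in $\{0\}\cup[c,\infty)$. $X$ has *geometric property (T)* if $\Delta$ has spectral gap at least some $c>0$ in $C^*_{u,\max}(X)$, and *almost boundary (T) with respect to $Z=\mathrm{core}(Y)$* (for $|Y_i|/|X_i|\to1$) if the image of $\Delta$ has spectral gap at least some $c>0$ in $C^*_{\max}(G(X)|_Z)$. For $x\in X$ the *linking graph* $L_x$ is the graph induced on the set of neighbours of $x$ (the empty graph counts as connected). Let $\tau(x,y)$ be the number of triangles of $X$ containing the edge $(x,y)$ (and $0$ if $x\not\sim y$). Let $\lambda_1(L_x)$ be the smallest positive eigenvalue ($+\infty$ if there is none) of the operator $(\Delta^{L_x}f)(y)=f(y)-\sum_{z\sim y}\frac1{\tau(x,y)}f(z)$ on functions on $L_x$, the sum being over the neighbours $z$ of $y$ in $L_x$. Let $\Delta_\tau\in\mathbb C[X]$ be given by $(\Delta_\tau\eta)(x)=\sum_{y\sim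 x}(\eta(x)-\eta(y))\,\tau(x,y)$. **Theorem.** Let $X=\bigsqcup_iX_i$ be a box space of graphs such that every linking graph $L_x$, $x\in X$, is connected. Suppose that there are $Y_i\subseteq X_i$ with $|Y_i|/|X_i|\to1$ and $\lambda>\frac12$ such that $\lambda_1(L_x)\ge\lambda$ for all $i$ and all $x\in Y_i$. Put $c=2-1/\lambda>0$. 1. $X$ has almost boundary (T) with respect to $Z=\mathrm{core}(Y)$. Moreover the image of $\Delta_\tau$ in $C^*_{\max}(G(X)|_{Z})$ has spectral gap at least $c$, and the image of $\Delta_\tau^2-c\Delta_\tau$ in $C_c(G(X)|_{Z})$ is a finite sum of elements $S^*S$ with $S\in C_c(G(X)|_Z)$. 2. If $Y_i=X_i$ for all $i$, then $X$ has geometric property (T). Moreover $\Delta_\tau$ has spectral gap at least $c$ in $C^*_{u,\max}(X)$, and $\Delta_\tau^2-c\Delta_\tau$ is a finite sum of elements $S^*S$ with $S\in\mathbb C[X]$. -/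

import Mathlib

open Filter Topology
open scoped ENNReal CompactlySupported

universe u

/-! ### Kernels with finite rows and columns -/

/-- The complex `P × P`-matrices with finitely many nonzero entries in each row and each column. -/
def lfSubmodule (P : Type u) : Submodule ℂ (P → P → ℂ) where
  carrier := {k | (∀ p, {q | k p q ≠ 0}.Finite) ∧ ∀ q, {p | k p q ≠ 0}.Finite}
  add_mem' := by
    rintro a b ⟨ha, ha'⟩ ⟨hb, hb'⟩
    refine ⟨fun p => ((ha p).union (hb p)).subset ?_, fun q => ((ha' q).union (hb' q)).subset ?_⟩
    · intro q hq
      by_contra h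
      simp only [Set.mem_union, Set.mem_ofPred_eq, not_or, not_not] at h
      exact hq (by simp [h.1, h.2])
    · intro p hq
      by_contra h
      simp only [Set.mem_union, Set.mem_ofPred_eq, not_or, not_not] at h
      exact hq (by simp [h.1, h.2])
  zero_mem' := by simp
  smul_mem' := by
    rintro c a ⟨ha, ha'⟩
    refine ⟨fun p => (ha p).subset ?_, fun q => (ha' q).subset ?_⟩
    · intro q hq h
      exact hq (by simp [h])
    · intro p hq h
      exact hq (by simp [h])

/-- The ⋆-algebra of row- and column-finite matrices, with matrix product and conjugate
transpose. -/
def LFKernel (P : Type u) : Type u := ↥(lfSubmodule P)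

namespace LFKernel

variable {P : Type u}

noncomputable instance : AddCommGroup (LFKernel P) := inferInstanceAs (AddCommGroup ↥(lfSubmodule P))
noncomputable instance : Module ℂ (LFKernel P) := inferInstanceAs (Module ℂ ↥(lfSubmodule P))

instance : CoeFun (LFKernel P) (fun _ => P → P → ℂ) := ⟨fun k => k.1⟩

@[ext] theorem ext {a b : LFKernel P} (h : ∀ p q, a p q = b p q) : a = b :=
  Subtype.ext (funext fun p => funext fun q => h p q)

theorem row_finite (a : LFKernel P) (p : P) : {q | a p q ≠ 0}.Finite := a.2.1 p
theorem col_finite (a : LFKernel P) (q : P) : {p | a p q ≠ 0}.Finite := a.2.2 q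

@[simp] theorem add_apply (a b : LFKernel P) (p q : P) : (a + b) p q = a p q + b p q := rfl
@[simp] theorem zero_apply (p q : P) : (0 : LFKernel P) p q = 0 := rfl
@[simp] theorem smul_apply (c : ℂ) (a : LFKernel P) (p q : P) : (c • a) p q = c * a p q := rfl
@[simp] theorem neg_apply (a : LFKernel P) (p q : P) : (-a) p q = -a p q := rfl
@[simp] theorem sub_apply (a b : LFKernel P) (p q : P) : (a - b) p q = a p q - b p q := rfl

theorem exists_ne_of_finsum_ne_zero {P : Type u} {f g : P → ℂ} (h : ∑ᶠ r, f r * g r ≠ 0) :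
    ∃ r, f r ≠ 0 ∧ g r ≠ 0 := by
  by_contra! hc
  refine h ?_
  rw [← finsum_zero (α := P)]
  congr 1
  funext r
  by_cases hr : f r = 0
  · simp [hr]
  · simp [hc r hr]

/-- The matrix product. -/
noncomputable instance : Mul (LFKernel P) where
  mul a b := ⟨fun p q => ∑ᶠ r, a p r * b r q, by
    constructor
    · intro p
      refine ((a.row_finite p).biUnion fun r _ => b.row_finite r).subset ?_
      intro q hq
      obtain ⟨r, h1, h2⟩ := exists_ne_of_finsum_ne_zero hq
      exact Set.mem_biUnion (show r ∈ {r | a p r ≠ 0} from h1) h2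
    · intro q
      refine ((b.col_finite q).biUnion fun r _ => a.col_finite r).subset ?_
      intro p hq
      obtain ⟨r, h1, h2⟩ := exists_ne_of_finsum_ne_zero hq
      exact Set.mem_biUnion (show r ∈ {r | b r q ≠ 0} from h2) h1⟩

open scoped Classical in
/-- The identity matrix. -/
noncomputable instance : One (LFKernel P) where
  one := ⟨fun p q => if p = q then 1 else 0, by
    constructor
    · intro p
      refine (Set.finite_singleton p).subset fun q hq => ?_
      by_contra h
      exact hq (if_neg fun h' => h h'.symm)
    · intro q
      refine (Set.finite_singleton q).subset fun p hq => ?_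
      by_contra h
      exact hq (if_neg h)⟩

/-- The conjugate transpose. -/
noncomputable instance : Star (LFKernel P) where
  star a := ⟨fun p q => (starRingEnd ℂ) (a q p), by
    constructor
    · intro p
      exact (a.col_finite p).subset fun q hq h => hq (by simp [h])
    · intro q
      exact (a.row_finite q).subset fun p hq h => hq (by simp [h])⟩

theorem mul_apply (a b : LFKernel P) (p q : P) : (a * b) p q = ∑ᶠ r, a p r * b r q := rfl

open scoped Classical in
theorem one_apply (p q : P) : (1 : LFKernel P) p q = if p = q then 1 else 0 := rfl

@[simp] theorem star_apply (a : LFKernel P) (p q : P) : (star a) p q = (starRingEnd ℂ) (a q p) :=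
  rfl

theorem mul_apply_left (a b : LFKernel P) (p q : P) :
    (a * b) p q = ∑ r ∈ (a.row_finite p).toFinset, a p r * b r q := by
  rw [mul_apply]
  refine finsum_eq_sum_of_support_subset _ fun r hr => ?_
  simp only [Set.Finite.coe_toFinset, Set.mem_ofPred_eq]
  exact fun h => hr (by simp [h])

theorem mul_apply_right (a b : LFKernel P) (p q : P) :
    (a * b) p q = ∑ r ∈ (b.col_finite q).toFinset, a p r * b r q := by
  rw [mul_apply]
  refine finsum_eq_sum_of_support_subset _ fun r hr => ?_
  simp only [Set.Finite.coe_toFinset, Set.mem_ofPred_eq]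
  exact fun h => hr (by simp [h])

theorem mul_apply_of_subset (a b : LFKernel P) (p q : P) (s : Finset P)
    (hs : ∀ r, a p r ≠ 0 → b r q ≠ 0 → r ∈ s) : (a * b) p q = ∑ r ∈ s, a p r * b r q := by
  rw [mul_apply]
  refine finsum_eq_sum_of_support_subset _ fun r hr => ?_
  exact hs r (fun h => hr (by simp [h])) (fun h => hr (by simp [h]))

noncomputable instance : Ring (LFKernel P) where
  __ := (inferInstance : AddCommGroup (LFKernel P))
  mul := (· * ·)
  one := 1
  left_distrib a b c := by
    ext p q
    simp only [mul_apply_left, add_apply, mul_add, Finset.sum_add_distrib]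
  right_distrib a b c := by
    ext p q
    simp only [mul_apply_right, add_apply, add_mul, Finset.sum_add_distrib]
  zero_mul a := by
    ext p q
    simp [mul_apply_right]
  mul_zero a := by
    ext p q
    simp [mul_apply_left]
  mul_assoc a b c := by
    ext p q
    rw [mul_apply_right, mul_apply_left a]
    simp_rw [mul_apply_left a b, mul_apply_right b c, Finset.mul_sum, Finset.sum_mul]
    rw [Finset.sum_comm]
    simp only [mul_assoc]
  one_mul a := by
    classical
    ext p q
    rw [mul_apply_of_subset _ _ _ _ {p} fun r hr _ => ?_]
    · simp [one_apply]
    · by_contra h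
      exact hr (if_neg fun h' => h (by simp [h']))
  mul_one a := by
    classical
    ext p q
    rw [mul_apply_of_subset _ _ _ _ {q} fun r _ hr => ?_]
    · simp [one_apply]
    · by_contra h
      exact hr (if_neg fun h' => h (by simp [h']))
  neg_add_cancel := neg_add_cancel
  zsmul := (· • ·)
  zsmul_zero' := SubNegMonoid.zsmul_zero'
  zsmul_succ' := SubNegMonoid.zsmul_succ'
  zsmul_neg' := SubNegMonoid.zsmul_neg'

noncomputable instance : Algebra ℂ (LFKernel P) := Algebra.ofModule
  (fun c a b => by
    ext p q
    rw [smul_apply, mul_apply_right, mul_apply_right, Finset.mul_sum]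
    simp only [smul_apply, mul_assoc])
  (fun c a b => by
    ext p q
    rw [smul_apply, mul_apply_left, mul_apply_left, Finset.mul_sum]
    refine Finset.sum_congr rfl fun r _ => ?_
    simp only [smul_apply]
    ring)

noncomputable instance : StarRing (LFKernel P) where
  star_involutive a := by
    ext p q
    simp
  star_mul a b := by
    ext p q
    rw [star_apply, mul_apply, mul_apply]
    rw [show ((starRingEnd ℂ) (∑ᶠ r, a q r * b r p)) = ∑ᶠ r, (starRingEnd ℂ) (a q r * b r p) from
      AddMonoidHom.map_finsum (starRingEnd ℂ : ℂ →+* ℂ).toAddMonoidHom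
        ((a.row_finite q).subset fun r hr h => hr (by simp [h]))]
    refine finsum_congr fun r => ?_
    simp [mul_comm]
  star_add a b := by
    ext p q
    simp

noncomputable instance : StarModule ℂ (LFKernel P) where
  star_smul c a := by
    ext p q
    simp

end LFKernel

/-! ### Maximal C*-completions -/

/-- A representation of a unital ⋆-algebra `A`: a unital ⋆-homomorphism to the bounded operators
on a nonzero complex Hilbert space. Hilbert spaces in the universe of `A` suffice for the maximal
norm, since a cyclic representation lives on a completion of a quotient of `A`. -/
structure StarRep (A : Type u) [Ring A] [StarRing A] [Algebra ℂ A] where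
  H : Type u
  [normed : NormedAddCommGroup H]
  [innerProduct : InnerProductSpace ℂ H]
  [complete : CompleteSpace H]
  [nontrivial : Nontrivial H]
  π : A →⋆ₐ[ℂ] (H →L[ℂ] H)

attribute [instance] StarRep.normed StarRep.innerProduct StarRep.complete StarRep.nontrivial

/-- The supremum of `‖π a‖` over all representations `π` is finite, for each `a`. -/
class MaxNormFinite (A : Type u) [Ring A] [StarRing A] [Algebra ℂ A] : Prop where
  bound : ∀ a : A, ∃ C : ℝ, ∀ ρ : StarRep A, ‖ρ.π a‖ ≤ C

section MaxCStar

variable (A : Type u) [Ring A] [StarRing A] [Algebra ℂ A] [MaxNormFinite A]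

/-- The direct sum of all representations of `A`. -/
noncomputable def universalRep :
    A →⋆ₐ[ℂ] lp (fun ρ : StarRep A => ρ.H →L[ℂ] ρ.H) ∞ where
  toFun a := ⟨fun ρ => ρ.π a, memℓp_infty (by
    obtain ⟨C, hC⟩ := MaxNormFinite.bound a
    exact ⟨C, by rintro _ ⟨ρ, rfl⟩; exact hC ρ⟩)⟩
  map_one' := by ext ρ; simp
  map_mul' a b := by ext ρ; simp
  map_zero' := by ext ρ; simp
  map_add' a b := by
    ext ρ
    simp only [map_add]
    rfl
  commutes' c := by
    ext ρ
    simp only [AlgHomClass.commutes]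
    rfl
  map_star' a := by ext ρ; simp [map_star]

/-- The completion of `A` in the norm `a ↦ sup {‖π a‖ | π a representation of A}`, as the closure
of the image of `A` in the direct sum of all representations. -/
noncomputable def MaxCStar : StarSubalgebra ℂ (lp (fun ρ : StarRep A => ρ.H →L[ℂ] ρ.H) ∞) :=
  (universalRep A).range.topologicalClosure

variable {A}

/-- The image of an element of `A` in the completion. -/
noncomputable def toMax (a : A) : MaxCStar A :=
  ⟨universalRep A a, StarSubalgebra.le_topologicalClosure _ ⟨a, rfl⟩⟩

theorem norm_toMax (a : A) : ‖toMax a‖ = ⨆ ρ : StarRep A, ‖ρ.π a‖ :=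
  lp.norm_eq_ciSup _

/-- The spectrum of `a` in the maximal C*-completion of `A` is contained in `{0} ∪ [c, ∞)`. -/
def HasSpectralGapMax (a : A) (c : ℝ) : Prop :=
  spectrum ℂ (toMax a) ⊆ {0} ∪ (fun r : ℝ => (r : ℂ)) '' Set.Ici c

end MaxCStar

/-- A criterion for the finiteness of the maximal norm on a ⋆-algebra of matrices. -/
theorem maxNormFinite_of_coloring {P : Type u} (S : StarSubalgebra ℂ (LFKernel P))
    (hcol : ∀ a ∈ S, ∃ (N : ℕ) (c : P → Fin N),
      (∀ j, ∃ e ∈ S, (∀ p, c p = j → e p p = 1) ∧ ∀ p q, e p q ≠ 0 → p = q ∧ c p = j) ∧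
      ∀ p q q', a p q ≠ 0 → a p q' ≠ 0 → c q = c q' → q = q')
    (hdiag : ∀ a ∈ S, (∀ p q, p ≠ q → a p q = 0) → (∀ p, (a p p).im = 0) →
      ∃ M : ℝ, ∃ b ∈ S, star b * b = (M : ℂ) • (1 : LFKernel P) - a) :
    MaxNormFinite S := by
  classical
  -- elements with a diagonal square
  have key : ∀ f : S, (∀ p q, p ≠ q → (star f * f : S).1 p q = 0) →
      ∃ C : ℝ, ∀ ρ : StarRep S, ‖ρ.π f‖ ≤ C := by
    intro f hf
    obtain ⟨M, b, hbS, hb⟩ := hdiag (star f * f : S).1 (star f * f : S).2 hf (by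
      intro p
      have h : star (star f * f : S).1 = (star f * f : S).1 := by
        rw [← StarMemClass.coe_star]; simp
      have h2 := congrArg (fun k : LFKernel P => k p p) h
      exact Complex.conj_eq_iff_im.1 h2)
    refine ⟨Real.sqrt M, fun ρ => ContinuousLinearMap.opNorm_le_bound _ (Real.sqrt_nonneg _) ?_⟩
    intro v
    have hb' : star (⟨b, hbS⟩ : S) * ⟨b, hbS⟩ = (M : ℂ) • (1 : S) - star f * f := Subtype.ext hb
    have h1 := congrArg (fun x => ρ.π x) hb'
    simp only [map_mul, map_star, map_sub, map_smul, map_one] at h1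
    have h2 : ∀ T : ρ.H →L[ℂ] ρ.H, inner ℂ v ((star T * T) v) = ((‖T v‖ ^ 2 : ℝ) : ℂ) := by
      intro T
      rw [mul_apply_eq_comp, ContinuousLinearMap.star_eq_adjoint,
        ContinuousLinearMap.adjoint_inner_right, inner_self_eq_norm_sq_to_K]
      push_cast
      rfl
    have h3 := congrArg (fun T : ρ.H →L[ℂ] ρ.H => inner ℂ v (T v)) h1
    simp only [h2, sub_apply, inner_sub_right, smul_apply,
      one_apply_eq_self, inner_smul_right, inner_self_eq_norm_sq_to_K] at h3
    have h4 : ‖ρ.π ⟨b, hbS⟩ v‖ ^ 2 = M * ‖v‖ ^ 2 - ‖ρ.π f v‖ ^ 2 := by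
      have := h3
      simp only [Complex.coe_algebraMap] at this
      exact_mod_cast this
    have h5 : ‖ρ.π f v‖ ^ 2 ≤ M * ‖v‖ ^ 2 := by nlinarith [sq_nonneg ‖ρ.π ⟨b, hbS⟩ v‖]
    have h6 := Real.sqrt_le_sqrt h5
    rwa [Real.sqrt_sq (norm_nonneg _), Real.sqrt_mul' _ (sq_nonneg _),
      Real.sqrt_sq (norm_nonneg _)] at h6
  refine ⟨fun a => ?_⟩
  obtain ⟨N, c, he, hc⟩ := hcol a.1 a.2
  choose e heS he1 he2 using he
  have hsum : a = ∑ j, a * ⟨e j, heS j⟩ := by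
    have h1 : (∑ j, (⟨e j, heS j⟩ : S)) = 1 := by
      apply Subtype.ext
      rw [AddSubmonoidClass.coe_finsetSum]
      have happ : ∀ (p q : P) (s : Finset (Fin N)),
          (∑ j ∈ s, e j : LFKernel P) p q = ∑ j ∈ s, e j p q := by
        intro p q s
        induction s using Finset.induction_on with
        | empty => simp
        | insert j s hj ih => rw [Finset.sum_insert hj, Finset.sum_insert hj, LFKernel.add_apply, ih]
      ext p q
      rw [happ]
      change _ = (1 : LFKernel P) p q
      rw [LFKernel.one_apply]
      split_ifs with h
      · subst h
        rw [Finset.sum_eq_single (c p)]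
        · exact he1 _ p rfl
        · intro j _ hj
          by_contra h
          exact hj (he2 j p p h).2.symm
        · simp
      · refine Finset.sum_eq_zero fun j _ => ?_
        by_contra h'
        exact h (he2 j p q h').1
    rw [← Finset.mul_sum, h1, mul_one]
  have hentry : ∀ j p q, (a * ⟨e j, heS j⟩ : S).1 p q ≠ 0 → a.1 p q ≠ 0 ∧ c q = j := by
    intro j p q h
    obtain ⟨r, h1, h2⟩ := LFKernel.exists_ne_of_finsum_ne_zero h
    obtain ⟨h3, h4⟩ := he2 j r q h2
    subst h3
    exact ⟨h1, h4⟩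
  have hpart : ∀ j, ∃ C : ℝ, ∀ ρ : StarRep S, ‖ρ.π (a * ⟨e j, heS j⟩)‖ ≤ C := by
    intro j
    refine key _ fun p q hpq => ?_
    by_contra h
    obtain ⟨r, h1, h2⟩ := LFKernel.exists_ne_of_finsum_ne_zero h
    have h1' : (a * ⟨e j, heS j⟩ : S).1 r p ≠ 0 := fun h0 => h1 (by
      change (starRingEnd ℂ) ((a * ⟨e j, heS j⟩ : S).1 r p) = 0
      rw [h0, map_zero])
    obtain ⟨h3, h4⟩ := hentry j r p h1'
    obtain ⟨h5, h6⟩ := hentry j r q h2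
    exact hpq (hc r p q h3 h5 (h4.trans h6.symm))
  choose C hC using hpart
  refine ⟨∑ j, C j, fun ρ => ?_⟩
  rw [hsum, map_sum]
  exact (norm_sum_le _ _).trans (Finset.sum_le_sum fun j _ => hC j ρ)

/-! ### Box spaces of graphs -/

/-- A box space of graphs: a sequence of finite graphs of uniformly bounded degree whose numbers
of vertices tend to infinity. The graphs need not be connected. -/
structure BoxSpace where
  V : ℕ → Type u
  finite : ∀ i, Finite (V i)
  graph : ∀ i, SimpleGraph (V i)
  degree_bounded : ∃ d : ℕ, ∀ i (x : V i), ((graph i).neighborSet x).ncard ≤ d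
  card_tendsto : Tendsto (fun i => Nat.card (V i)) atTop atTop

namespace BoxSpace

attribute [instance] BoxSpace.finite

variable (X : BoxSpace.{u})

/-- The disjoint union of the vertex sets. -/
abbrev Pt : Type u := Σ i, X.V i

/-- The disjoint union of the graphs. Its extended graph distance `X.total.edist` is the graph
metric on each connected component and `⊤` between different components. -/
def total : SimpleGraph X.Pt where
  Adj p q := ∃ (i : ℕ) (x y : X.V i), (X.graph i).Adj x y ∧ p = ⟨i, x⟩ ∧ q = ⟨i, y⟩
  symm := ⟨by
    rintro _ _ ⟨i, x, y, h, rfl, rfl⟩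
    exact ⟨i, y, x, h.symm, rfl, rfl⟩⟩
  loopless := ⟨by
    rintro _ ⟨i, x, y, h, h1, h2⟩
    obtain rfl : x = y := by
      have := h1.symm.trans h2
      simpa using this
    exact h.ne rfl⟩

variable {X}

theorem neighborSet_total (i : ℕ) (x : X.V i) :
    X.total.neighborSet ⟨i, x⟩ = Sigma.mk i '' (X.graph i).neighborSet x := by
  ext q
  constructor
  · rintro ⟨j, x', y, h, h1, rfl⟩
    obtain ⟨rfl, h2⟩ := Sigma.mk.inj_iff.1 h1
    obtain rfl := eq_of_heq h2
    exact ⟨y, h, rfl⟩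
  · rintro ⟨y, h, rfl⟩
    exact ⟨i, x, y, h, rfl, rfl⟩

theorem finite_neighborSet (p : X.Pt) : (X.total.neighborSet p).Finite := by
  obtain ⟨i, x⟩ := p
  rw [neighborSet_total]
  exact (Set.toFinite _).image _

noncomputable instance : X.total.LocallyFinite := fun p => (finite_neighborSet p).fintype

theorem exists_degree_le : ∃ d : ℕ, ∀ p : X.Pt, X.total.degree p ≤ d := by
  obtain ⟨d, hd⟩ := X.degree_bounded
  refine ⟨d, fun ⟨i, x⟩ => ?_⟩
  rw [← SimpleGraph.card_neighborSet_eq_degree, ← Set.toFinset_card,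
    ← Set.ncard_eq_toFinset_card', neighborSet_total]
  exact (Set.ncard_image_le (Set.toFinite _)).trans (hd i x)

theorem fst_eq_of_walk {p q : X.Pt} (w : X.total.Walk p q) : p.1 = q.1 := by
  induction w with
  | nil => rfl
  | cons h _ ih =>
    obtain ⟨i, x, y, _, rfl, rfl⟩ := h
    exact ih

theorem exists_walk_of_edist_le {p q : X.Pt} {R : ℕ} (h : X.total.edist p q ≤ R) :
    ∃ w : X.total.Walk p q, w.length ≤ R := by
  have h1 : X.total.Reachable p q := by
    rw [← SimpleGraph.edist_ne_top_iff_reachable]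
    exact ne_top_of_le_ne_top (ENat.natCast_ne_top R) h
  obtain ⟨w, hw⟩ := h1.exists_walk_length_eq_edist
  exact ⟨w, by rw [← hw] at h; exact_mod_cast h⟩

theorem fst_eq_of_edist_le {p q : X.Pt} {R : ℕ} (h : X.total.edist p q ≤ R) : p.1 = q.1 := by
  obtain ⟨w, -⟩ := exists_walk_of_edist_le h
  exact fst_eq_of_walk w

theorem edist_le_trans {p q r : X.Pt} {R S : ℕ} (h : X.total.edist p q ≤ R)
    (h' : X.total.edist q r ≤ S) : X.total.edist p r ≤ (R + S : ℕ) := by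
  push_cast
  exact SimpleGraph.edist_triangle.trans (add_le_add h h')

theorem edist_le_symm {p q : X.Pt} {R : ℕ} (h : X.total.edist p q ≤ R) :
    X.total.edist q p ≤ R := by
  rwa [SimpleGraph.edist_comm]

theorem edist_le_mono {p q : X.Pt} {R S : ℕ} (h : X.total.edist p q ≤ R) (hRS : R ≤ S) :
    X.total.edist p q ≤ S := h.trans (by exact_mod_cast hRS)

/-- Balls of a given radius have uniformly bounded cardinality. -/
theorem exists_ball_bound (R : ℕ) :
    ∃ N : ℕ, ∀ p : X.Pt, ∃ s : Finset X.Pt, s.card ≤ N ∧ ∀ q, X.total.edist p q ≤ R → q ∈ s := by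
  classical
  obtain ⟨d, hd⟩ := X.exists_degree_le
  suffices h : ∃ N : ℕ, ∀ p : X.Pt, ∃ s : Finset X.Pt, s.card ≤ N ∧
      ∀ q, (∃ w : X.total.Walk p q, w.length ≤ R) → q ∈ s by
    obtain ⟨N, hN⟩ := h
    refine ⟨N, fun p => ?_⟩
    obtain ⟨s, hs, hs'⟩ := hN p
    exact ⟨s, hs, fun q hq => hs' q (exists_walk_of_edist_le hq)⟩
  induction R with
  | zero =>
    refine ⟨1, fun p => ⟨{p}, by simp, ?_⟩⟩
    rintro q ⟨w, hw⟩
    have := SimpleGraph.Walk.eq_of_length_eq_zero (Nat.le_zero.1 hw)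
    simp [this]
  | succ R ih =>
    obtain ⟨N, hN⟩ := ih
    choose s hs hs' using hN
    refine ⟨d * N + 1, fun p => ⟨insert p ((X.total.neighborFinset p).biUnion s), ?_, ?_⟩⟩
    · refine (Finset.card_insert_le _ _).trans (Nat.add_le_add_right ?_ 1)
      refine (Finset.card_biUnion_le_card_mul _ _ N fun q _ => hs q).trans ?_
      exact Nat.mul_le_mul_right _ (hd p)
    · rintro q ⟨w, hw⟩
      cases w with
      | nil => simp
      | cons h w =>
        refine Finset.mem_insert_of_mem (Finset.mem_biUnion.2 ⟨_, ?_, hs' _ q ⟨w, ?_⟩⟩)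
        · simpa using h
        · simpa using hw

theorem finite_ball (p : X.Pt) (R : ℕ) : {q | X.total.edist p q ≤ R}.Finite := by
  obtain ⟨N, hN⟩ := X.exists_ball_bound R
  obtain ⟨s, -, hs⟩ := hN p
  exact s.finite_toSet.subset fun q hq => hs q hq

/-- There are finite colourings that separate points at distance at most `R`. -/
theorem exists_coloring (R : ℕ) : ∃ (N : ℕ) (c : X.Pt → Fin N),
    ∀ p q, X.total.edist p q ≤ R → c p = c q → p = q := by
  classical
  obtain ⟨N, hN⟩ := X.exists_ball_bound R
  choose s hs hs' using hN
  have hfin : ∀ t : Finset X.Pt, ∃ c : X.Pt → Fin (N + 1),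
      ∀ p ∈ t, ∀ q ∈ t, X.total.edist p q ≤ R → c p = c q → p = q := by
    intro t
    induction t using Finset.induction_on with
    | empty => exact ⟨fun _ => 0, by simp⟩
    | insert a t ha ih =>
      obtain ⟨c, hc⟩ := ih
      obtain ⟨j, hj⟩ : ∃ j : Fin (N + 1), j ∉ (s a).image c := by
        by_contra! h
        have h1 : (Finset.univ : Finset (Fin (N + 1))) ⊆ (s a).image c := fun j _ => h j
        have h2 := (Finset.card_le_card h1).trans Finset.card_image_le
        rw [Finset.card_univ, Fintype.card_fin] at h2
        exact absurd (h2.trans (hs a)) (by omega)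
      have hj' : ∀ q, X.total.edist a q ≤ R → c q ≠ j := fun q hq h =>
        hj (Finset.mem_image.2 ⟨q, hs' a q hq, h⟩)
      refine ⟨Function.update c a j, ?_⟩
      intro p hp q hq hpq hcol
      rw [Finset.mem_insert] at hp hq
      by_cases hpa : p = a <;> by_cases hqa : q = a
      · rw [hpa, hqa]
      · subst hpa
        rw [Function.update_self, Function.update_of_ne hqa] at hcol
        exact absurd hcol.symm (hj' q hpq)
      · subst hqa
        rw [Function.update_self, Function.update_of_ne hpa] at hcol
        exact absurd hcol (hj' p (edist_le_symm hpq))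
      · rw [Function.update_of_ne hpa, Function.update_of_ne hqa] at hcol
        exact hc p (hp.resolve_left hpa) q (hq.resolve_left hqa) hpq hcol
  have hcomp : ∀ i, {p : X.Pt | p.1 = i}.Finite := by
    intro i
    refine (Set.finite_range (Sigma.mk i : X.V i → X.Pt)).subset ?_
    rintro ⟨j, x⟩ (rfl : j = i)
    exact ⟨x, rfl⟩
  choose c hc using fun i => hfin (hcomp i).toFinset
  refine ⟨N + 1, fun p => c p.1 p, fun p q hpq hcol => ?_⟩
  have h1 := fst_eq_of_edist_le hpq
  refine hc p.1 p (by simp) q (by simp [h1]) hpq ?_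
  exact hcol.trans (by simp only [h1])

/-! ### The algebraic Roe algebra -/

variable (X)

/-- The algebraic (uniform) Roe algebra `ℂ[X]`: the matrices indexed by `X × X` with uniformly
bounded entries and finite propagation. By bounded geometry these are exactly the matrices of the
bounded operators on `ℓ²(X)` of finite propagation (and such matrices are automatically row- and
column-finite). -/
noncomputable def roeAlgebra : StarSubalgebra ℂ (LFKernel X.Pt) where
  carrier := {T | (∃ R : ℕ, ∀ x y, (R : ℕ∞) ≤ X.total.edist x y → T x y = 0) ∧
    ∃ C : ℝ, ∀ x y, ‖T x y‖ ≤ C}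
  mul_mem' := by
    rintro S T ⟨⟨R, hR⟩, C, hC⟩ ⟨⟨R', hR'⟩, C', hC'⟩
    refine ⟨⟨R + R', fun x y h => ?_⟩, ?_⟩
    · by_contra h0
      obtain ⟨z, h1, h2⟩ := LFKernel.exists_ne_of_finsum_ne_zero h0
      have h3 : X.total.edist x z < R := lt_of_not_ge fun h => h1 (hR _ _ h)
      have h4 : X.total.edist z y < R' := lt_of_not_ge fun h => h2 (hR' _ _ h)
      refine absurd (SimpleGraph.edist_triangle (G := X.total) (u := x) (v := z) (w := y)) ?_
      refine not_le_of_gt (lt_of_lt_of_le (ENat.add_lt_add h3 h4) ?_)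
      push_cast at h
      exact h
    · obtain ⟨N, hN⟩ := X.exists_ball_bound R
      refine ⟨N * (|C| * |C'|), fun x y => ?_⟩
      obtain ⟨s, hs, hs'⟩ := hN x
      rw [LFKernel.mul_apply_of_subset S T x y s fun r hr _ => hs' r
        (le_of_not_ge fun h => hr (hR _ _ h))]
      refine (norm_sum_le _ _).trans ((Finset.sum_le_card_nsmul s _ (|C| * |C'|) ?_).trans ?_)
      · intro r _
        rw [norm_mul]
        exact mul_le_mul ((hC _ _).trans (le_abs_self _)) ((hC' _ _).trans (le_abs_self _))
          (norm_nonneg _) (abs_nonneg _)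
      · rw [nsmul_eq_mul]
        exact mul_le_mul_of_nonneg_right (by exact_mod_cast hs) (by positivity)
  add_mem' := by
    rintro S T ⟨⟨R, hR⟩, C, hC⟩ ⟨⟨R', hR'⟩, C', hC'⟩
    refine ⟨⟨max R R', fun x y h => ?_⟩, C + C', fun x y => ?_⟩
    · rw [LFKernel.add_apply, hR, hR', add_zero]
      · exact le_trans (by exact_mod_cast le_max_right R R') h
      · exact le_trans (by exact_mod_cast le_max_left R R') h
    · exact (norm_add_le _ _).trans (add_le_add (hC _ _) (hC' _ _))
  algebraMap_mem' := by
    classical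
    intro c
    have hc : ∀ x y, (algebraMap ℂ (LFKernel X.Pt) c) x y = if x = y then c else 0 := by
      intro x y
      rw [Algebra.algebraMap_eq_smul_one, LFKernel.smul_apply, LFKernel.one_apply]
      simp
    refine ⟨⟨1, fun x y h => ?_⟩, ‖c‖, fun x y => ?_⟩
    · rw [hc, if_neg]
      rintro rfl
      simp at h
    · rw [hc]
      split_ifs <;> simp
  star_mem' := by
    rintro T ⟨⟨R, hR⟩, C, hC⟩
    refine ⟨⟨R, fun x y h => ?_⟩, C, fun x y => ?_⟩
    · rw [LFKernel.star_apply, hR, map_zero]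
      rwa [SimpleGraph.edist_comm]
    · simpa using hC y x

variable {X}

/-- A diagonal matrix. -/
noncomputable def _root_.LFKernel.diag {P : Type u} (h : P → ℂ) : LFKernel P := by
  classical
  exact ⟨fun p q => if p = q then h p else 0,
    fun p => (Set.finite_singleton p).subset fun q hq => by
      by_contra h
      exact hq (if_neg fun h' => h h'.symm),
    fun q => (Set.finite_singleton q).subset fun p hq => by
      by_contra h
      exact hq (if_neg h)⟩

open scoped Classical in
theorem _root_.LFKernel.diag_apply {P : Type u} (h : P → ℂ) (p q : P) :
    LFKernel.diag h p q = if p = q then h p else 0 := rfl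

/-- The square root of `M - a` for a diagonal matrix `a` with real entries bounded by `M`. -/
theorem _root_.LFKernel.star_diag_mul_diag {P : Type u} {a : LFKernel P} {M : ℝ}
    (h0 : ∀ p q, p ≠ q → a p q = 0) (him : ∀ p, (a p p).im = 0) (hM : ∀ p, (a p p).re ≤ M) :
    star (LFKernel.diag fun p => ((Real.sqrt (M - (a p p).re) : ℝ) : ℂ)) *
      LFKernel.diag (fun p => ((Real.sqrt (M - (a p p).re) : ℝ) : ℂ)) =
      (M : ℂ) • (1 : LFKernel P) - a := by
  classical
  ext p q
  rw [LFKernel.mul_apply_of_subset _ _ p q {q} fun r _ hr => by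
    by_contra h
    exact hr (if_neg fun h' => h (by simp [h']))]
  rw [Finset.sum_singleton, LFKernel.star_apply, LFKernel.diag_apply, LFKernel.diag_apply,
    if_pos rfl, LFKernel.sub_apply, LFKernel.smul_apply, LFKernel.one_apply]
  by_cases h : p = q
  · subst h
    have h1 : a p p = ((a p p).re : ℂ) := by
      apply Complex.ext <;> simp [him p]
    rw [if_pos rfl, if_pos rfl, Complex.conj_ofReal, ← Complex.ofReal_mul,
      Real.mul_self_sqrt (sub_nonneg.2 (hM p)), mul_one, Complex.ofReal_sub, ← h1]
  · rw [if_neg fun h' => h h'.symm, if_neg h, h0 p q h]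
    simp

theorem diag_mem_roeAlgebra {h : X.Pt → ℂ} {C : ℝ} (hC : ∀ x, ‖h x‖ ≤ C) :
    LFKernel.diag h ∈ X.roeAlgebra := by
  classical
  refine ⟨⟨1, fun x y h' => ?_⟩, |C|, fun x y => ?_⟩
  · rw [LFKernel.diag_apply, if_neg]
    rintro rfl
    simp at h'
  · rw [LFKernel.diag_apply]
    split_ifs
    · exact (hC x).trans (le_abs_self C)
    · simp

instance : MaxNormFinite X.roeAlgebra := by
  classical
  refine maxNormFinite_of_coloring _ ?_ ?_
  · rintro a ⟨⟨R, hR⟩, -⟩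
    obtain ⟨N, c, hc⟩ := X.exists_coloring (R + R)
    refine ⟨N, c, fun j => ⟨LFKernel.diag fun p => if c p = j then 1 else 0,
      diag_mem_roeAlgebra (C := 1) fun x => by split_ifs <;> simp, ?_, ?_⟩, ?_⟩
    · intro p hp
      simp [LFKernel.diag_apply, hp]
    · intro p q hpq
      by_contra h
      refine hpq ?_
      rw [LFKernel.diag_apply]
      split_ifs with h1 h2
      · exact absurd ⟨h1, h2⟩ h
      · rfl
      · rfl
    · intro p q q' hq hq' hcol
      have h1 : X.total.edist p q ≤ R := le_of_not_ge fun h => hq (hR _ _ h)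
      have h2 : X.total.edist p q' ≤ R := le_of_not_ge fun h => hq' (hR _ _ h)
      exact hc q q' (edist_le_trans (edist_le_symm h1) h2) hcol
  · rintro a ⟨-, C, hC⟩ h0 him
    have hre : ∀ p, |(a p p).re| ≤ C := fun p => (Complex.abs_re_le_norm _).trans (hC p p)
    refine ⟨C, _, diag_mem_roeAlgebra (C := Real.sqrt (C + C)) fun p => ?_,
      LFKernel.star_diag_mul_diag h0 him fun p => (le_abs_self _).trans (hre p)⟩
    rw [Complex.norm_real, Real.norm_of_nonneg (Real.sqrt_nonneg _)]
    exact Real.sqrt_le_sqrt (by linarith [neg_abs_le (a p p).re, hre p])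

/-! ### Laplace operators and linking graphs -/

variable (X)

/-- A matrix with bounded entries supported on the diagonal and on the edges, as an element of
`ℂ[X]`. -/
noncomputable def ofLocal (k : X.Pt → X.Pt → ℂ) (h0 : ∀ x y, k x y ≠ 0 → x = y ∨ X.total.Adj x y)
    (hC : ∃ C : ℝ, ∀ x y, ‖k x y‖ ≤ C) : X.roeAlgebra :=
  ⟨⟨k, by
    have h1 : ∀ x y, k x y ≠ 0 → X.total.edist x y ≤ (1 : ℕ) := fun x y h => by
      rw [Nat.cast_one, SimpleGraph.edist_le_one_iff_adj_or_eq]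
      exact (h0 x y h).symm
    exact ⟨fun p => (finite_ball p 1).subset fun q hq => h1 p q hq,
      fun q => (finite_ball q 1).subset fun p hp => edist_le_symm (h1 p q hp)⟩⟩, by
    refine ⟨⟨2, fun x y h => ?_⟩, hC⟩
    by_contra h'
    have h2 : X.total.edist x y ≤ 1 := by
      rw [SimpleGraph.edist_le_one_iff_adj_or_eq]
      exact (h0 x y h').symm
    exact absurd (h.trans h2) (by norm_num)⟩

open scoped Classical in
/-- The Laplace operator `Δ`. -/
noncomputable def laplacian : X.roeAlgebra :=
  X.ofLocal (fun x y => if x = y then (X.total.degree x : ℂ) else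
      if X.total.Adj x y then -1 else 0)
    (fun x y h => by
      by_contra! h'
      exact h (by simp [h'.1, h'.2]))
    (by
      obtain ⟨d, hd⟩ := X.exists_degree_le
      refine ⟨d + 1, fun x y => ?_⟩
      split_ifs
      · rw [Complex.norm_natCast]
        have : (X.total.degree x : ℝ) ≤ d := by exact_mod_cast hd x
        linarith
      · simp
      · simp only [norm_zero]
        positivity)

open scoped Classical in
/-- `τ(x, y)`, the number of triangles containing the edge `(x, y)`, which is `0` if `x` and `y` are
not adjacent. -/
noncomputable def tri (x y : X.Pt) : ℕ :=
  if X.total.Adj x y then (X.total.neighborFinset x ∩ X.total.neighborFinset y).card else 0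

/-- `τ(x) = ∑_{y ∼ x} τ(x, y)`. -/
noncomputable def triSum (x : X.Pt) : ℕ := ∑ y ∈ X.total.neighborFinset x, X.tri x y

variable {X} in
open scoped Classical in
theorem tri_le {d : ℕ} (hd : ∀ p : X.Pt, X.total.degree p ≤ d) (x y : X.Pt) : X.tri x y ≤ d := by
  unfold tri
  split_ifs
  · exact (Finset.card_le_card Finset.inter_subset_left).trans (hd x)
  · exact Nat.zero_le d

open scoped Classical in
/-- The weighted Laplace operator `Δ_τ`, given by
`(Δ_τ η)(x) = ∑_{y ∼ x} τ(x, y) (η(x) - η(y))`. -/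
noncomputable def laplacianTri : X.roeAlgebra :=
  X.ofLocal (fun x y => if x = y then (X.triSum x : ℂ) else -(X.tri x y : ℂ))
    (fun x y h => by
      by_contra! h'
      exact h (by simp [h'.1, tri, h'.2]))
    (by
      obtain ⟨d, hd⟩ := X.exists_degree_le
      have hd' := tri_le hd
      refine ⟨d * d + d, fun x y => ?_⟩
      split_ifs
      · rw [Complex.norm_natCast]
        have : X.triSum x ≤ d * d := by
          refine (Finset.sum_le_card_nsmul _ _ d fun y _ => hd' x y).trans ?_
          rw [smul_eq_mul]
          exact Nat.mul_le_mul_right _ (hd x)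
        have : (X.triSum x : ℝ) ≤ d * d := by exact_mod_cast this
        have h0 : (0 : ℝ) ≤ d := Nat.cast_nonneg d
        linarith
      · rw [norm_neg, Complex.norm_natCast]
        have : (X.tri x y : ℝ) ≤ d := by exact_mod_cast hd' x y
        have h0 : (0 : ℝ) ≤ d * d := by positivity
        linarith)

/-- The linking graph `L_x`: the graph induced on the set of neighbours of `x`. -/
def link (x : X.Pt) : SimpleGraph (X.total.neighborSet x) := X.total.induce (X.total.neighborSet x)

open scoped Classical in
/-- The Laplace operator of the linking graph for the random walk `μ_x(y, z) = 1 / τ(x, y)`: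
`(Δ f)(y) = f(y) - ∑_{z ∼ y} μ_x(y, z) f(z)`. -/
noncomputable def linkLaplacian (x : X.Pt) :
    (X.total.neighborSet x → ℂ) →ₗ[ℂ] (X.total.neighborSet x → ℂ) where
  toFun f y := f y - ∑ z with (X.link x).Adj y z, (1 / (X.tri x y : ℂ)) * f z
  map_add' f g := by
    funext y
    simp only [Pi.add_apply, mul_add, Finset.sum_add_distrib]
    ring
  map_smul' c f := by
    funext y
    simp only [Pi.smul_apply, smul_eq_mul, RingHom.id_apply, mul_sub, Finset.mul_sum]
    congr 1
    refine Finset.sum_congr rfl fun z _ => ?_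
    ring

/-- `λ₁(L_x)`, the smallest positive eigenvalue of the Laplace operator of the linking graph (`⊤`
if there is none). -/
noncomputable def lambda1 (x : X.Pt) : EReal :=
  sInf {m | ∃ μ : ℝ, 0 < μ ∧ Module.End.HasEigenvalue (X.linkLaplacian x) (μ : ℂ) ∧ m = μ}

/-! ### The coarse groupoid -/

variable (X : BoxSpace.{u})

/-- The Stone–Čech compactification of the discrete space `X`, as the space of ultrafilters. A point
`x` of `X` is identified with the principal ultrafilter `pure x`. -/
abbrev Beta : Type u := Ultrafilter X.Pt

variable {X}

/-- The closure in `βX × βX` of a subset of `X × X`. -/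
def clo (E : Set (X.Pt × X.Pt)) : Set (X.Beta × X.Beta) :=
  closure (Prod.map pure pure '' E)

variable (X)

/-- `E_R = {(x, y) | d(x, y) ≤ R}`. -/
def entourage (R : ℕ) : Set (X.Pt × X.Pt) := {xy | X.total.edist xy.1 xy.2 ≤ R}

/-- The coarse groupoid `G(X) = ⋃_R closure E_R ⊆ βX × βX`, as a subgroupoid of the pair groupoid:
`(p, q)` has range `p` and source `q`, and `(p, r) (r, q) = (p, q)`. -/
def CoarseGroupoid : Type u := {g : X.Beta × X.Beta // ∃ R : ℕ, g ∈ clo (X.entourage R)}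

variable {X}

/-- The inclusion of the closure of `E_R` in the coarse groupoid. -/
def cloIncl (R : ℕ) (g : clo (X.entourage R)) : X.CoarseGroupoid := ⟨g.1, R, g.2⟩

/-- The weak topology coming from the union `G(X) = ⋃_R closure E_R`. -/
instance : TopologicalSpace X.CoarseGroupoid :=
  ⨆ R : ℕ, TopologicalSpace.coinduced (cloIncl R) inferInstance

theorem continuous_cloIncl (R : ℕ) : Continuous (cloIncl (X := X) R) := by
  rw [continuous_iff_coinduced_le]
  exact le_iSup (fun R : ℕ => TopologicalSpace.coinduced (cloIncl (X := X) R) inferInstance) R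

theorem isOpen_iff_cloIncl {U : Set X.CoarseGroupoid} :
    IsOpen U ↔ ∀ R, IsOpen (cloIncl R ⁻¹' U) := by
  rw [isOpen_iSup_iff]
  exact forall_congr' fun R => isOpen_coinduced

theorem continuous_val : Continuous (fun g : X.CoarseGroupoid => g.1) := by
  rw [continuous_def]
  intro U hU
  rw [isOpen_iff_cloIncl]
  intro R
  exact hU.preimage continuous_subtype_val

theorem isOpen_mem (s : Set X.Pt) : IsOpen {p : X.Beta | s ∈ p} := ultrafilter_isOpen_basic s

theorem continuous_map (t : X.Pt → X.Pt) : Continuous (Ultrafilter.map t : X.Beta → X.Beta) := by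
  rw [ultrafilterBasis_is_basis.continuous_iff]
  rintro _ ⟨s, rfl⟩
  exact isOpen_mem (t ⁻¹' s)

theorem mem_clo {E : Set (X.Pt × X.Pt)} {p q : X.Beta} :
    (p, q) ∈ clo E ↔ ∀ A ∈ p, ∀ B ∈ q, ∃ x y, (x, y) ∈ E ∧ x ∈ A ∧ y ∈ B := by
  unfold clo
  rw [(ultrafilterBasis_is_basis.prod ultrafilterBasis_is_basis).mem_closure_iff]
  constructor
  · intro h A hA B hB
    obtain ⟨_, ⟨h1, h2⟩, ⟨x, y⟩, hxy, rfl⟩ := h ({u | A ∈ u} ×ˢ {u | B ∈ u})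
      ⟨_, ⟨A, rfl⟩, _, ⟨B, rfl⟩, rfl⟩ ⟨hA, hB⟩
    exact ⟨x, y, hxy, h1, h2⟩
  · rintro h _ ⟨_, ⟨A, rfl⟩, _, ⟨B, rfl⟩, rfl⟩ ⟨hA, hB⟩
    obtain ⟨x, y, hxy, h1, h2⟩ := h A hA B hB
    exact ⟨(pure x, pure y), ⟨h1, h2⟩, (x, y), hxy, rfl⟩

theorem clo_mono {E E' : Set (X.Pt × X.Pt)} (h : E ⊆ E') : clo E ⊆ clo E' :=
  closure_mono (Set.image_mono h)

theorem entourage_mono {R S : ℕ} (h : R ≤ S) : X.entourage R ⊆ X.entourage S :=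
  fun _ hxy => edist_le_mono hxy h

theorem isClosed_clo (E : Set (X.Pt × X.Pt)) : IsClosed (clo E) := isClosed_closure

theorem pure_mem_clo {E : Set (X.Pt × X.Pt)} {x y : X.Pt} :
    ((pure x, pure y) : X.Beta × X.Beta) ∈ clo E ↔ (x, y) ∈ E := by
  rw [mem_clo]
  constructor
  · intro h
    obtain ⟨x', y', h, h1, h2⟩ := h {x} (Set.mem_singleton x) {y} (Set.mem_singleton y)
    rw [Set.mem_singleton_iff] at h1 h2
    rwa [h1, h2] at h
  · intro h A hA B hB
    exact ⟨x, y, h, hA, hB⟩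

theorem clo_symm {R : ℕ} {p q : X.Beta} (h : (p, q) ∈ clo (X.entourage R)) :
    (q, p) ∈ clo (X.entourage R) := by
  rw [mem_clo] at h ⊢
  intro A hA B hB
  obtain ⟨x, y, hxy, h1, h2⟩ := h B hB A hA
  exact ⟨y, x, edist_le_symm hxy, h2, h1⟩

open scoped Classical in
/-- The point of colour `j` at distance at most `S` from `x`, if there is one. -/
noncomputable def tr {N : ℕ} (c : X.Pt → Fin N) (S : ℕ) (j : Fin N) (x : X.Pt) : X.Pt :=
  if h : ∃ y, c y = j ∧ X.total.edist x y ≤ S then h.choose else x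

section Tr

variable {N : ℕ} {c : X.Pt → Fin N} {S : ℕ}

theorem tr_eq (hc : ∀ p q, X.total.edist p q ≤ (S + S : ℕ) → c p = c q → p = q) {x y : X.Pt}
    (hxy : X.total.edist x y ≤ S) : tr c S (c y) x = y := by
  have h : ∃ y', c y' = c y ∧ X.total.edist x y' ≤ S := ⟨y, rfl, hxy⟩
  unfold tr
  rw [dif_pos h]
  exact hc _ _ (edist_le_trans (edist_le_symm h.choose_spec.2) hxy) h.choose_spec.1

theorem exists_color (c : X.Pt → Fin N) (q : X.Beta) : ∃ j, {y | c y = j} ∈ q := by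
  by_contra! h
  have h1 : ∀ j, {y | c y ≠ j} ∈ q := fun j => by
    have := Ultrafilter.compl_mem_iff_notMem.2 (h j)
    exact this
  have h2 : (⋂ j, {y | c y ≠ j}) ∈ (q : Filter X.Pt) := (Filter.iInter_mem).2 h1
  obtain ⟨y, hy⟩ := q.nonempty_of_mem h2
  exact Set.mem_iInter.1 hy (c y) rfl

theorem mem_clo_iff_tr (hc : ∀ p q, X.total.edist p q ≤ (S + S : ℕ) → c p = c q → p = q)
    {E : Set (X.Pt × X.Pt)} (hE : E ⊆ X.entourage S) {j : Fin N} {p q : X.Beta}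
    (hq : {y | c y = j} ∈ q) :
    (p, q) ∈ clo E ↔ {x | (x, tr c S j x) ∈ E} ∈ p ∧ q = p.map (tr c S j) := by
  rw [mem_clo]
  constructor
  · intro h
    have key : ∀ B ∈ q, {x | (x, tr c S j x) ∈ E ∧ tr c S j x ∈ B} ∈ p := by
      intro B hB
      by_contra hn
      rw [← Ultrafilter.compl_mem_iff_notMem] at hn
      obtain ⟨x, y, hxy, h1, h2, h3⟩ := h _ hn _ (inter_mem hB hq)
      have h4 : tr c S j x = y := by
        rw [← show c y = j from h3]
        exact tr_eq hc (hE hxy)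
      exact h1 (by
        change (x, tr c S j x) ∈ E ∧ tr c S j x ∈ B
        rw [h4]
        exact ⟨hxy, h2⟩)
    refine ⟨mem_of_superset (key _ univ_mem) fun x hx => hx.1, ?_⟩
    refine (Ultrafilter.eq_of_le ?_).symm
    intro B hB
    have hB' : tr c S j ⁻¹' B ∈ p := mem_of_superset (key B hB) fun x hx => hx.2
    exact hB'
  · rintro ⟨h1, rfl⟩ A hA B hB
    obtain ⟨x, hx1, hx2, hx3⟩ := p.nonempty_of_mem (inter_mem hA (inter_mem h1 hB))
    exact ⟨x, tr c S j x, hx2, hx1, hx3⟩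

end Tr

theorem clo_disjoint {E E' : Set (X.Pt × X.Pt)} {S : ℕ} (hE : E ⊆ X.entourage S)
    (hE' : E' ⊆ X.entourage S) (h : ∀ xy, xy ∈ E → xy ∈ E' → False) {p q : X.Beta}
    (h1 : (p, q) ∈ clo E) (h2 : (p, q) ∈ clo E') : False := by
  obtain ⟨N, c, hc⟩ := X.exists_coloring (S + S)
  obtain ⟨j, hj⟩ := exists_color c q
  rw [mem_clo_iff_tr hc hE hj] at h1
  rw [mem_clo_iff_tr hc hE' hj] at h2
  obtain ⟨x, hx1, hx2⟩ := p.nonempty_of_mem (inter_mem h1.1 h2.1)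
  exact h _ hx1 hx2

/-- The closure of `E_R` is relatively open in the closure of `E_S`. -/
theorem exists_open_clo (R S : ℕ) : ∃ O : Set (X.Beta × X.Beta), IsOpen O ∧
    ∀ g ∈ clo (X.entourage S), g ∈ O ↔ g ∈ clo (X.entourage R) := by
  refine ⟨(clo (X.entourage S \ X.entourage R))ᶜ, (isClosed_clo _).isOpen_compl, ?_⟩
  rintro ⟨p, q⟩ hg
  constructor
  · intro h
    have h1 : (p, q) ∈ clo (X.entourage R ∪ (X.entourage S \ X.entourage R)) :=
      clo_mono (by intro x hx; by_cases h : x ∈ X.entourage R; exacts [Or.inl h, Or.inr ⟨hx, h⟩]) hg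
    have h2 : clo (X.entourage R ∪ (X.entourage S \ X.entourage R)) =
        clo (X.entourage R) ∪ clo (X.entourage S \ X.entourage R) := by
      unfold clo
      rw [Set.image_union, closure_union]
    rw [h2] at h1
    exact h1.resolve_right h
  · intro h h'
    exact clo_disjoint (S := max R S) (entourage_mono (le_max_left _ _))
      (Set.sdiff_subset.trans (entourage_mono (le_max_right _ _)))
      (fun xy h1 h2 => h2.2 h1) h h'

theorem isOpen_clo (R : ℕ) : IsOpen {g : X.CoarseGroupoid | g.1 ∈ clo (X.entourage R)} := by
  rw [isOpen_iff_cloIncl]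
  intro S
  obtain ⟨O, hO, h⟩ := X.exists_open_clo R S
  convert hO.preimage (continuous_subtype_val (p := fun g => g ∈ clo (X.entourage S))) using 1
  ext g
  exact (h g.1 g.2).symm

theorem clo_row_finite (R : ℕ) (p : X.Beta) : {q | (p, q) ∈ clo (X.entourage R)}.Finite := by
  obtain ⟨N, c, hc⟩ := X.exists_coloring (R + R)
  refine (Set.finite_range fun j => p.map (tr c R j)).subset fun q hq => ?_
  obtain ⟨j, hj⟩ := exists_color c q
  exact ⟨j, ((mem_clo_iff_tr hc subset_rfl hj).1 hq).2.symm⟩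

theorem clo_col_finite (R : ℕ) (q : X.Beta) : {p | (p, q) ∈ clo (X.entourage R)}.Finite :=
  (clo_row_finite R q).subset fun _ hp => clo_symm hp

theorem clo_trans {R S : ℕ} {p r q : X.Beta} (h : (p, r) ∈ clo (X.entourage R))
    (h' : (r, q) ∈ clo (X.entourage S)) : (p, q) ∈ clo (X.entourage (R + S)) := by
  obtain ⟨N, c, hc⟩ := X.exists_coloring (S + S)
  obtain ⟨j, hj⟩ := exists_color c q
  rw [mem_clo_iff_tr hc subset_rfl hj] at h'
  obtain ⟨h1, rfl⟩ := h'
  rw [mem_clo] at h ⊢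
  intro A hA B hB
  obtain ⟨x, y, hxy, h2, h3, h4⟩ := h A hA _ (inter_mem h1 hB)
  exact ⟨x, tr c S j y, edist_le_trans hxy h3, h2, h4⟩

theorem clo_zero {p q : X.Beta} : (p, q) ∈ clo (X.entourage 0) ↔ p = q := by
  rw [mem_clo]
  constructor
  · intro h
    refine Ultrafilter.eq_of_le fun B hB => ?_
    by_contra hn
    rw [Ultrafilter.mem_coe, ← Ultrafilter.compl_mem_iff_notMem] at hn
    obtain ⟨x, y, hxy, h1, h2⟩ := h _ hn B hB
    obtain rfl : x = y := by
      have h3 : X.total.edist x y ≤ ((0 : ℕ) : ℕ∞) := hxy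
      rw [Nat.cast_zero, nonpos_iff_eq_zero, SimpleGraph.edist_eq_zero_iff] at h3
      exact h3
    exact h1 h2
  · rintro rfl A hA B hB
    obtain ⟨x, h1, h2⟩ := p.nonempty_of_mem (inter_mem hA hB)
    refine ⟨x, x, ?_, h1, h2⟩
    change X.total.edist x x ≤ _
    simp

end BoxSpace

namespace BoxSpace
variable (X : BoxSpace.{u})

/-! ### Reductions of the coarse groupoid and their groupoid algebras -/

/-- A closed invariant subset of the base space `βX` of the coarse groupoid. -/
structure ClosedInvariant where
  carrier : Set X.Beta
  isClosed : IsClosed carrier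
  invariant : ∀ g : X.CoarseGroupoid, g.1.1 ∈ carrier ↔ g.1.2 ∈ carrier

variable {X}

namespace ClosedInvariant

variable (Z : X.ClosedInvariant)

/-- The reduction `G(X)|_Z`, with the subspace topology. -/
def Reduction : Type u := {g : X.CoarseGroupoid // g.1.1 ∈ Z.carrier ∧ g.1.2 ∈ Z.carrier}

instance : TopologicalSpace Z.Reduction :=
  inferInstanceAs (TopologicalSpace {g : X.CoarseGroupoid // g.1.1 ∈ Z.carrier ∧ g.1.2 ∈ Z.carrier})

variable {Z}

/-- The range of an element of `G(X)|_Z`. -/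
def Reduction.rng (g : Z.Reduction) : Z.carrier := ⟨g.1.1.1, g.2.1⟩

/-- The source of an element of `G(X)|_Z`. -/
def Reduction.src (g : Z.Reduction) : Z.carrier := ⟨g.1.1.2, g.2.2⟩

/-- The matrix of `f : Z × Z → ℂ`, extended by zero to `βX × βX`. -/
noncomputable def ext0 (f : Z.carrier → Z.carrier → ℂ) (g : X.Beta × X.Beta) : ℂ := by
  classical
  exact if h : g.1 ∈ Z.carrier ∧ g.2 ∈ Z.carrier then f ⟨g.1, h.1⟩ ⟨g.2, h.2⟩ else 0

theorem ext0_apply (f : Z.carrier → Z.carrier → ℂ) (p q : Z.carrier) : ext0 f (p.1, q.1) = f p q := by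
  unfold ext0
  rw [dif_pos ⟨p.2, q.2⟩]

/-- The part of `closure E_S` over `Z`. -/
def piece (Z : X.ClosedInvariant) (S : ℕ) : Set (X.Beta × X.Beta) :=
  clo (X.entourage S) ∩ Z.carrier ×ˢ Z.carrier

theorem continuous_red_val : Continuous (fun g : Z.Reduction => g.1.1) :=
  continuous_val.comp continuous_subtype_val

/-- The inclusion of the part of `closure E_S` over `Z`. -/
def pieceIncl (S : ℕ) (g : Z.piece S) : Z.Reduction := ⟨cloIncl S ⟨g.1, g.2.1⟩, g.2.2⟩

theorem continuous_pieceIncl (S : ℕ) : Continuous (pieceIncl (Z := Z) S) := by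
  refine Continuous.subtype_mk ((continuous_cloIncl S).comp
    (Continuous.subtype_mk continuous_subtype_val _)) _

theorem isCompact_piece (S : ℕ) : IsCompact (Z.piece S) :=
  ((isClosed_clo _).inter (Z.isClosed.prod Z.isClosed)).isCompact

instance : T2Space Z.Reduction := by
  refine T2Space.of_injective_continuous (f := fun g : Z.Reduction => g.1.1) ?_ continuous_red_val
  intro g g' h
  exact Subtype.ext (Subtype.ext h)

theorem isOpen_red (S : ℕ) : IsOpen {g : Z.Reduction | g.1.1 ∈ clo (X.entourage S)} :=
  (isOpen_clo S).preimage continuous_subtype_val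

theorem continuous_red_iff (f : Z.carrier → Z.carrier → ℂ) :
    Continuous (fun g : Z.Reduction => f g.rng g.src) ↔
      ∀ S, ContinuousOn (ext0 f) (Z.piece S) := by
  constructor
  · intro h S
    rw [continuousOn_iff_continuous_domRestrict]
    refine (h.comp (continuous_pieceIncl S)).congr fun g => ?_
    exact (ext0_apply f ⟨g.1.1, g.2.2.1⟩ ⟨g.1.2, g.2.2.2⟩).symm
  · intro h
    have h' : (fun g : Z.Reduction => f g.rng g.src) = fun g => ext0 f g.1.1 := by
      funext g
      exact (ext0_apply f g.rng g.src).symm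
    rw [h', continuous_iff_continuousAt]
    intro g
    obtain ⟨S, hS⟩ := g.1.2
    have h1 : Tendsto (fun g : Z.Reduction => g.1.1) (𝓝 g) (𝓝[Z.piece S] g.1.1) := by
      refine tendsto_nhdsWithin_iff.2 ⟨continuous_red_val.tendsto g, ?_⟩
      filter_upwards [(isOpen_red S).mem_nhds hS] with g' hg'
      exact ⟨hg', g'.2⟩
    exact (h S g.1.1 ⟨hS, g.2⟩).tendsto.comp h1

variable (Z)

/-- The matrices that are given by compactly supported continuous functions on `G(X)|_Z`, with the
entry at `(p, q)` being `0` if `(p, q)` is not in `G(X)|_Z`. -/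
def IsGroupoidFunction (f : Z.carrier → Z.carrier → ℂ) : Prop :=
  ∃ φ : C_c(Z.Reduction, ℂ), (∀ g, φ g = f g.rng g.src) ∧
    ∀ p q, (∀ g : Z.Reduction, ¬ (g.rng = p ∧ g.src = q)) → f p q = 0

variable {Z}

theorem isGroupoidFunction_iff {f : Z.carrier → Z.carrier → ℂ} :
    Z.IsGroupoidFunction f ↔ (∃ R, ∀ p q, f p q ≠ 0 → (p.1, q.1) ∈ clo (X.entourage R)) ∧
      ∀ S, ContinuousOn (ext0 f) (Z.piece S) := by
  rw [← continuous_red_iff]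
  constructor
  · rintro ⟨φ, h1, h2⟩
    refine ⟨?_, φ.continuous.congr h1⟩
    obtain ⟨R, hR⟩ := φ.hasCompactSupport.isCompact.elim_directed_cover
      (fun S : ℕ => {g : Z.Reduction | g.1.1 ∈ clo (X.entourage S)}) isOpen_red
      (fun g _ => Set.mem_iUnion.2 g.1.2)
      (directed_of_isDirected_le fun S S' hS g hg => clo_mono (entourage_mono hS) hg)
    refine ⟨R, fun p q hpq => ?_⟩
    by_contra hn
    refine hpq (h2 p q ?_)
    rintro g ⟨rfl, rfl⟩
    have h3 : φ g ≠ 0 := by rwa [h1]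
    exact hn (hR (subset_tsupport _ h3))
  · rintro ⟨⟨R, hR⟩, hc⟩
    refine ⟨⟨⟨_, hc⟩, ?_⟩, fun g => rfl, ?_⟩
    · refine HasCompactSupport.intro (isCompact_univ_iff.2
        (isCompact_iff_compactSpace.1 (isCompact_piece (Z := Z) R)) |>.image
          (continuous_pieceIncl R)) ?_
      intro g hg
      by_contra hn
      exact hg ⟨⟨g.1.1, hR _ _ hn, g.2⟩, trivial, rfl⟩
    · intro p q h
      by_contra hn
      exact h ⟨⟨(p.1, q.1), R, hR p q hn⟩, p.2, q.2⟩ ⟨rfl, rfl⟩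

theorem mem_of_clo {R : ℕ} {p q : X.Beta} (h : (p, q) ∈ clo (X.entourage R)) :
    p ∈ Z.carrier ↔ q ∈ Z.carrier := Z.invariant ⟨(p, q), R, h⟩

theorem _root_.continuousOn_ite_clopen {α : Type u} [TopologicalSpace α] {F : α → ℂ} {W K : Set α}
    [∀ g, Decidable (g ∈ K)] (hK : IsClopen K) (hF : ContinuousOn F (W ∩ K)) :
    ContinuousOn (fun g => if g ∈ K then F g else 0) W := by
  intro g hg
  by_cases h : g ∈ K
  · have h1 : ContinuousWithinAt F W g :=
      (continuousWithinAt_inter (hK.isOpen.mem_nhds h)).1 (hF g ⟨hg, h⟩)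
    refine h1.congr_of_eventuallyEq ?_ (if_pos h)
    filter_upwards [mem_nhdsWithin_of_mem_nhds (hK.isOpen.mem_nhds h)] with g' hg'
    exact if_pos hg'
  · refine (continuousWithinAt_const (b := (0 : ℂ))).congr_of_eventuallyEq ?_ (if_neg h)
    filter_upwards [mem_nhdsWithin_of_mem_nhds (hK.isClosed.isOpen_compl.mem_nhds h)] with g' hg'
    exact if_neg hg'

theorem isClopen_mem (D : Set X.Pt) : IsClopen {p : X.Beta | D ∈ p} :=
  ⟨ultrafilter_isClosed_basic D, isOpen_mem D⟩

theorem continuousOn_indicator_clo (R S : ℕ) [∀ g : X.Beta × X.Beta, Decidable (g ∈ clo (X.entourage R))]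
    {F : X.Beta × X.Beta → ℂ} {W : Set (X.Beta × X.Beta)} (hW : W ⊆ clo (X.entourage S))
    (hF : ContinuousOn F (W ∩ clo (X.entourage R))) :
    ContinuousOn (fun g => if g ∈ clo (X.entourage R) then F g else 0) W := by
  obtain ⟨O, hO, h⟩ := X.exists_open_clo R S
  intro g hg
  by_cases hR : g ∈ clo (X.entourage R)
  · have hgO : g ∈ O := (h g (hW hg)).2 hR
    have h2 : ContinuousWithinAt F W g := by
      have h3 := (hF g ⟨hg, hR⟩).mono (show W ∩ O ⊆ W ∩ clo (X.entourage R) from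
        fun g' hg' => ⟨hg'.1, (h g' (hW hg'.1)).1 hg'.2⟩)
      exact (continuousWithinAt_inter (hO.mem_nhds hgO)).1 h3
    refine h2.congr_of_eventuallyEq ?_ (if_pos hR)
    filter_upwards [mem_nhdsWithin_of_mem_nhds (hO.mem_nhds hgO), self_mem_nhdsWithin] with g' h1 h2
    exact if_pos ((h g' (hW h2)).1 h1)
  · refine (continuousWithinAt_const (b := (0 : ℂ))).congr_of_eventuallyEq ?_ (if_neg hR)
    filter_upwards [mem_nhdsWithin_of_mem_nhds ((isClosed_clo _).isOpen_compl.mem_nhds hR)] with g' h1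
    exact if_neg h1

/-- The convolution of two functions on `G(X)|_Z` is again one. -/
theorem isGroupoidFunction_mul {a b : LFKernel Z.carrier} (ha : Z.IsGroupoidFunction a.1)
    (hb : Z.IsGroupoidFunction b.1) : Z.IsGroupoidFunction (a * b).1 := by
  classical
  rw [isGroupoidFunction_iff] at ha hb ⊢
  obtain ⟨⟨R, hR⟩, hac⟩ := ha
  obtain ⟨⟨R', hR'⟩, hbc⟩ := hb
  refine ⟨⟨R + R', fun p q h => ?_⟩, fun S => ?_⟩
  · obtain ⟨r, h1, h2⟩ := LFKernel.exists_ne_of_finsum_ne_zero h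
    exact clo_trans (hR p r h1) (hR' r q h2)
  obtain ⟨N, c, hc⟩ := X.exists_coloring (R + R)
  set D : Fin N → Set X.Pt := fun j =>
    {x | (x, tr c R j x) ∈ X.entourage R ∧ c (tr c R j x) = j} with hD
  have hDmem : ∀ {j : Fin N} {p : X.Beta}, D j ∈ p →
      (p, p.map (tr c R j)) ∈ clo (X.entourage R) := by
    intro j p hp
    have hcol : tr c R j ⁻¹' {y | c y = j} ∈ p := mem_of_superset hp fun x hx => hx.2
    exact (mem_clo_iff_tr hc subset_rfl hcol).2 ⟨mem_of_superset hp fun x hx => hx.1, rfl⟩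
  set F : X.Beta × X.Beta → ℂ := fun g => ∑ j : Fin N, if D j ∈ g.1 then
    ext0 a.1 (g.1, g.1.map (tr c R j)) * ext0 b.1 (g.1.map (tr c R j), g.2) else 0 with hF
  have hcont : ContinuousOn F (Z.piece S) := by
    refine continuousOn_finsetSum _ fun j _ => continuousOn_ite_clopen
      (K := {g : X.Beta × X.Beta | D j ∈ g.1}) ((isClopen_mem _).preimage continuous_fst)
      (ContinuousOn.mul ?_ ?_)
    · refine (hac R).comp (s := Z.piece S ∩ {g | D j ∈ g.1})
        (f := fun g : X.Beta × X.Beta => (g.1, g.1.map (tr c R j))) ?_ ?_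
      · exact (continuous_fst.prodMk ((continuous_map _).comp continuous_fst)).continuousOn
      · rintro ⟨p, q⟩ ⟨hg, hj⟩
        exact ⟨hDmem hj, hg.2.1, (mem_of_clo (hDmem hj)).1 hg.2.1⟩
    · refine (hbc (R + S)).comp (s := Z.piece S ∩ {g | D j ∈ g.1})
        (f := fun g : X.Beta × X.Beta => (g.1.map (tr c R j), g.2)) ?_ ?_
      · exact (((continuous_map _).comp continuous_fst).prodMk continuous_snd).continuousOn
      · rintro ⟨p, q⟩ ⟨hg, hj⟩
        exact ⟨clo_trans (clo_symm (hDmem hj)) hg.1, (mem_of_clo (hDmem hj)).1 hg.2.1, hg.2.2⟩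
  refine hcont.congr ?_
  rintro ⟨p, q⟩ ⟨hpq, hp, hq⟩
  change _ = ∑ j : Fin N, _
  rw [ext0_apply (a * b).1 ⟨p, hp⟩ ⟨q, hq⟩]
  rw [← Finset.sum_filter]
  have hmemZ : ∀ j : Fin N, D j ∈ p → p.map (tr c R j) ∈ Z.carrier := fun j hj =>
    (mem_of_clo (hDmem hj)).1 hp
  have hcolmap : ∀ j : Fin N, D j ∈ p → {y | c y = j} ∈ p.map (tr c R j) := fun j hj => by
    have h1 : tr c R j ⁻¹' {y | c y = j} ∈ p := mem_of_superset hj fun x hx => hx.2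
    exact h1
  let e : Fin N → Z.carrier := fun j =>
    if h : D j ∈ p then ⟨p.map (tr c R j), hmemZ j h⟩ else ⟨p, hp⟩
  have he : ∀ j, D j ∈ p → (e j).1 = p.map (tr c R j) := fun j hj => by
    simp only [e, dif_pos hj]
  rw [LFKernel.mul_apply_of_subset a b _ _ ((Finset.univ.filter fun j => D j ∈ p).image e),
    Finset.sum_image]
  · refine Finset.sum_congr rfl fun j hj => ?_
    have hj' : D j ∈ p := (Finset.mem_filter.1 hj).2
    rw [← he j hj', ext0_apply a.1 ⟨p, hp⟩ (e j), ext0_apply b.1 (e j) ⟨q, hq⟩]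
  · intro j hj j' hj' hjj
    have h1 : D j ∈ p := (Finset.mem_filter.1 hj).2
    have h2 : D j' ∈ p := (Finset.mem_filter.1 hj').2
    have h3 := hcolmap j h1
    have h4 := hcolmap j' h2
    rw [← he j h1] at h3
    rw [← he j' h2, ← hjj] at h4
    obtain ⟨y, hy1, hy2⟩ := (e j).1.nonempty_of_mem (inter_mem h3 h4)
    exact hy1.symm.trans hy2
  · intro r hr _
    have h1 := hR _ _ hr
    obtain ⟨j, hj⟩ := exists_color c r.1
    obtain ⟨h2, h3⟩ := (mem_clo_iff_tr hc subset_rfl hj).1 h1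
    rw [h3] at hj
    have h4 : D j ∈ p := inter_mem h2 hj
    refine Finset.mem_image.2 ⟨j, by simpa using h4, Subtype.ext ?_⟩
    rw [he j h4, ← h3]

/-- A diagonal matrix with continuous entries is a function on `G(X)|_Z`. -/
theorem isGroupoidFunction_diag {h : Z.carrier → ℂ} (hc : Continuous h) :
    Z.IsGroupoidFunction (LFKernel.diag h).1 := by
  classical
  rw [isGroupoidFunction_iff]
  refine ⟨⟨0, fun p q hpq => ?_⟩, fun S => ?_⟩
  · rw [clo_zero]
    by_contra hn
    exact hpq (if_neg fun h' => hn (congrArg _ h'))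
  · set h0 : X.Beta × X.Beta → ℂ := fun g => if hg : g.1 ∈ Z.carrier then h ⟨g.1, hg⟩ else 0 with hh0
    have h1 : ContinuousOn h0 (Z.piece S) := by
      rw [continuousOn_iff_continuous_domRestrict]
      refine (hc.comp (Continuous.subtype_mk (continuous_fst.comp continuous_subtype_val)
        fun g : Z.piece S => g.2.2.1)).congr fun g => ?_
      simp only [Function.comp_apply, Set.domRestrict_apply, hh0]
      rw [dif_pos g.2.2.1]
    refine (continuousOn_indicator_clo 0 S (Set.inter_subset_left)
      (h1.mono Set.inter_subset_left)).congr ?_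
    rintro ⟨p, q⟩ ⟨_, hp, hq⟩
    rw [ext0_apply (LFKernel.diag h).1 ⟨p, hp⟩ ⟨q, hq⟩]
    rw [LFKernel.diag_apply]
    change _ = if (p, q) ∈ clo (X.entourage 0) then h0 (p, q) else 0
    by_cases hpq : p = q
    · rw [if_pos (Subtype.ext hpq), if_pos (clo_zero.2 hpq)]
      simp only [hh0, dif_pos hp]
    · rw [if_neg fun h' => hpq (congrArg Subtype.val h'), if_neg fun h' => hpq (clo_zero.1 h')]

variable (Z)

/-- The groupoid algebra `C_c(G(X)|_Z)`, with convolution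
`(f₁ * f₂)(p, q) = ∑_r f₁(p, r) f₂(r, q)` and involution `f*(p, q) = conj (f(q, p))`. -/
noncomputable def groupoidAlgebra : StarSubalgebra ℂ (LFKernel Z.carrier) where
  carrier := {f | Z.IsGroupoidFunction f.1}
  mul_mem' := isGroupoidFunction_mul
  add_mem' := by
    intro a b ha hb
    simp only [Set.mem_ofPred_eq, isGroupoidFunction_iff] at ha hb ⊢
    obtain ⟨⟨R, hR⟩, hac⟩ := ha
    obtain ⟨⟨R', hR'⟩, hbc⟩ := hb
    refine ⟨⟨max R R', fun p q h => ?_⟩, fun S => ((hac S).add (hbc S)).congr ?_⟩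
    · by_contra hn
      have h1 : a.1 p q = 0 := by
        by_contra h1
        exact hn (clo_mono (entourage_mono (le_max_left R R')) (hR p q h1))
      have h2 : b.1 p q = 0 := by
        by_contra h2
        exact hn (clo_mono (entourage_mono (le_max_right R R')) (hR' p q h2))
      exact h (by change a.1 p q + b.1 p q = 0; rw [h1, h2, add_zero])
    · rintro ⟨p, q⟩ ⟨_, hp, hq⟩
      rw [Pi.add_apply, ext0_apply a.1 ⟨p, hp⟩ ⟨q, hq⟩, ext0_apply b.1 ⟨p, hp⟩ ⟨q, hq⟩,
        ext0_apply (a + b).1 ⟨p, hp⟩ ⟨q, hq⟩]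
      rfl
  algebraMap_mem' := by
    classical
    intro c
    have h : (algebraMap ℂ (LFKernel Z.carrier) c) = LFKernel.diag fun _ => c := by
      ext p q
      rw [Algebra.algebraMap_eq_smul_one, LFKernel.smul_apply, LFKernel.one_apply,
        LFKernel.diag_apply]
      simp
    rw [h]
    exact isGroupoidFunction_diag continuous_const
  star_mem' := by
    intro a ha
    simp only [Set.mem_ofPred_eq, isGroupoidFunction_iff] at ha ⊢
    obtain ⟨⟨R, hR⟩, hac⟩ := ha
    refine ⟨⟨R, fun p q h => clo_symm (hR q p fun h0 => h ?_)⟩, fun S => ?_⟩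
    · change (starRingEnd ℂ) (a.1 q p) = 0
      rw [h0, map_zero]
    · have h1 : ContinuousOn (fun g : X.Beta × X.Beta => (starRingEnd ℂ) (ext0 a.1 (g.2, g.1)))
          (Z.piece S) := by
        refine Complex.continuous_conj.comp_continuousOn ((hac S).comp (s := Z.piece S)
          (f := fun g : X.Beta × X.Beta => (g.2, g.1))
          (continuous_snd.prodMk continuous_fst).continuousOn ?_)
        rintro ⟨p, q⟩ ⟨h, hp, hq⟩
        exact ⟨clo_symm h, hq, hp⟩
      refine h1.congr ?_
      rintro ⟨p, q⟩ ⟨_, hp, hq⟩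
      change _ = (starRingEnd ℂ) (ext0 a.1 (q, p))
      rw [ext0_apply a.1 ⟨q, hq⟩ ⟨p, hp⟩, ext0_apply (star a).1 ⟨p, hp⟩ ⟨q, hq⟩]
      rfl

variable {Z}

theorem continuous_diag_entry {a : LFKernel Z.carrier} (ha : Z.IsGroupoidFunction a.1) :
    Continuous fun p : Z.carrier => a p p := by
  rw [isGroupoidFunction_iff] at ha
  have h1 := continuousOn_iff_continuous_domRestrict.1 (ha.2 0)
  refine (h1.comp (Continuous.subtype_mk (p := fun g => g ∈ Z.piece 0) (f := fun p : Z.carrier => (p.1, p.1))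
    (continuous_subtype_val.prodMk continuous_subtype_val)
    fun p => ⟨clo_zero.2 rfl, p.2, p.2⟩)).congr fun p => ?_
  exact ext0_apply a.1 p p

instance : MaxNormFinite Z.groupoidAlgebra := by
  classical
  have : CompactSpace Z.carrier := isCompact_iff_compactSpace.1 Z.isClosed.isCompact
  refine maxNormFinite_of_coloring _ ?_ ?_
  · intro a ha
    obtain ⟨⟨R, hR⟩, -⟩ := isGroupoidFunction_iff.1 ha
    obtain ⟨N, c, hc⟩ := X.exists_coloring (R + R + (R + R))
    choose col hcol using fun p : Z.carrier => exists_color c p.1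
    have hcolu : ∀ (p : Z.carrier) j, {y | c y = j} ∈ p.1 ↔ col p = j := by
      intro p j
      constructor
      · intro h
        obtain ⟨y, hy1, hy2⟩ := p.1.nonempty_of_mem (inter_mem (hcol p) h)
        exact hy1.symm.trans hy2
      · rintro rfl
        exact hcol p
    have hcolc : ∀ j, Continuous fun p : Z.carrier => (if col p = j then (1 : ℂ) else 0) := by
      intro j
      refine IsLocallyConstant.continuous ?_
      rw [IsLocallyConstant.iff_exists_open]
      intro p
      refine ⟨{p' | {y | c y = col p} ∈ p'.1},
        (isOpen_mem _).preimage continuous_subtype_val, hcol p, ?_⟩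
      intro p' hp'
      rw [(hcolu p' _).1 hp']
    refine ⟨N, col, fun j => ⟨LFKernel.diag fun p => if col p = j then 1 else 0,
      isGroupoidFunction_diag (hcolc j), ?_, ?_⟩, ?_⟩
    · intro p hp
      simp [LFKernel.diag_apply, hp]
    · intro p q hpq
      by_contra h
      refine hpq ?_
      rw [LFKernel.diag_apply]
      split_ifs with h1 h2
      · exact absurd ⟨h1, h2⟩ h
      · rfl
      · rfl
    · intro p q q' hq hq' hcq
      have h1 := clo_trans (clo_symm (hR p q hq)) (hR p q' hq')
      have h2 := (mem_clo_iff_tr hc subset_rfl (hcol q')).1 h1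
      have h3 := (mem_clo_iff_tr (p := q.1) (q := q.1) hc subset_rfl (hcq ▸ hcol q)).1
        (clo_mono (entourage_mono (Nat.zero_le _)) (clo_zero.2 rfl))
      exact Subtype.ext (h3.2.trans h2.2.symm)
  · intro a ha h0 him
    have hc := continuous_diag_entry ha
    obtain ⟨M, hM⟩ := (isCompact_range (Complex.continuous_re.comp hc)).bddAbove
    refine ⟨M, _, isGroupoidFunction_diag ?_,
      LFKernel.star_diag_mul_diag h0 him fun p => hM ⟨p, rfl⟩⟩
    exact Complex.continuous_ofReal.comp
      (Real.continuous_sqrt.comp (continuous_const.sub (Complex.continuous_re.comp hc)))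

end ClosedInvariant

/-! ### Extending and restricting elements of `ℂ[X]` -/

theorem continuous_groupoid_of_continuousOn {F : X.Beta × X.Beta → ℂ}
    (h : ∀ S, ContinuousOn F (clo (X.entourage S))) :
    Continuous fun g : X.CoarseGroupoid => F g.1 := by
  rw [continuous_iff_continuousAt]
  intro g
  obtain ⟨S, hS⟩ := g.2
  have h1 : Tendsto (fun g : X.CoarseGroupoid => g.1) (𝓝 g) (𝓝[clo (X.entourage S)] g.1) := by
    refine tendsto_nhdsWithin_iff.2 ⟨continuous_val.tendsto g, ?_⟩
    filter_upwards [(isOpen_clo S).mem_nhds hS] with g' hg'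
    exact hg'
  exact (h S g.1 hS).tendsto.comp h1

theorem exists_extension (T : X.roeAlgebra) : ∃ F : X.CoarseGroupoid → ℂ,
    (Continuous F ∧ ∀ g x y, g.1 = (pure x, pure y) → F g = T.1 x y) ∧
      ∃ R : ℕ, ∀ g, F g ≠ 0 → g.1 ∈ clo (X.entourage R) := by
  classical
  obtain ⟨T, ⟨R, hR⟩, C, hC⟩ := T
  obtain ⟨N, c, hc⟩ := X.exists_coloring (R + R)
  have hC0 : ∀ x y, T x y ∈ Metric.closedBall (0 : ℂ) |C| := fun x y => by
    rw [mem_closedBall_zero_iff]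
    exact (hC x y).trans (le_abs_self C)
  let φ : Fin N → X.Pt → Metric.closedBall (0 : ℂ) |C| := fun j x => ⟨T x (tr c R j x), hC0 _ _⟩
  have : CompactSpace (Metric.closedBall (0 : ℂ) |C|) :=
    isCompact_iff_compactSpace.1 (isCompact_closedBall _ _)
  set F : X.Beta × X.Beta → ℂ := fun g => if g ∈ clo (X.entourage R) then
    ∑ j, (if g ∈ {g : X.Beta × X.Beta | {y | c y = j} ∈ g.2} then
      ((Ultrafilter.extend (φ j) g.1 : Metric.closedBall (0 : ℂ) |C|) : ℂ) else 0) else 0 with hF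
  refine ⟨fun g => F g.1, ⟨continuous_groupoid_of_continuousOn fun S => ?_, ?_⟩, R, ?_⟩
  · refine ClosedInvariant.continuousOn_indicator_clo R S subset_rfl
      (continuousOn_finsetSum _ fun j _ => ?_)
    refine continuousOn_ite_clopen ((ClosedInvariant.isClopen_mem _).preimage continuous_snd)
      (Continuous.continuousOn ?_)
    exact continuous_subtype_val.comp ((continuous_ultrafilter_extend _).comp continuous_fst)
  · rintro ⟨_, hg⟩ x y rfl
    change F (pure x, pure y) = _
    simp only [hF, pure_mem_clo]
    split_ifs with h
    · rw [Finset.sum_eq_single (c y)]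
      · have h1 : ((pure x, pure y) : X.Beta × X.Beta) ∈
            {g : X.Beta × X.Beta | {y' | c y' = c y} ∈ g.2} := by
          change c y = c y
          rfl
        rw [if_pos h1, ultrafilter_extend_pure]
        change T x (tr c R (c y) x) = T x y
        rw [tr_eq hc h]
      · intro j _ hj
        rw [if_neg]
        intro h1
        change c y = j at h1
        exact hj h1.symm
      · simp
    · exact (hR x y (le_of_not_ge h)).symm
  · intro g hg
    by_contra hn
    exact hg (if_neg hn)

theorem extension_unique {F F' : X.CoarseGroupoid → ℂ} (hF : Continuous F) (hF' : Continuous F')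
    (h : ∀ g x y, g.1 = (pure x, pure y) → F g = F' g) : F = F' := by
  funext g
  obtain ⟨S, hS⟩ := g.2
  have hd : Dense {g : clo (X.entourage S) |
      g.1 ∈ (Prod.map pure pure '' X.entourage S : Set (X.Beta × X.Beta))} := by
    rw [Subtype.dense_iff]
    intro g hg
    refine closure_mono ?_ hg
    intro g' hg'
    exact ⟨⟨g', subset_closure hg'⟩, hg', rfl⟩
  have h1 := Continuous.ext_on hd (hF.comp (continuous_cloIncl S))
    (hF'.comp (continuous_cloIncl S)) (by
      rintro ⟨_, hg⟩ ⟨⟨x, y⟩, -, rfl⟩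
      exact h _ x y rfl)
  exact congrFun h1 ⟨g.1, hS⟩

theorem existsUnique_extension (T : X.roeAlgebra) : ∃! F : X.CoarseGroupoid → ℂ,
    Continuous F ∧ ∀ g x y, g.1 = (pure x, pure y) → F g = T.1 x y := by
  obtain ⟨F, hF, -⟩ := exists_extension T
  refine ⟨F, hF, fun F' hF' => extension_unique hF'.1 hF.1 fun g x y hg => ?_⟩
  rw [hF'.2 g x y hg, hF.2 g x y hg]

/-- The function on `G(X)` corresponding to `T` under `ℂ[X] ≅ C_c(G(X))`: the unique continuous
function on `G(X)` whose value at `(x, y)` in `X × X` is `T_{xy}`. -/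
noncomputable def extension (T : X.roeAlgebra) : X.CoarseGroupoid → ℂ :=
  (existsUnique_extension T).choose

theorem continuous_extension (T : X.roeAlgebra) : Continuous (extension T) :=
  (existsUnique_extension T).choose_spec.1.1

theorem exists_extension_support (T : X.roeAlgebra) :
    ∃ R : ℕ, ∀ g, extension T g ≠ 0 → g.1 ∈ clo (X.entourage R) := by
  obtain ⟨F, hF, R, hR⟩ := exists_extension T
  refine ⟨R, ?_⟩
  rwa [extension, ← (existsUnique_extension T).choose_spec.2 F hF]

open scoped Classical in
/-- The matrix of the restriction of `extension T` to `G(X)|_Z`. -/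
noncomputable def restrictFun (Z : X.ClosedInvariant) (T : X.roeAlgebra)
    (p q : Z.carrier) : ℂ :=
  if h : ∃ R : ℕ, (p.1, q.1) ∈ clo (X.entourage R) then extension T ⟨(p.1, q.1), h⟩ else 0

theorem restrictFun_apply (Z : X.ClosedInvariant) (T : X.roeAlgebra) (g : Z.Reduction) :
    restrictFun Z T g.rng g.src = extension T g.1 := dif_pos g.1.2

theorem exists_restrictFun_support (Z : X.ClosedInvariant) (T : X.roeAlgebra) :
    ∃ R : ℕ, ∀ p q, restrictFun Z T p q ≠ 0 → (p.1, q.1) ∈ clo (X.entourage R) := by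
  obtain ⟨R, hR⟩ := exists_extension_support T
  refine ⟨R, fun p q hpq => ?_⟩
  unfold restrictFun at hpq
  split_ifs at hpq with h
  · exact hR _ hpq
  · exact absurd rfl hpq

/-- The image of an element of `ℂ[X] ≅ C_c(G(X))` in `C_c(G(X)|_Z)` under restriction of functions
to `G(X)|_Z`. -/
noncomputable def restrict (Z : X.ClosedInvariant) (T : X.roeAlgebra) : Z.groupoidAlgebra :=
  ⟨⟨restrictFun Z T, by
    obtain ⟨R, hR⟩ := exists_restrictFun_support Z T
    exact ⟨fun p => ((clo_row_finite R p.1).preimage Subtype.val_injective.injOn).subset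
        fun q hq => hR p q hq,
      fun q => ((clo_col_finite R q.1).preimage Subtype.val_injective.injOn).subset
        fun p hp => hR p q hp⟩⟩,
    ClosedInvariant.isGroupoidFunction_iff.2 ⟨exists_restrictFun_support Z T,
      (ClosedInvariant.continuous_red_iff _).1
        (((continuous_extension T).comp continuous_subtype_val).congr fun g =>
          (restrictFun_apply Z T g).symm)⟩⟩

/-! ### Cores -/

variable (X) in
/-- The Stone–Čech boundary `∂βX = βX \ X`. -/
def boundary : Set X.Beta := (Set.range pure)ᶜ

/-- `∂βA`, the part of the closure of `A ⊆ X` in the boundary. -/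
def boundaryPart (A : Set X.Pt) : Set X.Beta := closure (pure '' A) ∩ X.boundary

/-- The saturation of a subset of `βX`: all `x` with `(a, x) ∈ G(X)` for some `a` in the subset. -/
def saturation (A : Set X.Beta) : Set X.Beta := {x | ∃ a ∈ A, ∃ g : X.CoarseGroupoid, g.1 = (a, x)}

theorem mem_closure_pure {A : Set X.Pt} {p : X.Beta} : p ∈ closure (pure '' A) ↔ A ∈ p := by
  rw [ultrafilterBasis_is_basis.mem_closure_iff]
  constructor
  · intro h
    by_contra hn
    rw [← Ultrafilter.compl_mem_iff_notMem] at hn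
    obtain ⟨_, h1, x, hx, rfl⟩ := h _ ⟨Aᶜ, rfl⟩ hn
    exact h1 hx
  · rintro h _ ⟨B, rfl⟩ hB
    obtain ⟨x, hx1, hx2⟩ := p.nonempty_of_mem (inter_mem h hB)
    exact ⟨pure x, hx2, x, hx1, rfl⟩

theorem eq_pure_of_clo {R : ℕ} {y : X.Pt} {q : X.Beta}
    (h : ((pure y : X.Beta), q) ∈ clo (X.entourage R)) : ∃ z, q = pure z := by
  rw [mem_clo] at h
  have h1 : {z | X.total.edist y z ≤ R} ∈ q := by
    by_contra hn
    rw [← Ultrafilter.compl_mem_iff_notMem] at hn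
    obtain ⟨x, z, hxz, h1, h2⟩ := h {y} (Set.mem_singleton y) _ hn
    rw [Set.mem_singleton_iff] at h1
    subst h1
    exact h2 hxz
  obtain ⟨z, -, hz⟩ := Ultrafilter.eq_pure_of_finite_mem (finite_ball y R) h1
  exact ⟨z, hz⟩

theorem mem_boundary_iff_of_clo {R : ℕ} {p q : X.Beta} (h : (p, q) ∈ clo (X.entourage R)) :
    p ∈ X.boundary ↔ q ∈ X.boundary := by
  refine not_congr ⟨?_, ?_⟩
  · rintro ⟨y, rfl⟩
    obtain ⟨z, rfl⟩ := eq_pure_of_clo h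
    exact ⟨z, rfl⟩
  · rintro ⟨y, rfl⟩
    obtain ⟨z, rfl⟩ := eq_pure_of_clo (clo_symm h)
    exact ⟨z, rfl⟩

/-- The core of a family of subsets `Y_i ⊆ X_i`: the complement in `∂βX` of the saturation of
`∂βYᶜ`, where `Y = ⋃_i Y_i`. -/
def core (Y : ∀ i, Set (X.V i)) : X.ClosedInvariant where
  carrier := X.boundary \ saturation (boundaryPart {p : X.Pt | p.2 ∈ Y p.1}ᶜ)
  isClosed := by
    set W : Set X.Pt := {p : X.Pt | p.2 ∈ Y p.1}ᶜ with hW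
    have h : X.boundary \ saturation (boundaryPart W) = X.boundary ∩
        ⋂ R : ℕ, {q | {x | ∃ w ∈ W, X.total.edist x w ≤ R} ∈ q}ᶜ := by
      ext q
      refine and_congr_right fun hq => ?_
      rw [Set.mem_iInter, ← not_exists_not, not_iff_not]
      constructor
      · rintro ⟨a, ⟨ha, -⟩, ⟨_, R, hg⟩, rfl⟩
        refine ⟨R, not_not.2 ?_⟩
        rw [mem_closure_pure] at ha
        by_contra hn
        change _ ∉ q at hn
        rw [← Ultrafilter.compl_mem_iff_notMem] at hn
        obtain ⟨x, y, hxy, h1, h2⟩ := mem_clo.1 hg _ ha _ hn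
        exact h2 ⟨x, h1, edist_le_symm hxy⟩
      · rintro ⟨R, hR⟩
        have hR : {x | ∃ w ∈ W, X.total.edist x w ≤ R} ∈ q := not_not.1 hR
        classical
        let t : X.Pt → X.Pt := fun x =>
          if h : ∃ w ∈ W, X.total.edist x w ≤ R then h.choose else x
        have ht : ∀ x, (∃ w ∈ W, X.total.edist x w ≤ R) → t x ∈ W ∧ X.total.edist x (t x) ≤ R := by
          intro x h
          simp only [t, dif_pos h]
          exact h.choose_spec
        have h1 : (q.map t, q) ∈ clo (X.entourage R) := by
          refine clo_symm (mem_clo.2 fun A hA B hB => ?_)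
          obtain ⟨x, hx1, hx2, hx3⟩ := q.nonempty_of_mem (inter_mem hA (inter_mem hR hB))
          exact ⟨x, t x, (ht x hx2).2, hx1, hx3⟩
        refine ⟨q.map t, ⟨mem_closure_pure.2 ?_, (mem_boundary_iff_of_clo h1).2 hq⟩,
          ⟨_, R, h1⟩, rfl⟩
        have h2 : t ⁻¹' W ∈ q := mem_of_superset hR fun x hx => (ht x hx).1
        exact h2
    rw [h]
    refine IsClosed.inter ?_ (isClosed_iInter fun R => (isOpen_mem _).isClosed_compl)
    have h2 : (Set.range pure : Set X.Beta) = ⋃ x, {u : X.Beta | {x} ∈ u} := by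
      ext u
      rw [Set.mem_iUnion]
      constructor
      · rintro ⟨x, rfl⟩
        exact ⟨x, Set.mem_singleton x⟩
      · rintro ⟨x, hx⟩
        obtain ⟨z, -, hz⟩ := Ultrafilter.eq_pure_of_finite_mem (Set.finite_singleton x) hx
        exact ⟨z, hz.symm⟩
    rw [boundary, h2]
    exact (isOpen_iUnion fun x => isOpen_mem _).isClosed_compl
  invariant := by
    have key : ∀ (R : ℕ) (p q : X.Beta), (p, q) ∈ clo (X.entourage R) →
        p ∈ X.boundary \ saturation (boundaryPart {p : X.Pt | p.2 ∈ Y p.1}ᶜ) →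
        q ∈ X.boundary \ saturation (boundaryPart {p : X.Pt | p.2 ∈ Y p.1}ᶜ) := by
      rintro R p q h ⟨h1, h2⟩
      refine ⟨(mem_boundary_iff_of_clo h).1 h1, ?_⟩
      rintro ⟨a, ha, ⟨_, S, hg⟩, rfl⟩
      exact h2 ⟨a, ha, ⟨_, S + R, clo_trans hg (clo_symm h)⟩, rfl⟩
    rintro ⟨⟨p, q⟩, R, hg⟩
    exact ⟨key R p q hg, key R q p (clo_symm hg)⟩

/-! ### Property (T) -/

variable (X)

/-- Geometric property (T): the spectrum of `Δ` in the maximal uniform Roe algebra `C*_{u,max}(X)`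
is contained in `{0} ∪ [c, ∞)` for some `c > 0`. -/
def GeometricPropertyT : Prop := ∃ c : ℝ, 0 < c ∧ HasSpectralGapMax X.laplacian c

/-- Almost boundary property (T) with respect to `Z`, a core of `X`: the spectrum of `Δ` in
`C*_max(G(X)|_Z)` is contained in `{0} ∪ [c, ∞)` for some `c > 0`. -/
def AlmostBoundaryT (Z : X.ClosedInvariant) : Prop :=
  ∃ c : ℝ, 0 < c ∧ HasSpectralGapMax (restrict Z X.laplacian) c

end BoxSpace

/-- `a` is a sum of (hermitian) squares in the ⋆-algebra `A`. -/
def IsSumOfHermitianSquares {A : Type u} [Ring A] [StarRing A] (a : A) : Prop :=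
  ∃ (n : ℕ) (s : Fin n → A), a = ∑ k, star (s k) * s k

/-!
# Spectral gaps from linking graphs

The argument is Żuk's local criterion, carried out with matrices instead of vectors so that it takes
place in `ℂ[X]` and passes to the groupoid algebras.

Let `τ(x) = ∑_{y ∼ x} τ(x, y)`, and let `q_x` be the quadratic form on functions on the linking
graph `L_x` given by
`q_x(g) = λ⁻¹ · ½ ∑_{y ∼ z} |g(y) - g(z)|² - ∑_y τ(x, y) |g(y)|² + τ(x)⁻¹ |∑_y τ(x, y) g(y)|²`.
As `τ(x, y)` is the degree of `y` in `L_x`, the form `q_x` is the Poincaré inequality of `L_x`: it is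
positive semidefinite when `L_x` is connected and `λ₁(L_x) ≥ λ` (`linkForm_posSemidef`). Counting
triangles gives `∑_x q_x = Δ_τ τ⁻¹ Δ_τ - (2 - λ⁻¹) Δ_τ` (`laplacianTri_mul_inv_mul_apply`). Since
`τ ≥ 1` wherever `Δ_τ` has a nonzero row, `Δ_τ (1 - τ⁻¹) Δ_τ` is a hermitian square, and
`Δ_τ² - (2 - λ⁻¹) Δ_τ` is this square plus `∑_x q_x`.

The form `q_x` is a sum of at most `deg x` rank one squares `v v*`, where `v` is supported near `x`.
Taking these vectors as the rows at `x` of boundedly many matrices turns a sum of `q_x` into a finite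
sum `∑ S* S` in `ℂ[X]` (`exists_sum_of_local_squares`). If the gap hypothesis holds only on `Y`, the
terms `q_x` with `x ∉ Y` are left over; the nonzero rows of their sum lie near the complement of `Y`,
so that it restricts to zero on `core(Y)` (`restrict_core_eq_zero`). Restriction is a unital
⋆-homomorphism (`restrictHom`), because the values of the extension of a matrix are limits of its
entries along ultrafilters.

In a C⋆-algebra, `b ≥ 0` and `b² ≥ c b` give the spectral gap `c` of `b` by spectral mapping. For the
unweighted operator, let `b` be `Δ_τ` plus the Laplace operator of the edges in no triangle. By
connectedness of the linking graphs these edges are components of `X`, so `b² ≥ c b` still holds.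
All edge weights of `b` lie between `1` and a constant `d`, so that `Δ ≤ b ≤ d Δ`, and `Δ` inherits
the gap `c / d` (`sq_sub_nonneg_of_comparable`).
-/

/-! ### The maximal completion as a C⋆-algebra -/

section MaxCStarAlgebra

variable (A : Type u) [Ring A] [StarRing A] [Algebra ℂ A] [MaxNormFinite A]

theorem isClosed_maxCStar :
    IsClosed (MaxCStar A : Set (lp (fun ρ : StarRep A => ρ.H →L[ℂ] ρ.H) ∞)) :=
  StarSubalgebra.isClosed_topologicalClosure _

noncomputable instance : CStarAlgebra (MaxCStar A) where
  __ := (inferInstance : NormedRing (MaxCStar A))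
  __ := (inferInstance : StarRing (MaxCStar A))
  __ := (inferInstance : NormedAlgebra ℂ (MaxCStar A))
  __ := (inferInstance : StarModule ℂ (MaxCStar A))
  __ := (isClosed_maxCStar A).completeSpace_coe
  norm_mul_self_le := (inferInstance : CStarRing (MaxCStar A)).norm_mul_self_le

/-- The canonical map to the maximal completion, `toMax`, as a unital ⋆-homomorphism. -/
noncomputable def toMaxHom : A →⋆ₐ[ℂ] MaxCStar A :=
  (universalRep A).codRestrict (MaxCStar A) fun a =>
    StarSubalgebra.le_topologicalClosure _ ⟨a, rfl⟩

end MaxCStarAlgebra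

/-! ### Spectral gaps in C⋆-algebras -/

section SpectralGap

variable {M : Type*} [CStarAlgebra M] [PartialOrder M] [StarOrderedRing M]

/-- By spectral mapping, `t² - c t ≥ 0` for every `t` in the spectrum of `b`. -/
theorem spectrum_subset_of_sq_sub_nonneg {b : M} {c : ℝ} (hb : 0 ≤ b)
    (h : 0 ≤ b ^ 2 - c • b) : spectrum ℝ b ⊆ {0} ∪ Set.Ici c := by
  intro t ht
  have ht0 : 0 ≤ t := spectrum_nonneg_of_nonneg hb ht
  have hmem : t ^ 2 - c * t ∈ spectrum ℝ (b ^ 2 - c • b) := by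
    have h1 := spectrum.subset_polynomial_aeval b (Polynomial.X ^ 2 - Polynomial.C c * Polynomial.X)
      ⟨t, ht, rfl⟩
    simpa [Algebra.smul_def] using h1
  have h2 : 0 ≤ t ^ 2 - c * t := spectrum_nonneg_of_nonneg h hmem
  rcases ht0.eq_or_lt with h0 | h0
  · exact Or.inl h0.symm
  · exact Or.inr (by
      have : 0 ≤ t * (t - c) := by nlinarith
      exact sub_nonneg.1 (nonneg_of_mul_nonneg_right this h0))

/-- A spectral gap passes to comparable positive elements. If `p` is the spectral projection of `b`
at `0`, then `p a p ≤ p b p = 0`, so `a` lives under `1 - p`, where `d a ≥ b ≥ c`. -/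
theorem sq_sub_nonneg_of_comparable {a b : M} {c d : ℝ} (hc : 0 < c) (hd : 0 < d) (ha : 0 ≤ a)
    (hab : a ≤ b) (hba : b ≤ d • a) (hb : 0 ≤ b ^ 2 - c • b) : 0 ≤ a ^ 2 - (c / d) • a := by
  have hb0 : 0 ≤ b := ha.trans hab
  have hsa : IsSelfAdjoint b := .of_nonneg hb0
  have hspec := spectrum_subset_of_sq_sub_nonneg hb0 hb
  set f : ℝ → ℝ := fun t => min (t / c) 1 with hf
  have hfc : Continuous f := by fun_prop
  set e : M := cfc f b with he
  have hesa : IsSelfAdjoint e := cfc_predicate f b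
  -- `b (1 - e) = 0`
  have hbe : b * e = b := by
    conv_lhs => rw [← cfc_id ℝ b]
    rw [he, cfc_id ℝ b]
    nth_rw 1 [← cfc_id ℝ b]
    rw [← cfc_mul id f b]
    conv_rhs => rw [← cfc_id ℝ b]
    refine cfc_congr fun t ht => ?_
    rcases hspec ht with h0 | h0
    · rw [Set.mem_singleton_iff.1 h0]
      simp
    · have : 1 ≤ t / c := (one_le_div hc).2 h0
      simp [f, min_eq_right this]
  -- `c e ≤ b`
  have hce : c • e ≤ b := by
    rw [← sub_nonneg]
    have h1 : b - c • e = cfc (fun t => t - c * f t) b := by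
      rw [cfc_sub (fun t => t) (fun t => c * f t) b, cfc_id' ℝ b, cfc_const_mul c f b]
    rw [h1]
    refine cfc_nonneg fun t _ => ?_
    have h2 : c * f t ≤ c * (t / c) := mul_le_mul_of_nonneg_left (min_le_left _ _) hc.le
    rw [mul_div_cancel₀ _ hc.ne'] at h2
    linarith
  set s : M := CFC.sqrt a with hs
  have hss : s * s = a := CFC.sqrt_mul_sqrt_self a
  have hsa' : IsSelfAdjoint s := .of_nonneg (CFC.sqrt_nonneg a)
  set p : M := 1 - e with hp
  have hpsa : IsSelfAdjoint p := (IsSelfAdjoint.one M).sub hesa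
  have hbp : b * p = 0 := by rw [hp, mul_sub, mul_one, hbe, sub_self]
  have hpap : star p * a * p = 0 := by
    refine le_antisymm ?_ (star_left_conjugate_nonneg ha p)
    have := star_left_conjugate_le_conjugate hab p
    rwa [mul_assoc _ b, hbp, mul_zero] at this
  have hsp : s * p = 0 := by
    rw [← CStarRing.star_mul_self_eq_zero_iff, star_mul, hsa'.star_eq, mul_assoc, ← mul_assoc s,
      hss, ← mul_assoc]
    exact hpap
  have hse : s * e = s := by
    rw [hp, mul_sub, mul_one, sub_eq_zero] at hsp
    exact hsp.symm
  have hae : (c / d) • e ≤ a := by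
    have h1 : c • e ≤ d • a := hce.trans hba
    have h2 := smul_le_smul_of_nonneg_left h1 (inv_nonneg.2 hd.le)
    rwa [smul_smul, smul_smul, inv_mul_cancel₀ hd.ne', one_smul, inv_mul_eq_div] at h2
  have h3 := star_left_conjugate_le_conjugate hae s
  rw [hsa'.star_eq, mul_smul_comm, smul_mul_assoc, hse, hss] at h3
  rw [sub_nonneg, pow_two]
  calc (c / d) • a ≤ s * a * s := h3
    _ = a * a := by rw [← hss]; simp only [mul_assoc]

end SpectralGap

/-! ### Sums of hermitian squares -/

theorem IsSumOfHermitianSquares.map {A B : Type*} [Ring A] [StarRing A] [Ring B] [StarRing B]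
    [Algebra ℂ A] [Algebra ℂ B] (φ : A →⋆ₐ[ℂ] B) {a : A} (h : IsSumOfHermitianSquares a) :
    IsSumOfHermitianSquares (φ a) := by
  obtain ⟨n, s, rfl⟩ := h
  exact ⟨n, fun k => φ (s k), by simp [map_sum, map_mul, map_star]⟩

theorem IsSumOfHermitianSquares.add {A : Type*} [Ring A] [StarRing A] {a b : A}
    (ha : IsSumOfHermitianSquares a) (hb : IsSumOfHermitianSquares b) :
    IsSumOfHermitianSquares (a + b) := by
  obtain ⟨n, s, rfl⟩ := ha
  obtain ⟨m, t, rfl⟩ := hb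
  exact ⟨n + m, Fin.append s t, by simp [Fin.sum_univ_add]⟩

theorem isSumOfHermitianSquares_star_mul_self {A : Type*} [Ring A] [StarRing A] (s : A) :
    IsSumOfHermitianSquares (star s * s) :=
  ⟨1, fun _ => s, by simp⟩

theorem IsSumOfHermitianSquares.smul {A : Type*} [Ring A] [StarRing A] [Algebra ℂ A]
    [StarModule ℂ A] {a : A} (h : IsSumOfHermitianSquares a) {r : ℝ} (hr : 0 ≤ r) :
    IsSumOfHermitianSquares ((r : ℂ) • a) := by
  obtain ⟨n, s, rfl⟩ := h
  refine ⟨n, fun k => ((Real.sqrt r : ℝ) : ℂ) • s k, ?_⟩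
  have h1 : ((Real.sqrt r : ℝ) : ℂ) * ((Real.sqrt r : ℝ) : ℂ) = r := by
    rw [← Complex.ofReal_mul, Real.mul_self_sqrt hr]
  simp only [Finset.smul_sum, star_smul, Complex.star_def, Complex.conj_ofReal,
    smul_mul_smul_comm, h1]

theorem IsSumOfHermitianSquares.isSelfAdjoint {A : Type*} [Ring A] [StarRing A] {a : A}
    (h : IsSumOfHermitianSquares a) : IsSelfAdjoint a := by
  obtain ⟨n, s, rfl⟩ := h
  simp [IsSelfAdjoint]

theorem IsSumOfHermitianSquares.nonneg {A : Type*} [Ring A] [StarRing A] [PartialOrder A]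
    [StarOrderedRing A] {a : A} (h : IsSumOfHermitianSquares a) : 0 ≤ a := by
  obtain ⟨n, s, rfl⟩ := h
  exact Finset.sum_nonneg fun k _ => star_mul_self_nonneg (s k)

/-! ### Spectral gaps in maximal completions -/

section MaxGap

variable {A : Type u} [Ring A] [StarRing A] [Algebra ℂ A]

section

variable {M : Type*} [CStarAlgebra M]

theorem complex_spectrum_subset [PartialOrder M] [StarOrderedRing M] {b : M} {c : ℝ} (hb : 0 ≤ b)
    (h : 0 ≤ b ^ 2 - c • b) :
    spectrum ℂ b ⊆ {0} ∪ (fun r : ℝ => (r : ℂ)) '' Set.Ici c := by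
  have h1 := spectrum_subset_of_sq_sub_nonneg hb h
  rw [← (IsSelfAdjoint.of_nonneg hb).spectrumRestricts.algebraMap_image]
  rintro _ ⟨t, ht, rfl⟩
  rcases h1 ht with h0 | h0
  · exact Or.inl (by rw [Set.mem_singleton_iff.1 h0]; simp)
  · exact Or.inr ⟨t, h0, rfl⟩

attribute [local instance] CStarAlgebra.spectralOrder CStarAlgebra.spectralOrderedRing in
theorem spectrum_map_subset (φ : A →⋆ₐ[ℂ] M) {a : A} {c : ℝ}
    (ha : IsSumOfHermitianSquares a) (h : IsSumOfHermitianSquares (a ^ 2 - (c : ℂ) • a)) :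
    spectrum ℂ (φ a) ⊆ {0} ∪ (fun r : ℝ => (r : ℂ)) '' Set.Ici c := by
  refine complex_spectrum_subset (ha.map φ).nonneg ?_
  have := (h.map φ).nonneg
  rwa [map_sub, map_pow, map_smul, Complex.coe_smul] at this

attribute [local instance] CStarAlgebra.spectralOrder CStarAlgebra.spectralOrderedRing in
theorem spectrum_map_subset_of_comparable (φ : A →⋆ₐ[ℂ] M) {a b : A} {c d : ℝ}
    (hc : 0 < c) (hd : 0 < d)
    (ha : IsSumOfHermitianSquares a) (hab : IsSumOfHermitianSquares (b - a))
    (hba : IsSumOfHermitianSquares ((d : ℂ) • a - b))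
    (hb : IsSumOfHermitianSquares (b ^ 2 - (c : ℂ) • b)) :
    spectrum ℂ (φ a) ⊆ {0} ∪ (fun r : ℝ => (r : ℂ)) '' Set.Ici (c / d) := by
  have h1 := (ha.map φ).nonneg
  have h2 := (hab.map φ).nonneg
  have h3 := (hba.map φ).nonneg
  have h4 := (hb.map φ).nonneg
  rw [map_sub, sub_nonneg] at h2
  rw [map_sub, map_smul, Complex.coe_smul, sub_nonneg] at h3
  rw [map_sub, map_pow, map_smul, Complex.coe_smul] at h4
  exact complex_spectrum_subset h1 (sq_sub_nonneg_of_comparable hc hd h1 h2 h3 h4)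

end

variable [MaxNormFinite A]

theorem IsSumOfHermitianSquares.hasSpectralGapMax {a : A} {c : ℝ}
    (ha : IsSumOfHermitianSquares a) (h : IsSumOfHermitianSquares (a ^ 2 - (c : ℂ) • a)) :
    HasSpectralGapMax a c :=
  spectrum_map_subset (M := MaxCStar A) (toMaxHom A) ha h

/-- If `a ≤ b ≤ d a` and `b² ≥ c b`, all up to sums of hermitian squares, then `a` has a spectral
gap. -/
theorem hasSpectralGapMax_of_comparable {a b : A} {c d : ℝ} (hc : 0 < c) (hd : 0 < d)
    (ha : IsSumOfHermitianSquares a) (hab : IsSumOfHermitianSquares (b - a))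
    (hba : IsSumOfHermitianSquares ((d : ℂ) • a - b))
    (hb : IsSumOfHermitianSquares (b ^ 2 - (c : ℂ) • b)) : HasSpectralGapMax a (c / d) :=
  spectrum_map_subset_of_comparable (M := MaxCStar A) (toMaxHom A) hc hd ha hab hba hb

end MaxGap

/-! ### Restriction to a closed invariant set as a ⋆-homomorphism -/

namespace BoxSpace

variable {X : BoxSpace.{u}}

open scoped Classical in
/-- `extension T`, extended by zero to a function on `βX × βX`. -/
noncomputable def extFun (T : X.roeAlgebra) (g : X.Beta × X.Beta) : ℂ :=
  if h : ∃ R : ℕ, g ∈ clo (X.entourage R) then extension T ⟨g, h⟩ else 0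

theorem restrict_apply (Z : X.ClosedInvariant) (T : X.roeAlgebra) (p q : Z.carrier) :
    (restrict Z T).1 p q = extFun T (p.1, q.1) := rfl

theorem extFun_pure (T : X.roeAlgebra) {x y : X.Pt} {S : ℕ} (h : X.total.edist x y ≤ S) :
    extFun T (pure x, pure y) = T.1 x y := by
  have h1 : ∃ R : ℕ, ((pure x, pure y) : X.Beta × X.Beta) ∈ clo (X.entourage R) :=
    ⟨S, pure_mem_clo.2 h⟩
  rw [extFun, dif_pos h1]
  exact (existsUnique_extension T).choose_spec.1.2 _ x y rfl

theorem continuousOn_extFun (T : X.roeAlgebra) (S : ℕ) :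
    ContinuousOn (extFun T) (clo (X.entourage S)) := by
  rw [continuousOn_iff_continuous_domRestrict]
  refine ((continuous_extension T).comp (continuous_cloIncl S)).congr fun g => ?_
  have h : ∃ R : ℕ, g.1 ∈ clo (X.entourage R) := ⟨S, g.2⟩
  rw [Set.domRestrict_apply, extFun, dif_pos h]
  rfl

theorem exists_extFun_support (T : X.roeAlgebra) :
    ∃ R : ℕ, ∀ g, extFun T g ≠ 0 → g ∈ clo (X.entourage R) := by
  obtain ⟨R, hR⟩ := exists_extension_support T
  refine ⟨R, fun g hg => ?_⟩
  unfold extFun at hg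
  split_ifs at hg with h
  · exact hR _ hg
  · exact absurd rfl hg

theorem map_mem_clo {p : X.Beta} {g f : X.Pt → X.Pt} {S : ℕ}
    (h : ∀ᶠ x in (p : Filter X.Pt), X.total.edist (g x) (f x) ≤ S) :
    (p.map g, p.map f) ∈ clo (X.entourage S) := by
  refine mem_clo.2 fun A hA B hB => ?_
  have hA' : ∀ᶠ x in (p : Filter X.Pt), g x ∈ A := hA
  have hB' : ∀ᶠ x in (p : Filter X.Pt), f x ∈ B := hB
  obtain ⟨x, h1, h2, h3⟩ := (h.and (hA'.and hB')).exists
  exact ⟨g x, f x, h1, h2, h3⟩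

/-- The values of the extension of a matrix are limits of its entries along ultrafilters. -/
theorem tendsto_extFun (T : X.roeAlgebra) {p : X.Beta} {g f : X.Pt → X.Pt} {S : ℕ}
    (h : ∀ᶠ x in (p : Filter X.Pt), X.total.edist (g x) (f x) ≤ S) :
    Tendsto (fun x => T.1 (g x) (f x)) p (𝓝 (extFun T (p.map g, p.map f))) := by
  have h1 : Tendsto (fun x => ((pure (g x), pure (f x)) : X.Beta × X.Beta)) p
      (𝓝[clo (X.entourage S)] (p.map g, p.map f)) := by
    refine tendsto_nhdsWithin_iff.2 ⟨?_, h.mono fun x hx => pure_mem_clo.2 hx⟩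
    have hp := Ultrafilter.tendsto_pure_self p
    exact (((continuous_map g).tendsto p).comp hp).prodMk_nhds
      (((continuous_map f).tendsto p).comp hp)
  refine ((continuousOn_extFun T S _ (map_mem_clo h)).tendsto.comp h1).congr' ?_
  filter_upwards [h] with x hx
  exact extFun_pure T hx

theorem tendsto_extFun_left (T : X.roeAlgebra) {p : X.Beta} {f : X.Pt → X.Pt} {S : ℕ}
    (h : ∀ᶠ x in (p : Filter X.Pt), X.total.edist x (f x) ≤ S) :
    Tendsto (fun x => T.1 x (f x)) p (𝓝 (extFun T (p, p.map f))) := by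
  have := tendsto_extFun T (g := id) h
  rwa [Ultrafilter.map_id] at this

theorem exists_map_of_clo {p q : X.Beta} {S : ℕ} (h : (p, q) ∈ clo (X.entourage S)) :
    ∃ f : X.Pt → X.Pt, (∀ᶠ x in (p : Filter X.Pt), X.total.edist x (f x) ≤ S) ∧ q = p.map f := by
  obtain ⟨N, c, hc⟩ := X.exists_coloring (S + S)
  obtain ⟨j, hj⟩ := exists_color c q
  exact ⟨tr c S j, (mem_clo_iff_tr hc subset_rfl hj).1 h⟩

theorem extFun_of_not_mem (T : X.roeAlgebra) {g : X.Beta × X.Beta}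
    (h : ¬ ∃ R : ℕ, g ∈ clo (X.entourage R)) : extFun T g = 0 := dif_neg h

theorem extFun_add (a b : X.roeAlgebra) (g : X.Beta × X.Beta) :
    extFun (a + b) g = extFun a g + extFun b g := by
  by_cases hg : ∃ R : ℕ, g ∈ clo (X.entourage R)
  · obtain ⟨p, q⟩ := g
    obtain ⟨R, hR⟩ := hg
    obtain ⟨f, hf, rfl⟩ := exists_map_of_clo hR
    exact tendsto_nhds_unique (tendsto_extFun_left (a + b) hf)
      ((tendsto_extFun_left a hf).add (tendsto_extFun_left b hf))
  · simp [extFun_of_not_mem _ hg]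

theorem extFun_smul (c : ℂ) (a : X.roeAlgebra) (g : X.Beta × X.Beta) :
    extFun (c • a) g = c * extFun a g := by
  by_cases hg : ∃ R : ℕ, g ∈ clo (X.entourage R)
  · obtain ⟨p, q⟩ := g
    obtain ⟨R, hR⟩ := hg
    obtain ⟨f, hf, rfl⟩ := exists_map_of_clo hR
    exact tendsto_nhds_unique (tendsto_extFun_left (c • a) hf)
      ((tendsto_extFun_left a hf).const_mul c)
  · simp [extFun_of_not_mem _ hg]

theorem extFun_star (a : X.roeAlgebra) (p q : X.Beta) :
    extFun (star a) (p, q) = (starRingEnd ℂ) (extFun a (q, p)) := by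
  by_cases hg : ∃ R : ℕ, (p, q) ∈ clo (X.entourage R)
  · obtain ⟨R, hR⟩ := hg
    obtain ⟨f, hf, rfl⟩ := exists_map_of_clo hR
    have h1 : ∀ᶠ x in (p : Filter X.Pt), X.total.edist (f x) (id x) ≤ R :=
      hf.mono fun x hx => edist_le_symm hx
    have h2 := tendsto_extFun a h1
    rw [Ultrafilter.map_id] at h2
    exact tendsto_nhds_unique (tendsto_extFun_left (star a) hf)
      ((Complex.continuous_conj.tendsto _).comp h2)
  · rw [extFun_of_not_mem _ hg, extFun_of_not_mem, map_zero]
    rintro ⟨R, hR⟩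
    exact hg ⟨R, clo_symm hR⟩

open scoped Classical in
theorem extFun_one (p q : X.Beta) :
    extFun (1 : X.roeAlgebra) (p, q) = if p = q then 1 else 0 := by
  have hone : ∀ x y, (1 : X.roeAlgebra).1 x y = if x = y then 1 else 0 := fun x y => by
    refine Eq.trans (LFKernel.one_apply x y) ?_
    congr
  by_cases hg : ∃ R : ℕ, (p, q) ∈ clo (X.entourage R)
  · split_ifs with hpq
    · subst hpq
      have h1 : ∀ᶠ x in (p : Filter X.Pt), X.total.edist x (id x) ≤ (0 : ℕ) := by simp
      have h2 := tendsto_extFun_left (1 : X.roeAlgebra) h1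
      rw [Ultrafilter.map_id] at h2
      refine tendsto_nhds_unique h2 (tendsto_const_nhds.congr fun x => ?_)
      rw [hone, id, if_pos rfl]
    · obtain ⟨R, hR⟩ := hg
      obtain ⟨f, hf, rfl⟩ := exists_map_of_clo hR
      have h1 : ∀ᶠ x in (p : Filter X.Pt), x ≠ f x := by
        by_contra hn
        rw [Ultrafilter.eventually_not, not_not] at hn
        refine hpq (Ultrafilter.coe_injective ?_)
        rw [Ultrafilter.coe_map]
        exact (Filter.map_id.symm.trans (Filter.map_congr hn))
      refine tendsto_nhds_unique (tendsto_extFun_left (1 : X.roeAlgebra) hf)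
        (tendsto_const_nhds.congr' ?_)
      filter_upwards [h1] with x hx
      rw [hone, if_neg hx]
  · rw [extFun_of_not_mem _ hg, if_neg]
    rintro rfl
    exact hg ⟨0, clo_zero.2 rfl⟩

theorem restrict_mul (Z : X.ClosedInvariant) (a b : X.roeAlgebra) :
    restrict Z (a * b) = restrict Z a * restrict Z b := by
  classical
  refine Subtype.ext (LFKernel.ext fun p q => ?_)
  change extFun (a * b) (p.1, q.1) = ((restrict Z a).1 * (restrict Z b).1) p q
  obtain ⟨R₀, hR₀⟩ := a.2.1
  obtain ⟨R₁, hR₁⟩ := exists_extFun_support a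
  set R := max R₀ R₁ with hR
  have hsupp : ∀ x y, a.1 x y ≠ 0 → X.total.edist x y ≤ R := fun x y h =>
    edist_le_mono (le_of_not_ge fun h' => h (hR₀ _ _ h')) (le_max_left _ _)
  have hsupp' : ∀ g, extFun a g ≠ 0 → g ∈ clo (X.entourage R) := fun g h =>
    clo_mono (entourage_mono (le_max_right _ _)) (hR₁ g h)
  by_cases hg : ∃ R : ℕ, (p.1, q.1) ∈ clo (X.entourage R)
  swap
  · rw [extFun_of_not_mem _ hg]
    by_contra hne
    obtain ⟨r, h1, h2⟩ := LFKernel.exists_ne_of_finsum_ne_zero (Ne.symm hne)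
    obtain ⟨R', hR'⟩ := exists_extFun_support b
    exact hg ⟨_, clo_trans (hsupp' _ h1) (hR' _ h2)⟩
  obtain ⟨S, hS⟩ := hg
  obtain ⟨f, hf, hq⟩ := exists_map_of_clo hS
  obtain ⟨N, c, hc⟩ := X.exists_coloring (R + R)
  set D : Fin N → Set X.Pt := fun j => {x | X.total.edist x (tr c R j x) ≤ R ∧ c (tr c R j x) = j}
  set J : Finset (Fin N) := Finset.univ.filter fun j => ∀ᶠ x in (p.1 : Filter X.Pt), x ∈ D j
  have hJ : ∀ {j}, j ∈ J → ∀ᶠ x in (p.1 : Filter X.Pt), x ∈ D j := fun hj =>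
    (Finset.mem_filter.1 hj).2
  -- the composable pairs over `(x, f x)` for `x` close to `p`
  have hmat : ∀ᶠ x in (p.1 : Filter X.Pt), (a * b).1 x (f x) =
      ∑ j ∈ J, a.1 x (tr c R j x) * b.1 (tr c R j x) (f x) := by
    have h1 : ∀ᶠ x in (p.1 : Filter X.Pt), ∀ j, x ∈ D j ↔ j ∈ J := by
      rw [Filter.eventually_all]
      intro j
      by_cases hj : j ∈ J
      · exact (hJ hj).mono fun x hx => ⟨fun _ => hj, fun _ => hx⟩
      · have : ∀ᶠ x in (p.1 : Filter X.Pt), ¬ x ∈ D j := by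
          rw [Ultrafilter.eventually_not]
          exact fun h => hj (Finset.mem_filter.2 ⟨Finset.mem_univ _, h⟩)
        exact this.mono fun x hx => ⟨fun h => absurd h hx, fun h => absurd h hj⟩
    filter_upwards [h1] with x hx
    change (a.1 * b.1) x (f x) = _
    rw [LFKernel.mul_apply_of_subset a.1 b.1 x (f x) (J.image fun j => tr c R j x),
      Finset.sum_image]
    · intro j hj j' hj' hjj
      have h3 := ((hx j).2 hj).2
      have h4 := ((hx j').2 hj').2
      rw [← h3, ← h4]
      exact congrArg c hjj
    · intro r hr _
      have h3 := hsupp x r hr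
      have h4 := tr_eq hc h3
      exact Finset.mem_image.2 ⟨c r, (hx _).1 ⟨by rwa [h4], by rw [h4]⟩, h4⟩
  have hmem : ∀ {j}, j ∈ J → (p.1, p.1.map (tr c R j)) ∈ clo (X.entourage R) := fun hj => by
    have := map_mem_clo (g := id) ((hJ hj).mono fun x hx => hx.1)
    rwa [Ultrafilter.map_id] at this
  let e : Fin N → Z.carrier := fun j =>
    if h : j ∈ J then ⟨p.1.map (tr c R j), (ClosedInvariant.mem_of_clo (hmem h)).1 p.2⟩ else p
  have he : ∀ {j}, j ∈ J → (e j).1 = p.1.map (tr c R j) := fun hj => by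
    simp only [e, dif_pos hj]
  have hcol : ∀ {j}, j ∈ J → {y | c y = j} ∈ (e j).1 := fun {j} hj => by
    rw [he hj]
    exact (hJ hj).mono fun x hx => hx.2
  have hker : ((restrict Z a).1 * (restrict Z b).1) p q =
      ∑ j ∈ J, extFun a (p.1, p.1.map (tr c R j)) * extFun b (p.1.map (tr c R j), p.1.map f) := by
    rw [LFKernel.mul_apply_of_subset _ _ p q (J.image e), Finset.sum_image]
    · refine Finset.sum_congr rfl fun j hj => ?_
      rw [restrict_apply, restrict_apply, he hj, hq]
    · intro j hj j' hj' hjj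
      have h3 := hcol hj
      rw [hjj] at h3
      obtain ⟨y, hy1, hy2⟩ := (e j').1.nonempty_of_mem (inter_mem h3 (hcol hj'))
      exact hy1.symm.trans hy2
    · intro r hr _
      have h1 := hsupp' _ hr
      obtain ⟨j, hj⟩ := exists_color c r.1
      obtain ⟨h2, h3⟩ := (mem_clo_iff_tr hc subset_rfl hj).1 h1
      rw [h3] at hj
      have h4 : j ∈ J := Finset.mem_filter.2 ⟨Finset.mem_univ _, inter_mem h2 hj⟩
      exact Finset.mem_image.2 ⟨j, h4, Subtype.ext (by rw [he h4, ← h3])⟩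
  rw [hker, hq]
  refine tendsto_nhds_unique (tendsto_extFun_left (a * b) hf) (Tendsto.congr'
    (hmat.mono fun x hx => hx.symm) (tendsto_finsetSum _ fun j hj => Tendsto.mul ?_ ?_))
  · exact tendsto_extFun_left a ((hJ hj).mono fun x hx => hx.1)
  · refine tendsto_extFun b (S := R + S) ?_
    filter_upwards [hJ hj, hf] with x h1 h2
    exact edist_le_trans (edist_le_symm h1.1) h2

open scoped Classical in
/-- Restriction `ℂ[X] → C_c(G(X)|_Z)` as a unital ⋆-homomorphism. -/
noncomputable def restrictHom (Z : X.ClosedInvariant) : X.roeAlgebra →⋆ₐ[ℂ] Z.groupoidAlgebra where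
  toAlgHom := AlgHom.ofLinearMap
    { toFun := restrict Z
      map_add' := fun a b => Subtype.ext (LFKernel.ext fun p q => extFun_add a b (p.1, q.1))
      map_smul' := fun c a => Subtype.ext (LFKernel.ext fun p q => extFun_smul c a (p.1, q.1)) }
    (Subtype.ext (LFKernel.ext fun p q => (extFun_one p.1 q.1).trans (by
      rw [← Subtype.ext_iff.eq]
      exact (LFKernel.one_apply p q).symm)))
    (restrict_mul Z)
  map_star' := fun a => Subtype.ext (LFKernel.ext fun p q => extFun_star a p.1 q.1)

theorem restrictHom_apply (Z : X.ClosedInvariant) (T : X.roeAlgebra) :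
    restrictHom Z T = restrict Z T := rfl

/-- The core avoids the closure of every neighbourhood of the complement of `Y`. -/
theorem eventually_of_mem_core {Y : ∀ i, Set (X.V i)} {p : X.Beta} (hp : p ∈ (core Y).carrier)
    (R : ℕ) : ∀ᶠ x in (p : Filter X.Pt), ∀ w : X.Pt, X.total.edist x w ≤ R → w.2 ∈ Y w.1 := by
  classical
  by_contra hn
  rw [← Ultrafilter.eventually_not] at hn
  have hn' : ∀ᶠ x in (p : Filter X.Pt), ∃ w : X.Pt, X.total.edist x w ≤ R ∧ w.2 ∉ Y w.1 := by
    simpa only [not_forall, exists_prop] using hn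
  let t : X.Pt → X.Pt := fun x =>
    if h : ∃ w : X.Pt, X.total.edist x w ≤ R ∧ w.2 ∉ Y w.1 then h.choose else x
  have ht : ∀ᶠ x in (p : Filter X.Pt), X.total.edist x (t x) ≤ R ∧ (t x).2 ∉ Y (t x).1 := by
    filter_upwards [hn'] with x hx
    have hx' : t x = hx.choose := dif_pos hx
    rw [hx']
    exact hx.choose_spec
  have h1 : (p.map t, p) ∈ clo (X.entourage R) := by
    have := map_mem_clo (p := p) (g := t) (f := id) (ht.mono fun x hx => edist_le_symm hx.1)
    rwa [Ultrafilter.map_id] at this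
  exact hp.2 ⟨p.map t, ⟨mem_closure_pure.2 (ht.mono fun x hx => hx.2),
    (mem_boundary_iff_of_clo h1).2 hp.1⟩, ⟨_, R, h1⟩, rfl⟩

/-- Matrices whose nonzero rows stay close to the complement of `Y` vanish on the core. -/
theorem restrict_core_eq_zero {Y : ∀ i, Set (X.V i)} {T : X.roeAlgebra} {R : ℕ}
    (h : ∀ y z, T.1 y z ≠ 0 → ∃ w : X.Pt, X.total.edist y w ≤ R ∧ w.2 ∉ Y w.1) :
    restrict (core Y) T = 0 := by
  refine Subtype.ext (LFKernel.ext fun p q => ?_)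
  change extFun T (p.1, q.1) = 0
  by_cases hg : ∃ R : ℕ, (p.1, q.1) ∈ clo (X.entourage R)
  · obtain ⟨S, hS⟩ := hg
    obtain ⟨f, hf, hq⟩ := exists_map_of_clo hS
    rw [hq]
    refine tendsto_nhds_unique (tendsto_extFun_left T hf) (tendsto_const_nhds.congr' ?_)
    filter_upwards [eventually_of_mem_core p.2 R] with x hx
    by_contra hne
    obtain ⟨w, h1, h2⟩ := h x (f x) (Ne.symm hne)
    exact h2 (hx w h1)
  · exact extFun_of_not_mem T hg

end BoxSpace

/-! ### Sums of local squares in the Roe algebra -/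

theorem LFKernel.sum_apply {P : Type u} {ι : Type*} (s : Finset ι) (e : ι → LFKernel P) (p q : P) :
    (∑ j ∈ s, e j : LFKernel P) p q = ∑ j ∈ s, e j p q := by
  classical
  induction s using Finset.induction_on with
  | empty => simp
  | insert j s hj ih => rw [Finset.sum_insert hj, Finset.sum_insert hj, LFKernel.add_apply, ih]

namespace BoxSpace

variable {X : BoxSpace.{u}}

/-- A locally finite family of rank one squares sums to a finite sum of hermitian squares in `ℂ[X]`:
the `k`-th vector at `x` becomes the row at `x` of the `k`-th matrix. -/
theorem exists_sum_of_local_squares {ι : X.Pt → Type*} [∀ x, Fintype (ι x)] {N : ℕ}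
    (hN : ∀ x, Fintype.card (ι x) ≤ N) (v : ∀ x, ι x → X.Pt → ℂ) {R : ℕ}
    (hsupp : ∀ x i y, v x i y ≠ 0 → X.total.edist x y ≤ R) {C : ℝ} (hC0 : 0 ≤ C)
    (hC : ∀ x i y, ‖v x i y‖ ≤ C) :
    ∃ T : X.roeAlgebra, IsSumOfHermitianSquares T ∧
      ∀ y z, T.1 y z = ∑ᶠ x, ∑ i, (starRingEnd ℂ) (v x i y) * v x i z := by
  classical
  have hemb : ∀ x, Nonempty (ι x ↪ Fin N) := fun x =>
    Function.Embedding.nonempty_of_card_le (by simpa using hN x)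
  let e : ∀ x, ι x ↪ Fin N := fun x => (hemb x).some
  let v' : ∀ x, Fin N → X.Pt → ℂ := fun x => Function.extend (e x) (v x) 0
  have hv' : ∀ x k, v' x k = 0 ∨ ∃ i, v' x k = v x i := by
    intro x k
    by_cases hk : ∃ i, e x i = k
    · obtain ⟨i, rfl⟩ := hk
      exact Or.inr ⟨i, (e x).injective.extend_apply _ _ _⟩
    · exact Or.inl (Function.extend_apply' _ _ _ hk)
  have hsupp' : ∀ x k y, v' x k y ≠ 0 → X.total.edist x y ≤ R := by
    intro x k y h
    rcases hv' x k with h0 | ⟨i, hi⟩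
    · exact absurd (by rw [h0]; rfl) h
    · exact hsupp x i y (by rwa [hi] at h)
  have hC' : ∀ x k y, ‖v' x k y‖ ≤ C := by
    intro x k y
    rcases hv' x k with h0 | ⟨i, hi⟩
    · rw [h0]
      simpa using hC0
    · rw [hi]
      exact hC x i y
  have hsum : ∀ x y z, ∑ k, (starRingEnd ℂ) (v' x k y) * v' x k z =
      ∑ i, (starRingEnd ℂ) (v x i y) * v x i z := by
    intro x y z
    refine (Fintype.sum_of_injective (e x) (e x).injective _ _ (fun k hk => ?_) fun i => ?_).symm
    · have : v' x k = 0 := Function.extend_apply' _ _ _ hk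
      simp [this]
    · have : v' x (e x i) = v x i := (e x).injective.extend_apply _ _ _
      rw [this]
  let S : Fin N → X.roeAlgebra := fun k =>
    ⟨⟨fun x y => v' x k y,
      fun p => (finite_ball p R).subset fun q hq => hsupp' p k q hq,
      fun q => (finite_ball q R).subset fun p hp => edist_le_symm (hsupp' p k q hp)⟩,
      ⟨R + 1, fun x y h => by
        by_contra h'
        have h1 := h.trans (hsupp' x k y h')
        exact absurd (by exact_mod_cast h1 : R + 1 ≤ R) (by omega)⟩, C, fun x y => hC' x k y⟩
  refine ⟨∑ k, star (S k) * S k, ⟨N, S, rfl⟩, fun y z => ?_⟩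
  rw [AddSubmonoidClass.coe_finsetSum, LFKernel.sum_apply]
  have hball : ∀ x k, v' x k y ≠ 0 → x ∈ (finite_ball y R).toFinset := fun x k h => by
    simpa using edist_le_symm (hsupp' x k y h)
  rw [finsum_eq_sum_of_support_subset (s := (finite_ball y R).toFinset)]
  · simp_rw [← hsum]
    rw [Finset.sum_comm]
    refine Finset.sum_congr rfl fun k _ => ?_
    change (star (S k).1 * (S k).1) y z = _
    rw [LFKernel.mul_apply_of_subset _ _ y z (finite_ball y R).toFinset]
    · rfl
    · intro r hr _
      exact hball r k fun h => hr (by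
        change (starRingEnd ℂ) (v' r k y) = 0
        rw [h, map_zero])
  · intro x hx
    rw [Function.mem_support, ← hsum] at hx
    obtain ⟨k, -, hk⟩ := Finset.exists_ne_zero_of_sum_ne_zero hx
    exact hball x k fun h => hk (by rw [h, map_zero, zero_mul])

end BoxSpace

/-! ### The Poincaré inequality of a linking graph -/

section Link

open Matrix

open scoped MatrixOrder in
theorem Matrix.PosSemidef.exists_transpose_mul_self {V : Type*} [Fintype V] [DecidableEq V]
    {Q : Matrix V V ℝ} (hQ : Q.PosSemidef) : ∃ B : Matrix V V ℝ, Q = Bᵀ * B := by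
  obtain ⟨B, hB⟩ := CStarAlgebra.nonneg_iff_eq_star_mul_self.1 hQ.nonneg
  exact ⟨B, by rw [hB, star_eq_conjTranspose, conjTranspose_eq_transpose_of_trivial]⟩

variable {V : Type*} [Fintype V] (L : SimpleGraph V) [DecidableRel L.Adj]

theorem sum_degree_mul (g : V → ℝ) :
    ∑ y, ∑ z with L.Adj y z, g z = ∑ y, L.degree y * g y := by
  simp_rw [Finset.sum_filter]
  rw [Finset.sum_comm]
  refine Finset.sum_congr rfl fun z _ => ?_
  rw [← Finset.sum_filter, Finset.sum_const, nsmul_eq_mul]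
  congr 2
  rw [← SimpleGraph.card_neighborFinset_eq_degree]
  congr 1
  ext y
  simp [SimpleGraph.adj_comm]

/-- The energy of `g` as a sum over edges, each edge occurring once in each direction. -/
theorem energy_eq (g : V → ℝ) :
    2 * ∑ y, g y * (L.degree y * g y - ∑ z with L.Adj y z, g z) =
      ∑ y, ∑ z with L.Adj y z, (g y - g z) ^ 2 := by
  have h1 : ∑ y, ∑ z with L.Adj y z, (g y) ^ 2 = ∑ y, L.degree y * g y ^ 2 := by
    refine Finset.sum_congr rfl fun y _ => ?_
    rw [Finset.sum_const, nsmul_eq_mul]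
    congr 2
    rw [← SimpleGraph.card_neighborFinset_eq_degree]
    congr 1
    ext y
    simp
  have h2 := sum_degree_mul L fun y => g y ^ 2
  have h3 : ∑ y, ∑ z with L.Adj y z, (g y - g z) ^ 2 = (∑ y, ∑ z with L.Adj y z, (g y) ^ 2) +
      (∑ y, ∑ z with L.Adj y z, (g z) ^ 2) - 2 * ∑ y, g y * ∑ z with L.Adj y z, g z := by
    rw [Finset.mul_sum, ← Finset.sum_add_distrib, ← Finset.sum_sub_distrib]
    refine Finset.sum_congr rfl fun y _ => ?_
    rw [Finset.mul_sum, Finset.mul_sum, ← Finset.sum_add_distrib, ← Finset.sum_sub_distrib]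
    refine Finset.sum_congr rfl fun z _ => ?_
    ring
  rw [h3, h1, h2]
  simp only [mul_sub, Finset.sum_sub_distrib]
  have h4 : ∑ y, g y * (L.degree y * g y) = ∑ y, L.degree y * g y ^ 2 :=
    Finset.sum_congr rfl fun y _ => by ring
  rw [h4]
  ring

variable [DecidableEq V]

/-- The matrix of the form `g ↦ lam⁻¹ E(g) - ‖g‖² + |⟨g, 1⟩|² / ‖1‖²`, where
`E(g) = ½ ∑_{y ∼ z} |g(y) - g(z)|²` and the vertices are weighted by their degrees. In a graph without
edges the last term is `0 / 0 = 0`. -/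
noncomputable def linkForm (lam : ℝ) : Matrix V V ℝ := of fun y z =>
  lam⁻¹ * ((if y = z then (L.degree y : ℝ) else 0) - if L.Adj y z then 1 else 0) -
    (if y = z then (L.degree y : ℝ) else 0) +
    L.degree y * L.degree z / ∑ w, (L.degree w : ℝ)

theorem linkForm_mulVec (lam : ℝ) (g : V → ℝ) (y : V) :
    (linkForm L lam *ᵥ g) y = lam⁻¹ * (L.degree y * g y - ∑ z with L.Adj y z, g z) -
      L.degree y * g y + L.degree y * ((∑ z, L.degree z * g z) / ∑ w, (L.degree w : ℝ)) := by
  simp only [linkForm, mulVec, dotProduct, of_apply, add_mul, sub_mul, mul_assoc,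
    Finset.sum_add_distrib, Finset.sum_sub_distrib, ← Finset.mul_sum, ite_mul, zero_mul,
    Finset.sum_ite_eq, Finset.mem_univ, if_true, one_mul, mul_sub]
  congr 1
  · congr 2
    rw [Finset.sum_filter]
  · rw [Finset.sum_div, Finset.mul_sum]
    refine Finset.sum_congr rfl fun z _ => ?_
    ring

/-- If the positive eigenvalues of the random walk Laplace operator of a connected graph are at least
`lam`, then `linkForm L lam` is positive semidefinite: an eigenvector to a negative eigenvalue `θ`,
relative to the degrees, would be orthogonal to the constants, hence an eigenvector of the Laplace
operator to the eigenvalue `lam (1 + θ) < lam`, which is positive as the graph is connected. -/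
theorem linkForm_posSemidef (hL : L.Preconnected) {lam : ℝ} (hlam : 0 < lam)
    (hgap : ∀ μ : ℝ, 0 < μ → (∃ g : V → ℝ, g ≠ 0 ∧
      ∀ y, g y - ∑ z with L.Adj y z, (1 / (L.degree y : ℝ)) * g z = μ * g y) → lam ≤ μ) :
    (linkForm L lam).PosSemidef := by
  rcases subsingleton_or_nontrivial V with hV | hV
  · have hadj : ∀ y z, ¬ L.Adj y z := fun y z h => h.ne (Subsingleton.elim y z)
    have : linkForm L lam = 0 := by
      ext y z
      simp [linkForm, hadj]
    rw [this]
    exact PosSemidef.zero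
  have hdeg : ∀ y, (0 : ℝ) < L.degree y := fun y => by
    exact_mod_cast hL.degree_pos_of_nontrivial y
  -- dividing by the square roots of the degrees makes the relative eigenvalues ordinary ones
  set s : V → ℝ := fun y => Real.sqrt (L.degree y) with hs
  have hs0 : ∀ y, 0 < s y := fun y => Real.sqrt_pos.2 (hdeg y)
  have hss : ∀ y, s y * s y = L.degree y := fun y => Real.mul_self_sqrt (hdeg y).le
  set H : Matrix V V ℝ := of fun y z => linkForm L lam y z / (s y * s z) with hH
  have hQ : linkForm L lam = (diagonal s)ᴴ * H * diagonal s := by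
    ext y z
    have h1 := (hs0 y).ne'
    have h2 := (hs0 z).ne'
    simp only [diagonal_conjTranspose, mul_diagonal, diagonal_mul, hH, of_apply, star_trivial]
    field_simp
  rw [hQ]
  have hHerm : H.IsHermitian := by
    ext y z
    simp only [conjTranspose_apply, star_trivial, hH, of_apply, linkForm]
    rw [mul_comm (s z), mul_comm (L.degree z : ℝ)]
    simp only [L.adj_comm z y, eq_comm (a := z) (b := y)]
    by_cases h : y = z
    · subst h; rfl
    · simp [h]
  refine PosSemidef.conjTranspose_mul_mul_same ?_ _
  rw [hHerm.posSemidef_iff_eigenvalues_nonneg]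
  intro i
  by_contra hneg
  set θ : ℝ := hHerm.eigenvalues i with hθ
  replace hneg : θ < 0 := not_le.1 hneg
  set w : V → ℝ := (hHerm.eigenvectorBasis i).ofLp with hw
  have hw0 : w ≠ 0 := by
    intro h
    have h1 := hHerm.eigenvectorBasis.orthonormal.ne_zero i
    exact h1 (by ext y; exact congrFun h y)
  have hwe : H *ᵥ w = θ • w := by
    have := hHerm.mulVec_eigenvectorBasis i
    simpa using this
  set g : V → ℝ := fun y => w y / s y with hg
  have hg0 : g ≠ 0 := by
    intro h
    refine hw0 (funext fun y => ?_)
    have := congrFun h y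
    simp only [hg, Pi.zero_apply, div_eq_zero_iff, (hs0 y).ne', or_false] at this
    exact this
  set M : ℝ := ∑ y, (L.degree y : ℝ) with hM
  have hM0 : 0 < M := Finset.sum_pos (fun y _ => hdeg y) Finset.univ_nonempty
  set avg : ℝ := (∑ z, L.degree z * g z) / M with havg
  -- the generalized eigenvalue equation
  have heq : ∀ y, (linkForm L lam *ᵥ g) y = θ * (L.degree y * g y) := by
    intro y
    have h1 := congrFun hwe y
    simp only [mulVec, dotProduct, hH, of_apply, Pi.smul_apply, smul_eq_mul] at h1
    have h2 : ∑ z, linkForm L lam y z * g z = s y * ∑ z, linkForm L lam y z / (s y * s z) * w z := by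
      rw [Finset.mul_sum]
      refine Finset.sum_congr rfl fun z _ => ?_
      have h1 := (hs0 y).ne'
      have h2 := (hs0 z).ne'
      simp only [hg]
      field_simp
    change ∑ z, linkForm L lam y z * g z = _
    rw [h2, h1, ← hss y]
    have h1 := (hs0 y).ne'
    simp only [hg]
    field_simp
  simp_rw [linkForm_mulVec] at heq
  -- summing the equation over all vertices shows that `g` has mean zero
  have hzero : ∑ z, L.degree z * g z = 0 := by
    have h1 := Finset.sum_congr (s₁ := Finset.univ) rfl fun y _ => heq y
    simp only [Finset.sum_add_distrib, Finset.sum_sub_distrib, ← Finset.mul_sum,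
      sum_degree_mul, ← Finset.sum_mul, sub_self, mul_zero, zero_sub] at h1
    rw [← hM, mul_div_cancel₀ _ hM0.ne', neg_add_cancel] at h1
    rcases mul_eq_zero.1 h1.symm with h | h
    · exact absurd h hneg.ne
    · exact h
  rw [hzero] at heq
  simp only [zero_div, mul_zero, add_zero] at heq
  have heq' : ∀ y, L.degree y * g y - ∑ z with L.Adj y z, g z =
      lam * (1 + θ) * (L.degree y * g y) := by
    intro y
    have h1 := heq y
    have h2 : lam * (lam⁻¹ * (L.degree y * g y - ∑ z with L.Adj y z, g z)) =
        lam * ((1 + θ) * (L.degree y * g y)) := by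
      congr 1
      linarith
    rwa [mul_inv_cancel_left₀ hlam.ne', ← mul_assoc] at h2
  have hμ : lam * (1 + θ) < lam := by nlinarith
  rcases lt_or_ge 0 (lam * (1 + θ)) with hpos | hnonpos
  · refine absurd (hgap _ hpos ⟨g, hg0, fun y => ?_⟩) (not_le.2 hμ)
    have h1 := (hdeg y).ne'
    rw [← Finset.mul_sum]
    have h2 := heq' y
    field_simp
    linarith
  · -- a nonpositive eigenvalue forces zero energy, so `g` is constant of mean zero
    have hE := energy_eq L g
    have hE0 : ∑ y, ∑ z with L.Adj y z, (g y - g z) ^ 2 = 0 := by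
      refine le_antisymm ?_ (Finset.sum_nonneg fun y _ => Finset.sum_nonneg fun z _ => sq_nonneg _)
      rw [← hE]
      have : ∑ y, g y * (L.degree y * g y - ∑ z with L.Adj y z, g z) ≤ 0 := by
        refine Finset.sum_nonpos fun y _ => ?_
        rw [heq' y]
        have : 0 ≤ L.degree y * g y ^ 2 := mul_nonneg (hdeg y).le (sq_nonneg _)
        nlinarith
      linarith
    have hadj : ∀ y z, L.Adj y z → g y = g z := by
      intro y z hyz
      have h1 := (Finset.sum_eq_zero_iff_of_nonneg fun y _ =>
        Finset.sum_nonneg fun z _ => sq_nonneg _).1 hE0 y (Finset.mem_univ y)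
      have h2 := (Finset.sum_eq_zero_iff_of_nonneg fun z _ => sq_nonneg _).1 h1 z (by simpa using hyz)
      exact sub_eq_zero.1 (pow_eq_zero_iff two_ne_zero |>.1 h2)
    have hconst : ∀ y z, g y = g z := by
      intro y z
      obtain ⟨p⟩ := hL y z
      induction p with
      | nil => rfl
      | cons h _ ih => exact (hadj _ _ h).trans ih
    obtain ⟨y0⟩ : Nonempty V := inferInstance
    have h1 : M * g y0 = 0 := by
      rw [← hzero, hM, Finset.sum_mul]
      exact Finset.sum_congr rfl fun y _ => by rw [hconst y y0]
    have h2 : g y0 = 0 := (mul_eq_zero.1 h1).resolve_left hM0.ne'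
    exact hg0 (funext fun y => (hconst y y0).trans h2)

end Link

/-! ### Weighted Laplace operators -/

namespace BoxSpace

variable {X : BoxSpace.{u}}

theorem tri_comm (x y : X.Pt) : X.tri x y = X.tri y x := by
  classical
  unfold tri
  rw [Finset.inter_comm]
  simp only [X.total.adj_comm x y]

theorem tri_of_not_adj {x y : X.Pt} (h : ¬ X.total.Adj x y) : X.tri x y = 0 := if_neg h

theorem tri_self (x : X.Pt) : X.tri x x = 0 := tri_of_not_adj (X.total.loopless.irrefl x)

theorem edist_le_one_of_adj {x y : X.Pt} (h : X.total.Adj x y) :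
    X.total.edist x y ≤ (1 : ℕ) := by
  rw [Nat.cast_one, SimpleGraph.edist_le_one_iff_adj_or_eq]
  exact Or.inl h

theorem tri_eq_zero_of_triSum {x : X.Pt} (h : X.triSum x = 0) (y : X.Pt) : X.tri x y = 0 := by
  by_cases hxy : X.total.Adj x y
  · exact Finset.sum_eq_zero_iff.1 h y (by simpa using hxy)
  · exact tri_of_not_adj hxy

open scoped Classical in
/-- `T` is the Laplace operator `(T η)(x) = ∑_{y ∼ x} w(x, y) (η(x) - η(y))` for the edge weights
`w`. -/
def IsWeightedLaplacian (w : X.Pt → X.Pt → ℝ) (T : X.roeAlgebra) : Prop :=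
  ∀ x y, T.1 x y =
    if x = y then ((∑ z ∈ X.total.neighborFinset x, w x z : ℝ) : ℂ) else -(w x y : ℂ)

namespace IsWeightedLaplacian

variable {w w' : X.Pt → X.Pt → ℝ} {T T' : X.roeAlgebra}

theorem add (h : IsWeightedLaplacian w T) (h' : IsWeightedLaplacian w' T') :
    IsWeightedLaplacian (fun x y => w x y + w' x y) (T + T') := by
  intro x y
  change T.1 x y + T'.1 x y = _
  rw [h, h']
  split_ifs
  · rw [Finset.sum_add_distrib]
    push_cast
    ring
  · push_cast
    ring

theorem smul (h : IsWeightedLaplacian w T) (c : ℝ) :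
    IsWeightedLaplacian (fun x y => c * w x y) ((c : ℂ) • T) := by
  intro x y
  change (c : ℂ) * T.1 x y = _
  rw [h]
  split_ifs
  · rw [← Finset.mul_sum]
    push_cast
    ring
  · push_cast
    ring

theorem sub (h : IsWeightedLaplacian w T) (h' : IsWeightedLaplacian w' T') :
    IsWeightedLaplacian (fun x y => w x y - w' x y) (T - T') := by
  intro x y
  change T.1 x y - T'.1 x y = _
  rw [h, h']
  split_ifs
  · rw [Finset.sum_sub_distrib]
    push_cast
    ring
  · push_cast
    ring

theorem congr (h : IsWeightedLaplacian w T) (hw : ∀ x y, w x y = w' x y) :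
    IsWeightedLaplacian w' T := by
  obtain rfl : w = w' := funext fun x => funext fun y => hw x y
  exact h

/-- A Laplace operator with nonnegative weights is the sum of the squares of the differences along the
edges. -/
theorem isSumOfHermitianSquares (h : IsWeightedLaplacian w T)
    (hsymm : ∀ x y, w x y = w y x) (h0 : ∀ x y, 0 ≤ w x y)
    (hadj : ∀ x y, ¬ X.total.Adj x y → w x y = 0) {C : ℝ} (hC : ∀ x y, w x y ≤ C) :
    IsSumOfHermitianSquares T := by
  classical
  obtain ⟨d, hd⟩ := X.exists_degree_le
  rcases isEmpty_or_nonempty X.Pt with hX | ⟨⟨x0⟩⟩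
  · exact ⟨0, Fin.elim0, Subtype.ext (LFKernel.ext fun p => hX.elim p)⟩
  have hC0 : 0 ≤ C := (h0 x0 x0).trans (hC x0 x0)
  let δ : X.Pt → X.Pt → ℝ := fun x a => if a = x then 1 else 0
  let v : ∀ x, X.total.neighborSet x → X.Pt → ℂ := fun x y a =>
    ((Real.sqrt (w x y / 2) * (δ x a - δ y a) : ℝ) : ℂ)
  obtain ⟨T₁, hT₁, hT₁'⟩ := exists_sum_of_local_squares (X := X)
    (ι := fun x => X.total.neighborSet x) (N := d)
    (fun x => by rw [SimpleGraph.card_neighborSet_eq_degree]; exact hd x) v (R := 1)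
    (fun x y a ha => by
      by_cases h1 : a = x
      · subst h1
        simp
      by_cases h2 : a = y
      · subst h2
        exact edist_le_one_of_adj y.2
      exact absurd (by simp [v, δ, h1, h2]) ha) (C := Real.sqrt (C / 2)) (Real.sqrt_nonneg _)
    (fun x y a => by
      rw [Complex.norm_real, Real.norm_eq_abs, abs_mul, abs_of_nonneg (Real.sqrt_nonneg _)]
      refine (mul_le_of_le_one_right (Real.sqrt_nonneg _) ?_).trans
        (Real.sqrt_le_sqrt (by linarith [hC x y]))
      simp only [δ]
      split_ifs <;> norm_num)
  suffices hTT : T = T₁ by rwa [hTT]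
  refine Subtype.ext (LFKernel.ext fun a b => ?_)
  rw [h, hT₁']
  have hsq : ∀ x, ∑ i, (starRingEnd ℂ) (v x i a) * v x i b =
      ((∑ y ∈ X.total.neighborFinset x,
        w x y / 2 * ((δ x a - δ y a) * (δ x b - δ y b)) : ℝ) : ℂ) := by
    intro x
    rw [SimpleGraph.neighborFinset, Finset.sum_subtype (X.total.neighborSet x).toFinset
      (p := fun y => y ∈ X.total.neighborSet x) (by simp)]
    push_cast
    refine Finset.sum_congr rfl fun y _ => ?_
    simp only [v]
    rw [Complex.conj_ofReal, ← Complex.ofReal_mul]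
    have : Real.sqrt (w x y / 2) * Real.sqrt (w x y / 2) = w x y / 2 :=
      Real.mul_self_sqrt (by linarith [h0 x y])
    rw [mul_mul_mul_comm, this]
    push_cast
    rfl
  simp_rw [hsq]
  rw [finsum_eq_sum_of_support_subset (s := insert a (X.total.neighborFinset a))]
  swap
  · intro x hx
    by_contra hn
    simp only [Finset.coe_insert, Set.mem_insert_iff, Finset.mem_coe,
      SimpleGraph.mem_neighborFinset, not_or] at hn
    refine hx (Complex.ofReal_eq_zero.2 (Finset.sum_eq_zero ?_))
    intro y hy
    have h1 : a ≠ y := by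
      rintro rfl
      exact hn.2 (by simpa [X.total.adj_comm] using hy)
    simp [δ, Ne.symm hn.1, h1]
  rw [← Complex.ofReal_sum]
  have hexp : ∀ x y, w x y / 2 * ((δ x a - δ y a) * (δ x b - δ y b)) =
      δ x a * (δ x b * (w x y / 2)) - δ x a * (δ y b * (w x y / 2)) -
        δ x b * (δ y a * (w x y / 2)) + δ y a * (δ y b * (w x y / 2)) := fun x y => by ring
  have hloop : w a a = 0 := hadj a a (X.total.loopless.irrefl a)
  have h1 : ∀ x y, (if y ∈ X.total.neighborFinset x then w x y / 2 else 0) = w x y / 2 := by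
    intro x y
    split_ifs with hxy
    · rfl
    · rw [hadj x y (by simpa using hxy), zero_div]
  simp_rw [hexp, Finset.sum_add_distrib, Finset.sum_sub_distrib, ← Finset.mul_sum]
  simp only [δ, ite_mul, one_mul, zero_mul, Finset.sum_ite_eq, h1]
  have h2 : (if b ∈ insert a (X.total.neighborFinset a) then w b a / 2 else 0) = w a b / 2 := by
    split_ifs with hb
    · rw [hsymm]
    · rw [Finset.mem_insert, not_or] at hb
      rw [hadj a b (by simpa using hb.2), zero_div]
  have h3 : ∀ x, (if a ∈ X.total.neighborFinset x then if b = a then w x a / 2 else 0 else 0) =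
      if b = a then w x a / 2 else 0 := by
    intro x
    rw [← h1 x a]
    split_ifs <;> rfl
  rw [h2]
  simp only [h3, Finset.mem_insert_self, if_true]
  by_cases hab : a = b
  · subst hab
    rw [if_pos rfl, hloop]
    simp only [if_true]
    rw [Finset.sum_insert (by simp), hloop, ← Finset.sum_div, ← Finset.sum_div,
      Finset.sum_congr rfl fun x _ => hsymm x a]
    congr 1
    ring
  · simp only [if_neg hab, if_neg (Ne.symm hab), Finset.sum_const_zero]
    rw [← Complex.ofReal_neg]
    congr 1
    ring

end IsWeightedLaplacian
open scoped Classical in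
/-- Every bounded weight on the edges has a Laplace operator in `ℂ[X]`. -/
theorem exists_isWeightedLaplacian (w : X.Pt → X.Pt → ℝ)
    (hadj : ∀ x y, ¬ X.total.Adj x y → w x y = 0) {C : ℝ} (hC : ∀ x y, |w x y| ≤ C) :
    ∃ T : X.roeAlgebra, IsWeightedLaplacian w T := by
  obtain ⟨d, hd⟩ := X.exists_degree_le
  refine ⟨X.ofLocal (fun x y => if x = y then
    ((∑ z ∈ X.total.neighborFinset x, w x z : ℝ) : ℂ) else -(w x y : ℂ)) (fun x y h => ?_)
    ⟨d * |C| + |C|, fun x y => ?_⟩, fun x y => rfl⟩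
  · by_contra! h'
    exact h (by simp [h'.1, hadj x y h'.2])
  · have h0 : 0 ≤ d * |C| := by positivity
    split_ifs
    · rw [Complex.norm_real, Real.norm_eq_abs]
      have h1 := (Finset.abs_sum_le_sum_abs (fun z => w x z) (X.total.neighborFinset x)).trans
        (Finset.sum_le_card_nsmul _ _ |C| fun z _ => (hC x z).trans (le_abs_self C))
      rw [nsmul_eq_mul, SimpleGraph.card_neighborFinset_eq_degree] at h1
      have h2 : (X.total.degree x : ℝ) * |C| ≤ d * |C| :=
        mul_le_mul_of_nonneg_right (by exact_mod_cast hd x) (abs_nonneg C)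
      linarith [abs_nonneg C]
    · rw [norm_neg, Complex.norm_real, Real.norm_eq_abs]
      linarith [(hC x y).trans (le_abs_self C)]

theorem isWeightedLaplacian_laplacianTri :
    IsWeightedLaplacian (fun x y => (X.tri x y : ℝ)) X.laplacianTri := by
  classical
  intro x y
  refine Eq.trans (b := if x = y then (X.triSum x : ℂ) else -(X.tri x y : ℂ)) ?_ ?_
  · change ite _ _ _ = _
    congr
  · unfold triSum
    push_cast
    congr

open scoped Classical in
theorem isWeightedLaplacian_laplacian :
    IsWeightedLaplacian (fun x y => if X.total.Adj x y then (1 : ℝ) else 0) X.laplacian := by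
  intro x y
  refine Eq.trans (b := if x = y then (X.total.degree x : ℂ) else
      if X.total.Adj x y then -1 else 0) ?_ ?_
  · change ite _ _ _ = _
    congr
  · have h1 : (∑ z ∈ X.total.neighborFinset x, if X.total.Adj x z then (1 : ℝ) else 0) =
        X.total.degree x := by
      rw [Finset.sum_congr rfl fun z hz => if_pos (by simpa using hz), Finset.sum_const,
        SimpleGraph.card_neighborFinset_eq_degree, nsmul_eq_mul, mul_one]
    rw [h1]
    split_ifs with h2 h3
    · simp
    · simp [h3]
    · simp [h3]

theorem isSumOfHermitianSquares_laplacianTri : IsSumOfHermitianSquares X.laplacianTri := by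
  obtain ⟨d, hd⟩ := X.exists_degree_le
  exact isWeightedLaplacian_laplacianTri.isSumOfHermitianSquares
    (fun x y => by rw [tri_comm]) (fun x y => Nat.cast_nonneg _)
    (fun x y h => by rw [tri_of_not_adj h, Nat.cast_zero]) (C := d)
    (fun x y => by exact_mod_cast tri_le hd x y)

theorem star_laplacianTri : star X.laplacianTri = X.laplacianTri :=
  isSumOfHermitianSquares_laplacianTri.isSelfAdjoint

/-! ### Edges contained in no triangle -/

/-- If the linking graphs are connected, an edge in no triangle is a connected component. -/
theorem eq_of_tri_eq_zero (hconn : ∀ x : X.Pt, (X.link x).Preconnected) {x y z : X.Pt}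
    (hxy : X.total.Adj x y) (h : X.tri x y = 0) (hz : X.total.Adj x z) : z = y := by
  classical
  by_contra hne
  have : Nontrivial (X.total.neighborSet x) :=
    ⟨⟨z, hz⟩, ⟨y, hxy⟩, fun h => hne (congrArg Subtype.val h)⟩
  have h1 := (hconn x).degree_pos_of_nontrivial ⟨y, hxy⟩
  obtain ⟨w, hw⟩ := (SimpleGraph.degree_pos_iff_exists_adj _ _).1 h1
  rw [tri, if_pos hxy, Finset.card_eq_zero] at h
  have h2 : w.1 ∈ X.total.neighborFinset x ∩ X.total.neighborFinset y := by
    rw [Finset.mem_inter, SimpleGraph.mem_neighborFinset, SimpleGraph.mem_neighborFinset]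
    exact ⟨w.2, hw⟩
  rw [h] at h2
  simp at h2

/-- The Laplace operator `b` of the edges in no triangle. As these edges are components of `X`, the
square of `b` is `2 b`, and `b` is orthogonal to `Δ_τ`. -/
theorem exists_laplacian_of_no_triangle (hconn : ∀ x : X.Pt, (X.link x).Preconnected) :
    ∃ b : X.roeAlgebra, IsWeightedLaplacian
      (open scoped Classical in fun x y => if X.total.Adj x y ∧ X.tri x y = 0 then (1 : ℝ) else 0) b ∧
      IsSumOfHermitianSquares b ∧
      b * b = (2 : ℂ) • b ∧ X.laplacianTri * b = 0 ∧ b * X.laplacianTri = 0 := by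
  classical
  set w : X.Pt → X.Pt → ℝ := fun x y => if X.total.Adj x y ∧ X.tri x y = 0 then (1 : ℝ) else 0
    with hw
  have hsymm : ∀ x y, w x y = w y x := fun x y => by
    simp only [hw, X.total.adj_comm x y, tri_comm x y]
  have hadj : ∀ x y, ¬ X.total.Adj x y → w x y = 0 := fun x y h => if_neg fun h' => h h'.1
  have h0 : ∀ x y, 0 ≤ w x y := fun x y => by simp only [hw]; split_ifs <;> norm_num
  have h1 : ∀ x y, w x y ≤ 1 := fun x y => by simp only [hw]; split_ifs <;> norm_num
  obtain ⟨b, hb⟩ := exists_isWeightedLaplacian w hadj (C := 1) fun x y => by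
    rw [abs_of_nonneg (h0 x y)]
    exact h1 x y
  have hsos := hb.isSumOfHermitianSquares hsymm h0 hadj h1
  -- the rows of `b`
  have hrow : ∀ x y, X.total.Adj x y → X.tri x y = 0 → ∀ z, b.1 x z =
      (if x = z then 1 else 0) - if y = z then 1 else 0 := by
    intro x y hxy h z
    have hN : X.total.neighborFinset x = {y} := by
      ext z
      simp only [SimpleGraph.mem_neighborFinset, Finset.mem_singleton]
      exact ⟨eq_of_tri_eq_zero hconn hxy h, fun h' => h' ▸ hxy⟩
    have hwxy : w x y = 1 := if_pos ⟨hxy, h⟩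
    rw [hb]
    by_cases hxz : x = z
    · subst hxz
      simp [hN, hwxy, hxy.ne']
    · by_cases hyz : y = z
      · subst hyz
        simp [hwxy, hxz]
      · have : w x z = 0 := hadj x z fun h' => hyz (eq_of_tri_eq_zero hconn hxy h h').symm
        simp [hxz, hyz, this]
  have hrow0 : ∀ x, (∀ y, X.total.Adj x y → X.tri x y ≠ 0) → ∀ z, b.1 x z = 0 := by
    intro x h z
    have hw0 : ∀ y, w x y = 0 := fun y => if_neg fun h' => h y h'.1 h'.2
    rw [hb]
    simp [hw0]
  have hprod : X.laplacianTri * b = 0 := by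
    refine Subtype.ext (LFKernel.ext fun x z => ?_)
    by_contra hne
    obtain ⟨r, h2, h3⟩ := LFKernel.exists_ne_of_finsum_ne_zero hne
    obtain ⟨y, hy, hy'⟩ : ∃ y, X.total.Adj r y ∧ X.tri r y = 0 := by
      by_contra! hc
      exact h3 (hrow0 r hc z)
    have htri : ∀ s, X.tri r s = 0 := fun s => by
      by_cases hs : X.total.Adj r s
      · rw [eq_of_tri_eq_zero hconn hy hy' hs, hy']
      · exact tri_of_not_adj hs
    refine h2 ?_
    rw [isWeightedLaplacian_laplacianTri x r]
    by_cases hxr : x = r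
    · subst hxr
      simp [htri]
    · simp [hxr, tri_comm x r, htri]
  have hsa : star b = b := hsos.isSelfAdjoint
  refine ⟨b, hb, hsos, ?_, hprod, ?_⟩
  · refine Subtype.ext (LFKernel.ext fun x z => ?_)
    change (b.1 * b.1) x z = (2 : ℂ) * b.1 x z
    by_cases h : ∃ y, X.total.Adj x y ∧ X.tri x y = 0
    · obtain ⟨y, hxy, h⟩ := h
      have hyx : ∀ z, b.1 y z = (if y = z then 1 else 0) - if x = z then 1 else 0 :=
        hrow y x hxy.symm (by rw [tri_comm, h])
      rw [LFKernel.mul_apply_of_subset _ _ x z {x, y}, Finset.sum_pair hxy.ne]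
      · rw [hrow x y hxy h x, hrow x y hxy h y, hrow x y hxy h z, hyx z]
        simp only [if_true, if_neg hxy.ne, if_neg hxy.ne']
        ring
      · intro r hr _
        rw [hrow x y hxy h r] at hr
        by_contra hn
        simp only [Finset.mem_insert, Finset.mem_singleton, not_or] at hn
        exact hr (by simp [Ne.symm hn.1, Ne.symm hn.2])
    · push Not at h
      rw [hrow0 x h z, mul_zero, LFKernel.mul_apply_of_subset _ _ x z ∅, Finset.sum_empty]
      intro r hr _
      exact absurd (hrow0 x h r) hr
  · have := congrArg star hprod
    rwa [star_mul, hsa, star_laplacianTri, star_zero] at this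

end BoxSpace

/-! ### The sum of the forms of the linking graphs -/

theorem LFKernel.diag_mul_apply {P : Type u} (h : P → ℂ) (a : LFKernel P) (p q : P) :
    (LFKernel.diag h * a) p q = h p * a p q := by
  rw [LFKernel.mul_apply_of_subset _ _ p q {p}, Finset.sum_singleton, LFKernel.diag_apply,
    if_pos rfl]
  intro r hr _
  by_contra hn
  exact hr (if_neg fun h' => hn (by simp [h']))

theorem LFKernel.mul_diag_apply {P : Type u} (a : LFKernel P) (h : P → ℂ) (p q : P) :
    (a * LFKernel.diag h) p q = a p q * h q := by
  rw [LFKernel.mul_apply_of_subset _ _ p q {q}, Finset.sum_singleton, LFKernel.diag_apply,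
    if_pos rfl]
  intro r _ hr
  by_contra hn
  exact hr (if_neg fun h' => hn (by simp [h']))

namespace BoxSpace

variable {X : BoxSpace.{u}}

open scoped Classical in
theorem link_degree (x : X.Pt) (y : X.total.neighborSet x) :
    (X.link x).degree y = X.tri x y := by
  have hxy : X.total.Adj x y := y.2
  rw [tri, if_pos hxy, ← SimpleGraph.card_neighborFinset_eq_degree,
    ← Finset.card_map (Function.Embedding.subtype _)]
  congr 1
  ext z
  simp only [Finset.mem_map, SimpleGraph.mem_neighborFinset, Finset.mem_inter]
  constructor
  · rintro ⟨z, hz, rfl⟩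
    exact ⟨z.2, hz⟩
  · rintro ⟨h1, h2⟩
    exact ⟨⟨z, h1⟩, h2, rfl⟩

open scoped Classical in
theorem sum_link_degree (x : X.Pt) :
    ∑ y, ((X.link x).degree y : ℝ) = X.triSum x := by
  simp_rw [link_degree]
  rw [triSum, Nat.cast_sum, SimpleGraph.neighborFinset,
    Finset.sum_subtype (X.total.neighborSet x).toFinset
      (p := fun y => y ∈ X.total.neighborSet x) (by simp)]

open scoped Classical in
theorem posSemidef_link (x : X.Pt) (hconn : (X.link x).Preconnected) {lam : ℝ} (hlam : 0 < lam)
    (hgap : (lam : EReal) ≤ X.lambda1 x) : (linkForm (X.link x) lam).PosSemidef := by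
  refine linkForm_posSemidef _ hconn hlam fun μ hμ => ?_
  rintro ⟨g, hg0, hg⟩
  have h1 : X.lambda1 x ≤ (μ : EReal) := by
    refine sInf_le ⟨μ, hμ, ?_, rfl⟩
    refine Module.End.hasEigenvalue_of_hasEigenvector (x := fun y => (g y : ℂ))
      ⟨Module.End.mem_eigenspace_iff.2 (funext fun y => ?_), fun h => hg0 (funext fun y => ?_)⟩
    · have h2 := congrArg (fun r : ℝ => (r : ℂ)) (hg y)
      simp only [link_degree] at h2
      push_cast at h2
      simp only [Pi.smul_apply, smul_eq_mul]
      rw [← h2]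
      rfl
    · exact Complex.ofReal_eq_zero.1 (congrFun h y)
  exact_mod_cast hgap.trans h1

open scoped Classical in
/-- The matrix `linkForm (X.link x) lam`, extended by zero to `X × X`. -/
noncomputable def localForm (lam : ℝ) (x y z : X.Pt) : ℝ :=
  if h : X.total.Adj x y ∧ X.total.Adj x z then
    linkForm (X.link x) lam ⟨y, h.1⟩ ⟨z, h.2⟩ else 0

open scoped Classical in
theorem localForm_eq {lam : ℝ} {x y : X.Pt} (hxy : X.total.Adj x y) (z : X.Pt) :
    localForm lam x y z =
      lam⁻¹ * ((if y = z then (X.tri x y : ℝ) else 0) -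
        if z ∈ X.total.neighborFinset x ∩ X.total.neighborFinset y then 1 else 0) -
      (if y = z then (X.tri x y : ℝ) else 0) + X.tri y x * (X.triSum x : ℝ)⁻¹ * X.tri x z := by
  unfold localForm
  by_cases hxz : X.total.Adj x z
  · rw [dif_pos ⟨hxy, hxz⟩]
    simp only [linkForm, Matrix.of_apply, sum_link_degree]
    have h0 : (⟨y, hxy⟩ : X.total.neighborSet x) = ⟨z, hxz⟩ ↔ y = z := Subtype.mk_eq_mk
    have h1 : (X.link x).Adj ⟨y, hxy⟩ ⟨z, hxz⟩ ↔
        z ∈ X.total.neighborFinset x ∩ X.total.neighborFinset y := by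
      rw [Finset.mem_inter, SimpleGraph.mem_neighborFinset, SimpleGraph.mem_neighborFinset]
      exact ⟨fun h => ⟨hxz, h⟩, fun h => h.2⟩
    simp only [link_degree, h0, h1, tri_comm y x]
    ring
  · have h1 : y ≠ z := fun h => hxz (h ▸ hxy)
    have h2 : z ∉ X.total.neighborFinset x ∩ X.total.neighborFinset y := fun h =>
      hxz (by simpa using (Finset.mem_inter.1 h).1)
    rw [dif_neg fun h => hxz h.2, if_neg h1, if_neg h2, tri_of_not_adj hxz]
    simp

/-- The local forms at the points of `Y` add up to a sum of hermitian squares. Its row at `y` is the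
sum of all local forms if all neighbours of `y` are in `Y`. -/
theorem exists_sum_localForm (hconn : ∀ x : X.Pt, (X.link x).Preconnected)
    {Y : ∀ i, Set (X.V i)} {lam : ℝ} (hlam : 0 < lam)
    (hgap : ∀ i, ∀ x ∈ Y i, (lam : EReal) ≤ X.lambda1 ⟨i, x⟩) :
    ∃ T : X.roeAlgebra, IsSumOfHermitianSquares T ∧ ∀ y z,
      (∀ x, X.total.Adj y x → x.2 ∈ Y x.1) →
      T.1 y z = ((∑ x ∈ X.total.neighborFinset y, localForm lam x y z : ℝ) : ℂ) := by
  classical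
  obtain ⟨d, hd⟩ := X.exists_degree_le
  have hB : ∀ x : X.Pt, ∃ B : Matrix (X.total.neighborSet x) (X.total.neighborSet x) ℝ,
      (x.2 ∈ Y x.1 → linkForm (X.link x) lam = B.transpose * B) ∧
      ∀ k y, |B k y| ≤ Real.sqrt (lam⁻¹ * d + d) := by
    intro x
    by_cases hx : x.2 ∈ Y x.1
    · obtain ⟨B, hB⟩ := (posSemidef_link x (hconn x) hlam
        (hgap x.1 x.2 hx)).exists_transpose_mul_self
      refine ⟨B, fun _ => hB, fun k y => Real.abs_le_sqrt ?_⟩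
      have h1 : linkForm (X.link x) lam y y = ∑ k, B k y ^ 2 := by
        rw [hB, Matrix.mul_apply]
        exact Finset.sum_congr rfl fun k _ => by rw [Matrix.transpose_apply, pow_two]
      have h2 : B k y ^ 2 ≤ ∑ k, B k y ^ 2 :=
        Finset.single_le_sum (f := fun k => B k y ^ 2) (fun _ _ => sq_nonneg _) (Finset.mem_univ k)
      refine h2.trans (h1.symm.le.trans ?_)
      have hdeg : ((X.link x).degree y : ℝ) ≤ d := by
        rw [link_degree]
        exact_mod_cast tri_le hd x y
      have hM : ((X.link x).degree y : ℝ) ≤ ∑ w, ((X.link x).degree w : ℝ) :=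
        Finset.single_le_sum (f := fun w => ((X.link x).degree w : ℝ))
          (fun _ _ => Nat.cast_nonneg _) (Finset.mem_univ y)
      have h0 : (0 : ℝ) ≤ (X.link x).degree y := Nat.cast_nonneg _
      have h3 : ((X.link x).degree y : ℝ) * (X.link x).degree y /
          ∑ w, ((X.link x).degree w : ℝ) ≤ (X.link x).degree y :=
        div_le_of_le_mul₀ (h0.trans hM) h0 (mul_le_mul_of_nonneg_left hM h0)
      have h4 : lam⁻¹ * ((X.link x).degree y : ℝ) ≤ lam⁻¹ * d :=
        mul_le_mul_of_nonneg_left hdeg (inv_nonneg.2 hlam.le)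
      simp only [linkForm, Matrix.of_apply, if_true, SimpleGraph.irrefl, if_false, sub_zero]
      linarith
    · exact ⟨0, fun h => absurd h hx, fun k y => by
        rw [Matrix.zero_apply, abs_zero]
        exact Real.sqrt_nonneg _⟩
  choose B hBeq hBbd using hB
  let v : ∀ x : X.Pt, X.total.neighborSet x → X.Pt → ℂ := fun x k a =>
    if h : x.2 ∈ Y x.1 ∧ X.total.Adj x a then (B x k ⟨a, h.2⟩ : ℂ) else 0
  obtain ⟨T, hT, hT'⟩ := exists_sum_of_local_squares (X := X)
    (ι := fun x => X.total.neighborSet x) (N := d)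
    (fun x => by rw [SimpleGraph.card_neighborSet_eq_degree]; exact hd x) v (R := 1)
    (fun x k a ha => by
      by_cases h : x.2 ∈ Y x.1 ∧ X.total.Adj x a
      · exact edist_le_one_of_adj h.2
      · exact absurd (dif_neg h) ha) (C := Real.sqrt (lam⁻¹ * d + d)) (Real.sqrt_nonneg _)
    (fun x k a => by
      simp only [v]
      split_ifs
      · rw [Complex.norm_real]
        exact hBbd x k _
      · rw [norm_zero]
        exact Real.sqrt_nonneg _)
  refine ⟨T, hT, fun y z hy => ?_⟩
  rw [hT', finsum_eq_sum_of_support_subset (s := X.total.neighborFinset y), Complex.ofReal_sum]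
  · refine Finset.sum_congr rfl fun x hx => ?_
    have hyx : X.total.Adj y x := by simpa using hx
    have hxY := hy x hyx
    by_cases hz : X.total.Adj x z
    · have h1 : ∀ k, (starRingEnd ℂ) (v x k y) * v x k z =
          ((B x k ⟨y, hyx.symm⟩ * B x k ⟨z, hz⟩ : ℝ) : ℂ) := by
        intro k
        simp only [v, dif_pos (And.intro hxY hyx.symm), dif_pos (And.intro hxY hz)]
        rw [Complex.conj_ofReal, Complex.ofReal_mul]
      rw [localForm, dif_pos ⟨hyx.symm, hz⟩, hBeq x hxY, Matrix.mul_apply, Complex.ofReal_sum]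
      exact Finset.sum_congr rfl fun k _ => h1 k
    · rw [localForm, dif_neg fun h => hz h.2, Complex.ofReal_zero]
      refine Finset.sum_eq_zero fun k _ => ?_
      have : v x k z = 0 := dif_neg fun h => hz h.2
      rw [this, mul_zero]
  · intro x hx
    by_contra hn
    refine hx (Finset.sum_eq_zero fun k _ => ?_)
    have : v x k y = 0 := dif_neg fun h => hn (by simpa using h.2.symm)
    rw [this, map_zero, zero_mul]

/-- The sum of all local forms is `Δ_τ τ⁻¹ Δ_τ - (2 - 1 / lam) Δ_τ`, where `τ⁻¹` is the diagonal matrix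
of the inverses of `τ(x)`, with `0⁻¹ = 0`. -/
theorem laplacianTri_mul_inv_mul_apply {lam : ℝ} (y z : X.Pt) :
    ((X.laplacianTri.1 * LFKernel.diag (fun x => (X.triSum x : ℂ)⁻¹) * X.laplacianTri.1 -
      ((2 - 1 / lam : ℝ) : ℂ) • X.laplacianTri.1 : LFKernel X.Pt)) y z =
      ((∑ x ∈ X.total.neighborFinset y, localForm lam x y z : ℝ) : ℂ) := by
  classical
  set D : LFKernel X.Pt := LFKernel.diag fun x => (X.triSum x : ℂ) with hD
  set E : LFKernel X.Pt := LFKernel.diag fun x => (X.triSum x : ℂ)⁻¹ with hE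
  -- the adjacency matrix with weights `τ(x, y)`
  set A : LFKernel X.Pt := D - X.laplacianTri.1 with hA
  have hAD : X.laplacianTri.1 = D - A := by rw [hA, sub_sub_cancel]
  have hAapp : ∀ x y, A x y = (X.tri x y : ℂ) := by
    intro x y
    rw [hA, LFKernel.sub_apply, isWeightedLaplacian_laplacianTri x y, hD, LFKernel.diag_apply]
    by_cases hxy : x = y
    · subst hxy
      simp [tri_self, triSum]
    · simp [hxy]
  -- if `τ(x) = 0`, the row of `A` at `x` vanishes
  have hcancel : ∀ x y, (X.triSum x : ℂ) * ((X.triSum x : ℂ)⁻¹ * X.tri x y) = X.tri x y := by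
    intro x y
    by_cases h : X.triSum x = 0
    · simp [tri_eq_zero_of_triSum h]
    · rw [mul_inv_cancel_left₀ (by exact_mod_cast h)]
  have h1 : D * E * D = D := by
    ext x y
    rw [mul_assoc, hD, LFKernel.diag_mul_apply, hE, LFKernel.diag_mul_apply, LFKernel.diag_apply]
    split_ifs
    · by_cases h : (X.triSum x : ℂ) = 0
      · simp [h]
      · rw [mul_inv_cancel_left₀ h]
    · simp
  have h2 : D * E * A = A := by
    ext x y
    rw [mul_assoc, hD, LFKernel.diag_mul_apply, hE, LFKernel.diag_mul_apply, hAapp, hcancel]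
  have h3 : A * E * D = A := by
    ext x y
    rw [hD, LFKernel.mul_diag_apply, hE, LFKernel.mul_diag_apply, hAapp, tri_comm, mul_assoc,
      mul_comm, mul_comm (_⁻¹) (_ : ℂ), mul_assoc, hcancel]
  have h4 : X.laplacianTri.1 * E * X.laplacianTri.1 -
      ((2 - 1 / lam : ℝ) : ℂ) • X.laplacianTri.1 = ((lam⁻¹ : ℝ) : ℂ) • (D - A) - D + A * E * A := by
    have h5 : (D - A) * E * (D - A) = D * E * D - D * E * A - (A * E * D - A * E * A) := by
      noncomm_ring
    rw [hAD, h5, h1, h2, h3, one_div, Complex.ofReal_sub, sub_smul]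
    rw [show ((2 : ℝ) : ℂ) = 1 + 1 by norm_num, add_smul, one_smul]
    abel
  rw [h4]
  have hADapp : (A * E * A) y z =
      ∑ x ∈ X.total.neighborFinset y, (X.tri y x : ℂ) * (X.triSum x : ℂ)⁻¹ * X.tri x z := by
    rw [LFKernel.mul_apply_of_subset _ _ y z (X.total.neighborFinset y)]
    · refine Finset.sum_congr rfl fun x _ => ?_
      rw [hE, LFKernel.mul_diag_apply, hAapp, hAapp]
    · intro r hr _
      rw [hE, LFKernel.mul_diag_apply, hAapp] at hr
      by_contra hn
      exact hr (by rw [tri_of_not_adj (by simpa using hn), Nat.cast_zero, zero_mul])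
  rw [LFKernel.add_apply, LFKernel.sub_apply, LFKernel.smul_apply, LFKernel.sub_apply, hADapp, hAapp,
    hD, LFKernel.diag_apply]
  rw [Finset.sum_congr rfl fun x hx => localForm_eq (lam := lam)
    (show X.total.Adj x y by simpa [X.total.adj_comm] using hx) z]
  have htri : ∑ x ∈ X.total.neighborFinset y,
      (if z ∈ X.total.neighborFinset x ∩ X.total.neighborFinset y then (1 : ℝ) else 0) =
      X.tri y z := by
    rw [Finset.sum_boole, tri]
    congr 1
    split_ifs with hyz
    · congr 1
      ext x
      simp [hyz, X.total.adj_comm x z]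
    · rw [Finset.card_eq_zero, Finset.filter_eq_empty_iff]
      intro x _ h
      exact hyz (by simpa using (Finset.mem_inter.1 h).2)
  have hdiag : ∑ x ∈ X.total.neighborFinset y, (if y = z then (X.tri x y : ℝ) else 0) =
      if y = z then (X.triSum y : ℝ) else 0 := by
    split_ifs
    · rw [triSum, Nat.cast_sum]
      exact Finset.sum_congr rfl fun x _ => by rw [tri_comm]
    · exact Finset.sum_const_zero
  rw [Finset.sum_add_distrib, Finset.sum_sub_distrib, ← Finset.mul_sum, Finset.sum_sub_distrib,
    htri, hdiag]
  push_cast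
  split_ifs <;> simp

/-- Up to a matrix whose nonzero rows lie near the complement of `Y`, the matrix
`Δ_τ² - (2 - 1 / lam) Δ_τ` is a sum of hermitian squares, namely of the local forms at the points of
`Y` and of `Δ_τ (1 - τ⁻¹) Δ_τ`. -/
theorem exists_isSumOfHermitianSquares_near (hconn : ∀ x : X.Pt, (X.link x).Preconnected)
    {Y : ∀ i, Set (X.V i)} {lam : ℝ} (hlam : 0 < lam)
    (hgap : ∀ i, ∀ x ∈ Y i, (lam : EReal) ≤ X.lambda1 ⟨i, x⟩) :
    ∃ T : X.roeAlgebra, IsSumOfHermitianSquares T ∧ ∀ y z,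
      (X.laplacianTri ^ 2 - ((2 - 1 / lam : ℝ) : ℂ) • X.laplacianTri - T).1 y z ≠ 0 →
        ∃ x, X.total.edist y x ≤ (1 : ℕ) ∧ x.2 ∉ Y x.1 := by
  classical
  obtain ⟨T, hT, hT'⟩ := exists_sum_localForm hconn hlam hgap
  set E : LFKernel X.Pt := LFKernel.diag fun x => (X.triSum x : ℂ)⁻¹ with hE
  have hEapp : ∀ x, E x x = (((X.triSum x : ℝ)⁻¹ : ℝ) : ℂ) := fun x => by
    rw [hE, LFKernel.diag_apply, if_pos rfl]
    push_cast
    rfl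
  have hinv : ∀ x, (E x x).re ≤ 1 := fun x => by
    rw [hEapp, Complex.ofReal_re]
    exact Nat.cast_inv_le_one _
  have hinv0 : ∀ x, 0 ≤ (E x x).re := fun x => by
    rw [hEapp, Complex.ofReal_re]
    positivity
  have hsq := LFKernel.star_diag_mul_diag (a := E) (M := 1)
    (fun p q hpq => by rw [hE, LFKernel.diag_apply, if_neg hpq])
    (fun p => by rw [hEapp, Complex.ofReal_im]) hinv
  set F : X.roeAlgebra := ⟨LFKernel.diag fun p => ((Real.sqrt (1 - (E p p).re) : ℝ) : ℂ),
    diag_mem_roeAlgebra (C := 1) fun x => by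
      rw [Complex.norm_real, Real.norm_of_nonneg (Real.sqrt_nonneg _)]
      exact Real.sqrt_le_one.2 (by linarith [hinv0 x])⟩ with hF
  have hsa : star X.laplacianTri = X.laplacianTri := star_laplacianTri
  refine ⟨star (F * X.laplacianTri) * (F * X.laplacianTri) + T,
    (isSumOfHermitianSquares_star_mul_self _).add hT, fun y z hne => ?_⟩
  by_contra! hY
  refine hne ?_
  have h1 : (star (F * X.laplacianTri) * (F * X.laplacianTri)).1 =
      X.laplacianTri.1 * X.laplacianTri.1 - X.laplacianTri.1 * E * X.laplacianTri.1 := by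
    rw [star_mul, hsa]
    change X.laplacianTri.1 * star F.1 * (F.1 * X.laplacianTri.1) = _
    rw [mul_assoc, ← mul_assoc (star F.1), hsq, Complex.ofReal_one, one_smul]
    noncomm_ring
  have h2 := laplacianTri_mul_inv_mul_apply (X := X) (lam := lam) y z
  rw [← hT' y z fun x hx => hY x (edist_le_one_of_adj hx)] at h2
  change ((X.laplacianTri ^ 2).1 - ((2 - 1 / lam : ℝ) : ℂ) • X.laplacianTri.1 -
    ((star (F * X.laplacianTri) * (F * X.laplacianTri)).1 + T.1)) y z = 0
  rw [h1, LFKernel.sub_apply, LFKernel.add_apply, ← h2, ← LFKernel.add_apply,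
    ← LFKernel.sub_apply]
  have h3 : (X.laplacianTri ^ 2).1 = X.laplacianTri.1 * X.laplacianTri.1 := by
    rw [pow_two]
    rfl
  rw [h3, ← hE, show ∀ a b c : LFKernel X.Pt, a - c - (a - b + (b - c)) = 0 from
    fun a b c => by abel]
  rfl

/-! ### Spectral gaps of the Laplace operators -/

/-- In every image of `ℂ[X]`, the gap `2 - 1 / lam` of `Δ_τ` in terms of hermitian squares gives
spectral gaps of `Δ` and `Δ_τ`. -/
theorem hasSpectralGapMax_map {A : Type u} [Ring A] [StarRing A] [Algebra ℂ A] [MaxNormFinite A]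
    (φ : X.roeAlgebra →⋆ₐ[ℂ] A) (hconn : ∀ x : X.Pt, (X.link x).Preconnected) {lam : ℝ}
    (hlam : 1 / 2 < lam)
    (h : IsSumOfHermitianSquares (φ X.laplacianTri ^ 2 -
      ((2 - 1 / lam : ℝ) : ℂ) • φ X.laplacianTri)) :
    (∃ c : ℝ, 0 < c ∧ HasSpectralGapMax (φ X.laplacian) c) ∧
      HasSpectralGapMax (φ X.laplacianTri) (2 - 1 / lam) := by
  classical
  have hlam0 : 0 < lam := by linarith
  have hc : 0 < 2 - 1 / lam := by
    rw [sub_pos, div_lt_iff₀ hlam0]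
    linarith
  refine ⟨?_, (isSumOfHermitianSquares_laplacianTri.map φ).hasSpectralGapMax h⟩
  obtain ⟨b, hb, hbsos, hbb, hτb, hbτ⟩ := exists_laplacian_of_no_triangle hconn
  obtain ⟨d, hd⟩ := X.exists_degree_le
  have hd' := tri_le hd
  have hd0 : (0 : ℝ) ≤ d := Nat.cast_nonneg d
  have hL := isWeightedLaplacian_laplacian (X := X)
  have hB := isWeightedLaplacian_laplacianTri.add hb
  refine ⟨(2 - 1 / lam) / (d + 1), by positivity,
    hasSpectralGapMax_of_comparable (b := φ (X.laplacianTri + b)) hc (by positivity) ?_ ?_ ?_ ?_⟩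
  · refine IsSumOfHermitianSquares.map φ
      (hL.isSumOfHermitianSquares (fun x y => ?_) (fun x y => ?_) (fun x y hxy => if_neg hxy)
        (C := 1) fun x y => ?_)
    · simp only [X.total.adj_comm x y]
    · split_ifs <;> norm_num
    · split_ifs <;> norm_num
  · rw [← map_sub]
    refine IsSumOfHermitianSquares.map φ ((hB.sub hL).isSumOfHermitianSquares
      (fun x y => ?_) (fun x y => ?_) (fun x y hxy => ?_) (C := d + 1) fun x y => ?_)
    · simp only [X.total.adj_comm x y, tri_comm x y]
    · by_cases h1 : X.total.Adj x y
      · by_cases h2 : X.tri x y = 0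
        · simp [h1, h2]
        · have : (1 : ℝ) ≤ X.tri x y := by exact_mod_cast Nat.one_le_iff_ne_zero.2 h2
          simp [h1, h2, this]
      · simp [h1]
    · simp [hxy, tri_of_not_adj hxy]
    · have h3 : (X.tri x y : ℝ) ≤ d := by exact_mod_cast hd' x y
      split_ifs <;> linarith
  · rw [← map_smul, ← map_sub]
    have hS := (hL.smul (d + 1 : ℝ)).sub hB
    refine IsSumOfHermitianSquares.map φ (hS.isSumOfHermitianSquares
      (fun x y => ?_) (fun x y => ?_) (fun x y hxy => ?_) (C := d + 1) fun x y => ?_)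
    · simp only [X.total.adj_comm x y, tri_comm x y]
    · have h3 : (X.tri x y : ℝ) ≤ d := by exact_mod_cast hd' x y
      by_cases h1 : X.total.Adj x y
      · by_cases h2 : X.tri x y = 0
        · simp [h1, h2]
        · simp only [h1, h2, if_true, and_false, if_false]
          linarith
      · simp [h1, tri_of_not_adj h1]
    · simp [hxy, tri_of_not_adj hxy]
    · have h3 : (0 : ℝ) ≤ X.tri x y := Nat.cast_nonneg _
      split_ifs <;> linarith
  · -- `(Δ_τ + b)² - c (Δ_τ + b) = (Δ_τ² - c Δ_τ) + (2 - c) b`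
    have hsq : (X.laplacianTri + b) ^ 2 = X.laplacianTri ^ 2 + (2 : ℂ) • b := by
      rw [pow_two, add_mul, mul_add, mul_add, hτb, hbτ, hbb, pow_two, add_zero, zero_add]
    have hrew : φ (X.laplacianTri + b) ^ 2 - ((2 - 1 / lam : ℝ) : ℂ) • φ (X.laplacianTri + b) =
        (φ X.laplacianTri ^ 2 - ((2 - 1 / lam : ℝ) : ℂ) • φ X.laplacianTri) +
          φ (((1 / lam : ℝ) : ℂ) • b) := by
      rw [← map_pow, hsq, map_add, map_add, map_smul, map_smul, map_pow, smul_add,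
        Complex.ofReal_sub, sub_smul _ _ (φ b)]
      rw [show ((2 : ℝ) : ℂ) = 2 by norm_num]
      abel
    rw [hrew]
    refine h.add (IsSumOfHermitianSquares.map φ ?_)
    exact hbsos.smul (by positivity)

end BoxSpace

theorem theorem7p3 (X : BoxSpace.{u})
    (hconn : ∀ x : X.Pt, (X.link x).Preconnected)
    (Y : ∀ i, Set (X.V i))
    (hY : Tendsto (fun i => ((Y i).ncard : ℝ) / (Nat.card (X.V i) : ℝ)) atTop (𝓝 1))
    (lam : ℝ) (hlam : 1 / 2 < lam)
    (hgap : ∀ i, ∀ x ∈ Y i, (lam : EReal) ≤ X.lambda1 ⟨i, x⟩) :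
    (X.AlmostBoundaryT (BoxSpace.core Y) ∧
      HasSpectralGapMax (BoxSpace.restrict (BoxSpace.core Y) X.laplacianTri) (2 - 1 / lam) ∧
      IsSumOfHermitianSquares (BoxSpace.restrict (BoxSpace.core Y) X.laplacianTri ^ 2 -
        ((2 - 1 / lam : ℝ) : ℂ) • BoxSpace.restrict (BoxSpace.core Y) X.laplacianTri)) ∧
    ((∀ i, Y i = Set.univ) →
      X.GeometricPropertyT ∧
      HasSpectralGapMax X.laplacianTri (2 - 1 / lam) ∧
      IsSumOfHermitianSquares
        (X.laplacianTri ^ 2 - ((2 - 1 / lam : ℝ) : ℂ) • X.laplacianTri)) := by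
  obtain ⟨T, hT, hrest⟩ := BoxSpace.exists_isSumOfHermitianSquares_near hconn (by linarith : 0 < lam) hgap
  constructor
  · have h : IsSumOfHermitianSquares (BoxSpace.restrictHom (BoxSpace.core Y) X.laplacianTri ^ 2 -
        ((2 - 1 / lam : ℝ) : ℂ) • BoxSpace.restrictHom (BoxSpace.core Y) X.laplacianTri) := by
      have h1 := BoxSpace.restrict_core_eq_zero hrest
      rw [← BoxSpace.restrictHom_apply, map_sub, sub_eq_zero, map_sub, map_pow, map_smul] at h1
      rw [h1]
      exact hT.map _
    obtain ⟨h1, h2⟩ := BoxSpace.hasSpectralGapMax_map _ hconn hlam h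
    exact ⟨h1, h2, h⟩
  · intro hYuniv
    have h : IsSumOfHermitianSquares
        (X.laplacianTri ^ 2 - ((2 - 1 / lam : ℝ) : ℂ) • X.laplacianTri) := by
      have h1 : X.laplacianTri ^ 2 - ((2 - 1 / lam : ℝ) : ℂ) • X.laplacianTri = T := by
        refine sub_eq_zero.1 (Subtype.ext (LFKernel.ext fun y z => ?_))
        by_contra hne
        obtain ⟨x, -, hx⟩ := hrest y z hne
        exact hx (by rw [hYuniv]; trivial)
      rw [h1]
      exact hT
    obtain ⟨h1, h2⟩ := BoxSpace.hasSpectralGapMax_map (StarAlgHom.id ℂ X.roeAlgebra) hconn hlam h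
    exact ⟨h1, h2, h⟩
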